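/- Let $\Bbbk$ be an algebraically closed field; all categories and functors are $\Bbbk$-linear. **Setting.** A *2-semicategory* $\mathcal C$ is defined like a 2-category, with strictly associative horizontal composition $(G,F)\mapsto GF$, but without identity 1-morphisms. A *lax unit* at an object $i$ is a 1-morphism $I_i\in\mathcal C(i,i)$ with natural transformations $l_F\colon I_iF\to F$ and $r_G\colon GI_i\to G$ ($F\in\mathcal C(j,i)$, $G\in\mathcal C(i,k)$) such that $\mathrm{id}_G\,l_F=r_G\,\mathrm{id}_F$, $l_{FH}=l_F\,\mathrm{id}_H$ and $r_{KG}=\mathrm{id}_K\,r_G$. It is a *weak unit* if all $l_F,r_G$ are isomorphisms. An *oplax unit* $(I'_i,l',r')$ is defined dually. A *bilax-unital 2-category* is a 2-semicategory with a lax unit $I_i$ and an oplax unit $I_i'$ at every object $i$. It is *finitary* if it has finitely many objects, each $\mathcal C(i,j)$ is additive and idempotent split with finite-dimensional morphism spaces and finitely many isomorphism classes of indecomposable objects, and all $I_i$, $I'_i$ are indecomposable. A pair $(F,G)$ with $F\in\mathcal C(i,j)$, $G\in\mathcal C(j,i)$ is an *adjoint pair*, with adjunction morphisms $\alpha\colon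 I'_i\to GF$ and $\beta\colon FG\to I_j$, if the composites $F\xrightarrow{r'_F}FI'_i\xrightarrow{\mathrm{id}_F\alpha}FGF\xrightarrow{\beta\,\mathrm{id}_F}I_jF\xrightarrow{l_F}F$ and $G\xrightarrow{l'_G}I'_iG\xrightarrow{\alpha\,\mathrm{id}_G}GFG\xrightarrow{\mathrm{id}_G\beta}GI_j\xrightarrow{r_G}G$ are identities. A finitary bilax-unital 2-category is *fiax* if there is an equivalence $(-)^\star\colon\mathcal C\to\mathcal C^{\mathrm{op},\mathrm{op}}$, the identity on objects and compatible with horizontal composition up to coherent isomorphisms $(GF)^\star\cong F^\star G^\star$, such that, modulo these isomorphisms, 1. there are identifications $(I_i)^\star\cong I'_i$ under which $(l_F)^\star=r'_{F^\star}$ and $(r_G)^\star=l'_{G^\star}$ for all $F,G$; 2. for each $F\in\mathcal C(j,i)$ there are adjunction morphisms $\alpha_F\colon I'_j\to F^\star F$, $\beta_F\colon FF^\star\to I_i$ making $(F,F^\star)$ an adjoint pair; 3. each $\gamma\colon F\to G$ in $\mathcal C(j,i)$ has $\gamma^\star$ equal to $G^\star\xrightarrow{l'}I'_jG^\star\xrightarrow{\alpha_F\mathrm{id}}F^\star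 FG^\star\xrightarrow{\mathrm{id}\,\gamma\,\mathrm{id}}F^\star GG^\star\xrightarrow{\mathrm{id}\,\beta_G}F^\star I_i\xrightarrow{r}F^\star$; 4. $(-)^{\star\star}\cong\mathrm{Id}_{\mathcal C}$, naturally in 2-morphisms and compatibly with horizontal composition. A 2-semicategory with weak units $\mathbb 1_i$ is called *fiat with weak units* if it is fiax with respect to $I_i=I'_i=\mathbb 1_i$, where the oplax unitors are the inverses of the unitors. **Projective abelianization.** $\overline{\mathcal C}$ has the same objects as $\mathcal C$. Its 1-morphisms $i\to j$ are pairs of an $X\in\mathcal C(i,j)$ and a finite list of 2-morphisms $f_a\colon Y_a\to X$ in $\mathcal C(i,j)$ (representing the cokernel of $\bigoplus_aY_a\to X$). Its 2-morphisms $(X,(f_a))\to(X',(f'_b))$ are the $g\colon X\to X'$ such that each $g\circ f_a$ has the form $\sum_bf'_b\circ h_{a,b}$, modulo those of the form $\sum_bf'_b\circ q_b$. The composite $(X,(f_a))(X',(f'_b))$ is $XX'$ with the list of all $\mathrm{id}_X f'_b$ followed by all $f_a\,\mathrm{id}_{X'}$. $\mathcal C$ embeds into $\overline{\mathcal C}$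 through empty lists. **Statement.** Let $\mathcal C=(\mathcal C,I,I')$ be a fiax category. For every object $i$, the 2-morphisms $l_{I_i},r_{I_i}\colon I_iI_i\to I_i$ have a coequalizer in $\overline{\mathcal C}(i,i)$. For each $i$ choose one, $\xi_i\colon I_i\to\mathbb 1_i$. Let $\widehat{\mathcal C}(i,i)$ be the full subcategory of $\overline{\mathcal C}(i,i)$ on the additive closure of $\mathcal C(i,i)$ and $\mathbb 1_i$ (direct summands of finite direct sums) and, for $i\ne j$, let $\widehat{\mathcal C}(i,j)$ be the full subcategory of $\overline{\mathcal C}(i,j)$ on the 1-morphisms isomorphic to one in $\mathcal C(i,j)$. Then: 1. $\widehat{\mathcal C}$ is closed under horizontal composition, hence is a 2-full sub-2-semicategory of $\overline{\mathcal C}$ (with strictly associative composition). Each $\mathbb 1_i$ has the structure of a weak unit of $\widehat{\mathcal C}$, with unitors $\hat l,\hat r$ satisfying $\hat l_F\circ(\xi_i\,\mathrm{id}_F)=l_F$ and $\hat r_G\circ(\mathrm{id}_G\,\xi_i)=r_G$ for all 1-morphisms $F\in\mathcal C(j,i)$, $G\in\mathcal C(i,k)$. So $\widehat{\mathcal C}$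 is a 2-category with weak units. 2. For these weak units, $\widehat{\mathcal C}$ is fiat: it is finitary (in particular each $\mathbb 1_i$ is indecomposable), and the given $(-)^\star$ on $\mathcal C$ extends, up to isomorphism natural in 2-morphisms and compatible with horizontal composition, to a weak involution on $\widehat{\mathcal C}$ satisfying 1–4 with $I_i=I'_i=\mathbb 1_i$. In particular $\mathbb 1_i^\star\cong\mathbb 1_i$, and $(F,F^\star)$ is an adjoint pair in the classical sense for every 1-morphism $F$ of $\widehat{\mathcal C}$. -/

import Mathlib

open CategoryTheory CategoryTheory.Limits

universe v u w x

/-! ## Finitary categories -/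

/-- A finitary `k`-linear category: additive, idempotent split, with finite-dimensional spaces of
morphisms and finitely many isomorphism classes of indecomposable objects. -/
class IsFinitaryCategory (k : Type x) [Field k] (A : Type u) [Category.{v} A] [Preadditive A]
    [Linear k A] : Prop where
  hasFiniteBiproducts : HasFiniteBiproducts A
  isIdempotentComplete : IsIdempotentComplete A
  finiteDimensional_hom : ∀ X Y : A, FiniteDimensional k (X ⟶ Y)
  finite_indecomposables :
    haveI : HasBinaryBiproducts A := HasBinaryBiproducts.of_hasBinaryProducts
    ∃ s : Set A, s.Finite ∧ ∀ X : A, Indecomposable X → ∃ Y ∈ s, Nonempty (X ≅ Y)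

/-! ## 2-semicategories -/

/-- A `k`-linear 2-semicategory with object class `B`, where horizontal composition is associative
up to a coherent isomorphism; it is a 2-semicategory in the strict sense when `IsStrict` holds.
The horizontal composite `hcomp G F` of `F : i → j` and `G : j → m` is written `G ⊚ F`. -/
structure TwoSemicat (k : Type x) [Field k] (B : Type w) where
  Hom : B → B → Type u
  [cat : ∀ i j, Category.{v} (Hom i j)]
  [preadditive : ∀ i j, Preadditive (Hom i j)]
  [linear : ∀ i j, Linear k (Hom i j)]
  hcomp : ∀ {i j m : B}, Hom j m → Hom i j → Hom i m
  whiskerLeft : ∀ {i j m : B} (G : Hom j m) {F F' : Hom i j}, (F ⟶ F') → (hcomp G F ⟶ hcomp G F')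
  whiskerRight : ∀ {i j m : B} {G G' : Hom j m}, (G ⟶ G') → ∀ F : Hom i j, hcomp G F ⟶ hcomp G' F
  associator : ∀ {i j m n : B} (H : Hom m n) (G : Hom j m) (F : Hom i j),
    hcomp (hcomp H G) F ≅ hcomp H (hcomp G F)
  whiskerLeft_id : ∀ {i j m : B} (G : Hom j m) (F : Hom i j), whiskerLeft G (𝟙 F) = 𝟙 (hcomp G F)
  whiskerLeft_comp : ∀ {i j m : B} (G : Hom j m) {F F' F'' : Hom i j} (f : F ⟶ F') (f' : F' ⟶ F''),
    whiskerLeft G (f ≫ f') = whiskerLeft G f ≫ whiskerLeft G f'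
  id_whiskerRight : ∀ {i j m : B} (G : Hom j m) (F : Hom i j), whiskerRight (𝟙 G) F = 𝟙 (hcomp G F)
  comp_whiskerRight : ∀ {i j m : B} {G G' G'' : Hom j m} (g : G ⟶ G') (g' : G' ⟶ G'')
    (F : Hom i j), whiskerRight (g ≫ g') F = whiskerRight g F ≫ whiskerRight g' F
  /-- The interchange law. -/
  whisker_exchange : ∀ {i j m : B} {G G' : Hom j m} {F F' : Hom i j} (g : G ⟶ G') (f : F ⟶ F'),
    whiskerLeft G f ≫ whiskerRight g F' = whiskerRight g F ≫ whiskerLeft G' f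
  whiskerLeft_add : ∀ {i j m : B} (G : Hom j m) {F F' : Hom i j} (f f' : F ⟶ F'),
    whiskerLeft G (f + f') = whiskerLeft G f + whiskerLeft G f'
  whiskerLeft_smul : ∀ {i j m : B} (G : Hom j m) {F F' : Hom i j} (c : k) (f : F ⟶ F'),
    whiskerLeft G (c • f) = c • whiskerLeft G f
  add_whiskerRight : ∀ {i j m : B} {G G' : Hom j m} (g g' : G ⟶ G') (F : Hom i j),
    whiskerRight (g + g') F = whiskerRight g F + whiskerRight g' F
  smul_whiskerRight : ∀ {i j m : B} {G G' : Hom j m} (c : k) (g : G ⟶ G') (F : Hom i j),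
    whiskerRight (c • g) F = c • whiskerRight g F
  associator_naturality_left : ∀ {i j m n : B} {H H' : Hom m n} (h : H ⟶ H') (G : Hom j m)
    (F : Hom i j), whiskerRight (whiskerRight h G) F ≫ (associator H' G F).hom =
      (associator H G F).hom ≫ whiskerRight h (hcomp G F)
  associator_naturality_middle : ∀ {i j m n : B} (H : Hom m n) {G G' : Hom j m} (g : G ⟶ G')
    (F : Hom i j), whiskerRight (whiskerLeft H g) F ≫ (associator H G' F).hom =
      (associator H G F).hom ≫ whiskerLeft H (whiskerRight g F)
  associator_naturality_right : ∀ {i j m n : B} (H : Hom m n) (G : Hom j m) {F F' : Hom i j}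
    (f : F ⟶ F'), whiskerLeft (hcomp H G) f ≫ (associator H G F').hom =
      (associator H G F).hom ≫ whiskerLeft H (whiskerLeft G f)
  pentagon : ∀ {i j m n p : B} (K : Hom n p) (H : Hom m n) (G : Hom j m) (F : Hom i j),
    whiskerRight (associator K H G).hom F ≫ (associator K (hcomp H G) F).hom ≫
        whiskerLeft K (associator H G F).hom =
      (associator (hcomp K H) G F).hom ≫ (associator K H (hcomp G F)).hom

namespace TwoSemicat

attribute [instance] TwoSemicat.cat TwoSemicat.preadditive TwoSemicat.linear

infixr:75 " ⊚ " => TwoSemicat.hcomp _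
infixr:81 " ◁ₛ " => TwoSemicat.whiskerLeft _
infixl:81 " ▷ₛ " => TwoSemicat.whiskerRight _

variable {k : Type x} [Field k] {B : Type w}

/-- The associativity isomorphism `(H ⊚ G) ⊚ F ≅ H ⊚ (G ⊚ F)`. -/
abbrev assoc {C : TwoSemicat.{v, u} k B} {i j m n : B} (H : C.Hom m n) (G : C.Hom j m)
    (F : C.Hom i j) : (H ⊚ G) ⊚ F ≅ H ⊚ (G ⊚ F) :=
  C.associator H G F

/-- Horizontal composition is strictly associative, and the associativity isomorphisms are the
identities. -/
structure IsStrict (C : TwoSemicat.{v, u} k B) : Prop where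
  hcomp_assoc : ∀ {i j m n : B} (H : C.Hom m n) (G : C.Hom j m) (F : C.Hom i j),
    (H ⊚ G) ⊚ F = H ⊚ (G ⊚ F)
  associator_eq : ∀ {i j m n : B} (H : C.Hom m n) (G : C.Hom j m) (F : C.Hom i j),
    assoc H G F = eqToIso (hcomp_assoc H G F)

/-! ## Lax and oplax units -/

/-- A lax unit structure on a 1-morphism `I : i → i`. -/
structure LaxUnit (C : TwoSemicat.{v, u} k B) {i : B} (I : C.Hom i i) where
  l : ∀ {j : B} (F : C.Hom j i), I ⊚ F ⟶ F
  r : ∀ {m : B} (G : C.Hom i m), G ⊚ I ⟶ G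
  l_naturality : ∀ {j : B} {F F' : C.Hom j i} (f : F ⟶ F'), (I ◁ₛ f) ≫ l F' = l F ≫ f
  r_naturality : ∀ {m : B} {G G' : C.Hom i m} (g : G ⟶ G'), (g ▷ₛ I) ≫ r G' = r G ≫ g
  compat : ∀ {j m : B} (F : C.Hom j i) (G : C.Hom i m),
    (assoc G I F).hom ≫ (G ◁ₛ l F) = r G ▷ₛ F
  l_hcomp : ∀ {j n : B} (F : C.Hom j i) (H : C.Hom n j),
    (assoc I F H).hom ≫ l (F ⊚ H) = l F ▷ₛ H
  r_hcomp : ∀ {m n : B} (K : C.Hom m n) (G : C.Hom i m),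
    r (K ⊚ G) = (assoc K G I).hom ≫ (K ◁ₛ r G)

/-- An oplax unit structure on a 1-morphism `I : i → i`. -/
structure OplaxUnit (C : TwoSemicat.{v, u} k B) {i : B} (I : C.Hom i i) where
  l : ∀ {j : B} (F : C.Hom j i), F ⟶ I ⊚ F
  r : ∀ {m : B} (G : C.Hom i m), G ⟶ G ⊚ I
  l_naturality : ∀ {j : B} {F F' : C.Hom j i} (f : F ⟶ F'), f ≫ l F' = l F ≫ (I ◁ₛ f)
  r_naturality : ∀ {m : B} {G G' : C.Hom i m} (g : G ⟶ G'), g ≫ r G' = r G ≫ (g ▷ₛ I)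
  compat : ∀ {j m : B} (F : C.Hom j i) (G : C.Hom i m),
    G ◁ₛ l F = (r G ▷ₛ F) ≫ (assoc G I F).hom
  l_hcomp : ∀ {j n : B} (F : C.Hom j i) (H : C.Hom n j),
    l (F ⊚ H) = (l F ▷ₛ H) ≫ (assoc I F H).hom
  r_hcomp : ∀ {m n : B} (K : C.Hom m n) (G : C.Hom i m),
    r (K ⊚ G) ≫ (assoc K G I).hom = K ◁ₛ r G

/-- A weak unit is a lax unit whose unitors are isomorphisms. -/
structure WeakUnit (C : TwoSemicat.{v, u} k B) {i : B} (I : C.Hom i i) extends LaxUnit C I where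
  [isIso_l : ∀ {j : B} (F : C.Hom j i), IsIso (l F)]
  [isIso_r : ∀ {m : B} (G : C.Hom i m), IsIso (r G)]

attribute [instance] WeakUnit.isIso_l WeakUnit.isIso_r

/-- The inverse unitors of a weak unit make it into an oplax unit. -/
noncomputable def WeakUnit.toOplaxUnit {C : TwoSemicat.{v, u} k B} {i : B} {I : C.Hom i i}
    (U : WeakUnit C I) : OplaxUnit C I where
  l F := inv (U.l F)
  r G := inv (U.r G)
  l_naturality f := by
    rw [IsIso.comp_inv_eq, Category.assoc, U.l_naturality, IsIso.inv_hom_id_assoc]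
  r_naturality g := by
    rw [IsIso.comp_inv_eq, Category.assoc, U.r_naturality, IsIso.inv_hom_id_assoc]
  compat F G := by
    have h := U.compat F G
    have h1 : (G ◁ₛ inv (U.l F)) ≫ (G ◁ₛ U.l F) = 𝟙 _ := by
      rw [← C.whiskerLeft_comp, IsIso.inv_hom_id, C.whiskerLeft_id]
    have h2 : (inv (U.r G) ▷ₛ F) ≫ (U.r G ▷ₛ F) = 𝟙 _ := by
      rw [← C.comp_whiskerRight, IsIso.inv_hom_id, C.id_whiskerRight]
    have h3 : (G ◁ₛ U.l F) ≫ (G ◁ₛ inv (U.l F)) = 𝟙 _ := by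
      rw [← C.whiskerLeft_comp, IsIso.hom_inv_id, C.whiskerLeft_id]
    calc G ◁ₛ inv (U.l F)
        = ((inv (U.r G) ▷ₛ F) ≫ (U.r G ▷ₛ F)) ≫ (G ◁ₛ inv (U.l F)) := by
          rw [h2, Category.id_comp]
      _ = _ := by rw [← h]; simp only [Category.assoc, h3, Category.comp_id]
  l_hcomp F H := by
    have h2 : (inv (U.l F) ▷ₛ H) ≫ (U.l F ▷ₛ H) = 𝟙 _ := by
      rw [← C.comp_whiskerRight, IsIso.inv_hom_id, C.id_whiskerRight]
    rw [IsIso.inv_eq_of_inv_hom_id]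
    rw [Category.assoc, U.l_hcomp, h2]
  r_hcomp K G := by
    have h1 : (K ◁ₛ U.r G) ≫ (K ◁ₛ inv (U.r G)) = 𝟙 _ := by
      rw [← C.whiskerLeft_comp, IsIso.hom_inv_id, C.whiskerLeft_id]
    rw [IsIso.inv_comp_eq, U.r_hcomp, Category.assoc, h1, Category.comp_id]

/-- A choice of a lax unit and an oplax unit at every object. -/
structure BilaxUnits (C : TwoSemicat.{v, u} k B) where
  I : ∀ i : B, C.Hom i i
  I' : ∀ i : B, C.Hom i i
  lax : ∀ i : B, LaxUnit C (I i)
  oplax : ∀ i : B, OplaxUnit C (I' i)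

/-- A 2-category with weak units, seen as a bilax-unital 2-category. -/
noncomputable def BilaxUnits.ofWeakUnits {C : TwoSemicat.{v, u} k B} {I : ∀ i : B, C.Hom i i}
    (U : ∀ i : B, WeakUnit C (I i)) : BilaxUnits C where
  I := I
  I' := I
  lax i := (U i).toLaxUnit
  oplax i := (U i).toOplaxUnit

/-! ## Finitary bilax-unital 2-categories -/

/-- A finitary bilax-unital 2-category. -/
structure IsFinitary {C : TwoSemicat.{v, u} k B} (U : BilaxUnits C) : Prop where
  finite_obj : Finite B
  finitary_hom : ∀ i j : B, IsFinitaryCategory k (C.Hom i j)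
  indecomposable_I : ∀ i : B,
    haveI := (finitary_hom i i).hasFiniteBiproducts
    haveI : HasBinaryBiproducts (C.Hom i i) := HasBinaryBiproducts.of_hasBinaryProducts
    Indecomposable (U.I i)
  indecomposable_I' : ∀ i : B,
    haveI := (finitary_hom i i).hasFiniteBiproducts
    haveI : HasBinaryBiproducts (C.Hom i i) := HasBinaryBiproducts.of_hasBinaryProducts
    Indecomposable (U.I' i)

/-! ## Adjoint pairs, fiax and fiat structures -/

/-- Adjunction morphisms exhibiting `(F, G)` as an adjoint pair of 1-morphisms. -/
structure AdjointPair {C : TwoSemicat.{v, u} k B} (U : BilaxUnits C) {i j : B} (F : C.Hom i j)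
    (G : C.Hom j i) where
  α : U.I' i ⟶ G ⊚ F
  β : F ⊚ G ⟶ U.I j
  triangle_left :
    (U.oplax i).r F ≫ (F ◁ₛ α) ≫ (assoc F G F).inv ≫ (β ▷ₛ F) ≫ (U.lax j).l F = 𝟙 F
  triangle_right :
    (U.oplax i).l G ≫ (α ▷ₛ G) ≫ (assoc G F G).hom ≫ (G ◁ₛ β) ≫ (U.lax j).r G = 𝟙 G

/-- An equivalence `(_)⋆ : C → C^{op,op}` which is the identity on objects, reverses 1-morphisms
and 2-morphisms, and is compatible with horizontal composition up to a coherent isomorphism `μ`.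
It does not involve any units. -/
structure AntiEquivalence (C : TwoSemicat.{v, u} k B) where
  obj : ∀ {i j : B}, C.Hom i j → C.Hom j i
  map : ∀ {i j : B} {F G : C.Hom i j}, (F ⟶ G) → (obj G ⟶ obj F)
  map_id : ∀ {i j : B} (F : C.Hom i j), map (𝟙 F) = 𝟙 (obj F)
  map_comp : ∀ {i j : B} {F G H : C.Hom i j} (f : F ⟶ G) (g : G ⟶ H),
    map (f ≫ g) = map g ≫ map f
  map_add : ∀ {i j : B} {F G : C.Hom i j} (f g : F ⟶ G), map (f + g) = map f + map g
  map_smul : ∀ {i j : B} {F G : C.Hom i j} (c : k) (f : F ⟶ G), map (c • f) = c • map f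
  /-- The action on 2-morphisms is fully faithful. -/
  map_bijective : ∀ {i j : B} (F G : C.Hom i j),
    Function.Bijective (map : (F ⟶ G) → (obj G ⟶ obj F))
  /-- The action on 1-morphisms is essentially surjective. -/
  obj_essSurj : ∀ {i j : B} (G : C.Hom j i), ∃ F : C.Hom i j, Nonempty (obj F ≅ G)
  μ : ∀ {i j m : B} (G : C.Hom j m) (F : C.Hom i j), obj (G ⊚ F) ≅ obj F ⊚ obj G
  μ_naturality_left : ∀ {i j m : B} {G G' : C.Hom j m} (g : G ⟶ G') (F : C.Hom i j),
    map (g ▷ₛ F) ≫ (μ G F).hom = (μ G' F).hom ≫ (obj F ◁ₛ map g)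
  μ_naturality_right : ∀ {i j m : B} (G : C.Hom j m) {F F' : C.Hom i j} (f : F ⟶ F'),
    map (G ◁ₛ f) ≫ (μ G F).hom = (μ G F').hom ≫ (map f ▷ₛ obj G)
  μ_assoc : ∀ {i j m n : B} (H : C.Hom m n) (G : C.Hom j m) (F : C.Hom i j),
    map (assoc H G F).hom ≫ (μ (H ⊚ G) F).hom ≫ (obj F ◁ₛ (μ H G).hom) =
      (μ H (G ⊚ F)).hom ≫ ((μ G F).hom ▷ₛ obj H) ≫ (assoc (obj F) (obj G) (obj H)).hom

/-- An isomorphism `(_)⋆⋆ ≅ Id`: it is natural in 2-morphisms and compatible with horizontal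
composition. -/
structure AntiEquivalence.DoubleDualIso {C : TwoSemicat.{v, u} k B} (S : AntiEquivalence C) where
  app : ∀ {i j : B} (F : C.Hom i j), S.obj (S.obj F) ≅ F
  naturality : ∀ {i j : B} {F G : C.Hom i j} (f : F ⟶ G),
    S.map (S.map f) ≫ (app G).hom = (app F).hom ≫ f
  app_hcomp : ∀ {i j m : B} (G : C.Hom j m) (F : C.Hom i j),
    (app (G ⊚ F)).hom =
      S.map (S.μ G F).inv ≫ (S.μ (S.obj F) (S.obj G)).hom ≫
        ((app G).hom ▷ₛ S.obj (S.obj F)) ≫ (G ◁ₛ (app F).hom)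

/-- A weak involution making a finitary bilax-unital 2-category fiax. The identifications of the
duals of the lax units with the oplax units, and of the duals of composites with composites of
duals, are given by the isomorphisms `ε` and `μ`. A finitary 2-category with weak units `1_i` is
fiat when it has such a structure for `I_i = I'_i = 1_i`: then `(F, F⋆)` is an adjoint pair in the
classical sense, for each `F`. -/
structure FiaxStructure {C : TwoSemicat.{v, u} k B} (U : BilaxUnits C) extends
    AntiEquivalence C where
  ε : ∀ i : B, obj (U.I i) ≅ U.I' i
  map_l : ∀ {i j : B} (F : C.Hom j i),
    map ((U.lax i).l F) ≫ (μ (U.I i) F).hom ≫ (obj F ◁ₛ (ε i).hom) = (U.oplax i).r (obj F)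
  map_r : ∀ {i m : B} (G : C.Hom i m),
    map ((U.lax i).r G) ≫ (μ G (U.I i)).hom ≫ ((ε i).hom ▷ₛ obj G) = (U.oplax i).l (obj G)
  adj : ∀ {i j : B} (F : C.Hom j i), AdjointPair U F (obj F)
  map_eq : ∀ {i j : B} {F G : C.Hom j i} (γ : F ⟶ G),
    map γ = (U.oplax j).l (obj G) ≫ ((adj F).α ▷ₛ obj G) ≫ (assoc (obj F) F (obj G)).hom ≫
      (obj F ◁ₛ (γ ▷ₛ obj G)) ≫ (obj F ◁ₛ (adj G).β) ≫ (U.lax i).r (obj F)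
  doubleDual : Nonempty toAntiEquivalence.DoubleDualIso

/-! ## Full sub-2-semicategories -/

/-- The 2-full sub-2-semicategory, with the same objects, given by a class of 1-morphisms which is
closed under horizontal composition. -/
def full (C : TwoSemicat.{v, u} k B) (P : ∀ i j : B, ObjectProperty (C.Hom i j))
    (hP : ∀ {i j m : B} (G : C.Hom j m) (F : C.Hom i j), P j m G → P i j F → P i m (G ⊚ F)) :
    TwoSemicat.{v, u} k B where
  Hom i j := (P i j).FullSubcategory
  hcomp G F := ⟨G.obj ⊚ F.obj, hP _ _ G.property F.property⟩
  whiskerLeft G _ _ f := ObjectProperty.homMk (G.obj ◁ₛ f.hom)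
  whiskerRight g F := ObjectProperty.homMk (g.hom ▷ₛ F.obj)
  associator H G F := ObjectProperty.isoMk _ (assoc H.obj G.obj F.obj)
  whiskerLeft_id _ _ := ObjectProperty.hom_ext _ (C.whiskerLeft_id _ _)
  whiskerLeft_comp _ _ _ _ _ _ := ObjectProperty.hom_ext _ (C.whiskerLeft_comp _ _ _)
  id_whiskerRight _ _ := ObjectProperty.hom_ext _ (C.id_whiskerRight _ _)
  comp_whiskerRight _ _ _ := ObjectProperty.hom_ext _ (C.comp_whiskerRight _ _ _)
  whisker_exchange _ _ := ObjectProperty.hom_ext _ (C.whisker_exchange _ _)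
  whiskerLeft_add _ _ _ _ _ := ObjectProperty.hom_ext _ (C.whiskerLeft_add _ _ _)
  whiskerLeft_smul _ _ _ _ _ := ObjectProperty.hom_ext _ (C.whiskerLeft_smul _ _ _)
  add_whiskerRight _ _ _ := ObjectProperty.hom_ext _ (C.add_whiskerRight _ _ _)
  smul_whiskerRight _ _ _ := ObjectProperty.hom_ext _ (C.smul_whiskerRight _ _ _)
  associator_naturality_left _ _ _ :=
    ObjectProperty.hom_ext _ (C.associator_naturality_left _ _ _)
  associator_naturality_middle _ _ _ _ _ :=
    ObjectProperty.hom_ext _ (C.associator_naturality_middle _ _ _)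
  associator_naturality_right _ _ _ _ _ :=
    ObjectProperty.hom_ext _ (C.associator_naturality_right _ _ _)
  pentagon _ _ _ _ := ObjectProperty.hom_ext _ (C.pentagon _ _ _ _)

end TwoSemicat

/-! ## Projective abelianization of a `k`-linear category -/

/-- An object of the projective abelianization of `A`: an object `X` together with a finite list of
morphisms `f_1 : Y_1 ⟶ X, …, f_n : Y_n ⟶ X`. It represents the cokernel of
`(f_1, …, f_n) : Y_1 ⊕ … ⊕ Y_n ⟶ X`. -/
structure ProjAb (k : Type x) [Field k] (A : Type u) [Category.{v} A] [Preadditive A]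
    [Linear k A] where
  X : A
  rel : List (Σ Y : A, Y ⟶ X)

namespace ProjAb

variable {k : Type x} [Field k] {A : Type u} [Category.{v} A] [Preadditive A] [Linear k A]

/-- The morphisms `Z ⟶ X` of the form `∑ i, q_i ≫ f_i` with `q_i : Z ⟶ Y_i`. -/
def null (P : ProjAb k A) (Z : A) : Submodule k (Z ⟶ P.X) :=
  Submodule.span k {a | ∃ y ∈ P.rel, ∃ q : Z ⟶ y.1, a = q ≫ y.2}

/-- The morphisms `g : X ⟶ X'` which extend to a tuple `(g, h)`, that is, such that each
`f_i ≫ g` is of the form `∑ j, h_{i,j} ≫ f'_j`. -/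
def admissible (P Q : ProjAb k A) : Submodule k (P.X ⟶ Q.X) where
  carrier := {g | ∀ y ∈ P.rel, y.2 ≫ g ∈ Q.null y.1}
  add_mem' := fun {a b} ha hb y hy => by
    rw [Preadditive.comp_add]; exact add_mem (ha y hy) (hb y hy)
  zero_mem' := fun y _ => by rw [comp_zero]; exact zero_mem _
  smul_mem' := fun c a ha y hy => by
    rw [Linear.comp_smul]; exact Submodule.smul_mem _ c (ha y hy)

lemma comp_mem_null (P : ProjAb k A) {W Z : A} (b : W ⟶ Z) {a : Z ⟶ P.X} (ha : a ∈ P.null Z) :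
    b ≫ a ∈ P.null W := by
  have : P.null Z ≤ (P.null W).comap (Linear.leftComp k P.X b) := by
    refine Submodule.span_le.2 ?_
    rintro _ ⟨y, hy, q, rfl⟩
    exact Submodule.subset_span ⟨y, hy, b ≫ q, (Category.assoc _ _ _).symm⟩
  exact this ha

lemma null_comp_mem {P Q : ProjAb k A} {Z : A} {a : Z ⟶ P.X} (ha : a ∈ P.null Z)
    {g : P.X ⟶ Q.X} (hg : g ∈ admissible P Q) : a ≫ g ∈ Q.null Z := by
  have : P.null Z ≤ (Q.null Z).comap (Linear.rightComp k Z g) := by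
    refine Submodule.span_le.2 ?_
    rintro _ ⟨y, hy, q, rfl⟩
    show (q ≫ y.2) ≫ g ∈ Q.null Z
    rw [Category.assoc]
    exact Q.comp_mem_null q (hg y hy)
  exact this ha

lemma id_mem (P : ProjAb k A) : 𝟙 P.X ∈ admissible P P := fun y hy => by
  rw [Category.comp_id]
  exact Submodule.subset_span ⟨y, hy, 𝟙 _, (Category.id_comp _).symm⟩

lemma comp_mem {P Q R : ProjAb k A} {f : P.X ⟶ Q.X} {g : Q.X ⟶ R.X} (hf : f ∈ admissible P Q)
    (hg : g ∈ admissible Q R) : f ≫ g ∈ admissible P R := fun y hy => by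
  rw [← Category.assoc]
  exact null_comp_mem (hf y hy) hg

/-- Morphisms of the projective abelianization: tuples `(g, h)` as in `admissible` up to homotopy.
Since every tuple `(0, h)` is null-homotopic, this is the space of the `g : X ⟶ X'` which extend to
a tuple `(g, h)`, modulo those of the form `∑ j, q_j ≫ f'_j`. -/
abbrev Hom (P Q : ProjAb k A) : Type v :=
  ↥(admissible P Q) ⧸ (Q.null P.X).comap (admissible P Q).subtype

/-- The class of an admissible morphism. -/
def cls {P Q : ProjAb k A} (g : P.X ⟶ Q.X) (hg : g ∈ admissible P Q) : Hom P Q :=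
  Submodule.Quotient.mk ⟨g, hg⟩

lemma cls_surjective {P Q : ProjAb k A} (f : Hom P Q) : ∃ g hg, f = cls g hg := by
  obtain ⟨⟨g, hg⟩, rfl⟩ := Submodule.Quotient.mk_surjective _ f
  exact ⟨g, hg, rfl⟩

lemma cls_eq_cls {P Q : ProjAb k A} {g g' : P.X ⟶ Q.X} {hg : g ∈ admissible P Q}
    {hg' : g' ∈ admissible P Q} : cls g hg = cls g' hg' ↔ g - g' ∈ Q.null P.X :=
  Submodule.Quotient.eq _

/-- Composition, induced by composition in `A`. -/
def comp {P Q R : ProjAb k A} (f : Hom P Q) (g : Hom Q R) : Hom P R :=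
  Quotient.liftOn₂' f g (fun a b => cls (a.1 ≫ b.1) (comp_mem a.2 b.2)) (by
    intro a b a' b' ha hb
    have ha' : a.1 - a'.1 ∈ Q.null P.X := (Submodule.quotientRel_def (Submodule.comap _ _)).1 ha
    have hb' : b.1 - b'.1 ∈ R.null Q.X := (Submodule.quotientRel_def (Submodule.comap _ _)).1 hb
    refine cls_eq_cls.2 ?_
    have : a.1 ≫ b.1 - a'.1 ≫ b'.1 = (a.1 - a'.1) ≫ b.1 + a'.1 ≫ (b.1 - b'.1) := by
      rw [Preadditive.sub_comp, Preadditive.comp_sub]; abel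
    rw [this]
    exact add_mem (null_comp_mem ha' b.2) (R.comp_mem_null _ hb'))

instance : Category.{v} (ProjAb k A) where
  Hom := Hom
  id P := cls (𝟙 P.X) (id_mem P)
  comp := comp
  id_comp f := by
    obtain ⟨f, hf, rfl⟩ := cls_surjective f
    exact cls_eq_cls.2 (by simp)
  comp_id f := by
    obtain ⟨f, hf, rfl⟩ := cls_surjective f
    exact cls_eq_cls.2 (by simp)
  assoc f g h := by
    obtain ⟨f, hf, rfl⟩ := cls_surjective f
    obtain ⟨g, hg, rfl⟩ := cls_surjective g
    obtain ⟨h, hh, rfl⟩ := cls_surjective h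
    exact cls_eq_cls.2 (by simp)

/-- The class of an admissible morphism, as a morphism in the category `ProjAb k A`. -/
def homMk {P Q : ProjAb k A} (g : P.X ⟶ Q.X) (hg : g ∈ admissible P Q) : P ⟶ Q := cls g hg

lemma homMk_surjective {P Q : ProjAb k A} (f : P ⟶ Q) : ∃ g hg, f = homMk g hg := cls_surjective f

lemma homMk_eq {P Q : ProjAb k A} {g g' : P.X ⟶ Q.X} {hg : g ∈ admissible P Q}
    {hg' : g' ∈ admissible P Q} : homMk g hg = homMk g' hg' ↔ g - g' ∈ Q.null P.X := cls_eq_cls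

lemma homMk_congr {P Q : ProjAb k A} {g g' : P.X ⟶ Q.X} {hg : g ∈ admissible P Q}
    {hg' : g' ∈ admissible P Q} (h : g = g') : homMk g hg = homMk g' hg' := by
  subst h; rfl

lemma homMk_id (P : ProjAb k A) : homMk (𝟙 P.X) (id_mem P) = 𝟙 P := rfl

lemma homMk_comp {P Q R : ProjAb k A} {f : P.X ⟶ Q.X} {g : Q.X ⟶ R.X} (hf : f ∈ admissible P Q)
    (hg : g ∈ admissible Q R) : homMk f hf ≫ homMk g hg = homMk (f ≫ g) (comp_mem hf hg) := rfl

instance (P Q : ProjAb k A) : AddCommGroup (P ⟶ Q) := inferInstanceAs (AddCommGroup (Hom P Q))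

instance (P Q : ProjAb k A) : Module k (P ⟶ Q) := inferInstanceAs (Module k (Hom P Q))

lemma homMk_add {P Q : ProjAb k A} {f g : P.X ⟶ Q.X} (hf : f ∈ admissible P Q)
    (hg : g ∈ admissible P Q) : homMk f hf + homMk g hg = homMk (f + g) (add_mem hf hg) := rfl

lemma homMk_smul {P Q : ProjAb k A} (c : k) {f : P.X ⟶ Q.X} (hf : f ∈ admissible P Q) :
    c • homMk f hf = homMk (c • f) (Submodule.smul_mem _ c hf) := rfl

instance : Preadditive (ProjAb k A) where
  add_comp P Q R f f' g := by
    obtain ⟨f, hf, rfl⟩ := homMk_surjective f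
    obtain ⟨f', hf', rfl⟩ := homMk_surjective f'
    obtain ⟨g, hg, rfl⟩ := homMk_surjective g
    rw [homMk_add, homMk_comp, homMk_comp, homMk_comp, homMk_add]
    exact homMk_congr (Preadditive.add_comp _ _ _ _ _ _)
  comp_add P Q R f g g' := by
    obtain ⟨f, hf, rfl⟩ := homMk_surjective f
    obtain ⟨g, hg, rfl⟩ := homMk_surjective g
    obtain ⟨g', hg', rfl⟩ := homMk_surjective g'
    rw [homMk_add, homMk_comp, homMk_comp, homMk_comp, homMk_add]
    exact homMk_congr (Preadditive.comp_add _ _ _ _ _ _)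

instance : Linear k (ProjAb k A) where
  smul_comp P Q R c f g := by
    obtain ⟨f, hf, rfl⟩ := homMk_surjective f
    obtain ⟨g, hg, rfl⟩ := homMk_surjective g
    rw [homMk_smul, homMk_comp, homMk_comp, homMk_smul]
    exact homMk_congr (Linear.smul_comp _ _ _ _ _ _)
  comp_smul P Q R f c g := by
    obtain ⟨f, hf, rfl⟩ := homMk_surjective f
    obtain ⟨g, hg, rfl⟩ := homMk_surjective g
    rw [homMk_smul, homMk_comp, homMk_comp, homMk_smul]
    exact homMk_congr (Linear.comp_smul _ _ _ _ _ _)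

variable (k A) in
/-- The embedding of `A` into its projective abelianization, `X ↦ (X, [])`. -/
def emb : A ⥤ ProjAb k A where
  obj X := ⟨X, []⟩
  map f := homMk f (fun _ hy => absurd hy List.not_mem_nil)
  map_id _ := rfl
  map_comp _ _ := rfl

end ProjAb

/-! ## Projective abelianization of a 2-semicategory -/

namespace TwoSemicat

variable {k : Type x} [Field k] {B : Type w} (C : TwoSemicat.{v, u} k B)

/-- The horizontal composite of `(X, f_1, …, f_n)` and `(X', f'_1, …, f'_m)`: the 1-morphism
`X ⊚ X'` together with the 2-morphisms `X ◁ₛ f'_j` followed by the 2-morphisms `f_i ▷ₛ X'`. -/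
abbrev projAbHcomp {i j m : B} (P : ProjAb k (C.Hom j m)) (Q : ProjAb k (C.Hom i j)) :
    ProjAb k (C.Hom i m) where
  X := P.X ⊚ Q.X
  rel := Q.rel.map (fun y => ⟨P.X ⊚ y.1, P.X ◁ₛ y.2⟩) ++
    P.rel.map (fun y => ⟨y.1 ⊚ Q.X, y.2 ▷ₛ Q.X⟩)

variable {C}

/-- Whiskering as a linear map. -/
def whiskerLeftₗ {i j m : B} (G : C.Hom j m) (F F' : C.Hom i j) :
    (F ⟶ F') →ₗ[k] (G ⊚ F ⟶ G ⊚ F') where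
  toFun f := G ◁ₛ f
  map_add' := C.whiskerLeft_add G
  map_smul' := C.whiskerLeft_smul G

/-- Whiskering as a linear map. -/
def whiskerRightₗ {i j m : B} (G G' : C.Hom j m) (F : C.Hom i j) :
    (G ⟶ G') →ₗ[k] (G ⊚ F ⟶ G' ⊚ F) where
  toFun g := g ▷ₛ F
  map_add' g g' := C.add_whiskerRight g g' F
  map_smul' c g := C.smul_whiskerRight c g F

lemma whiskerLeft_mem_null {i j m : B} (P : ProjAb k (C.Hom j m)) {Q : ProjAb k (C.Hom i j)}
    {Z : C.Hom i j} {a : Z ⟶ Q.X} (ha : a ∈ Q.null Z) :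
    P.X ◁ₛ a ∈ (C.projAbHcomp P Q).null (P.X ⊚ Z) := by
  have : Q.null Z ≤ ((C.projAbHcomp P Q).null (P.X ⊚ Z)).comap (whiskerLeftₗ P.X Z Q.X) := by
    refine Submodule.span_le.2 ?_
    rintro _ ⟨y, hy, q, rfl⟩
    refine Submodule.subset_span ⟨⟨P.X ⊚ y.1, P.X ◁ₛ y.2⟩, ?_, P.X ◁ₛ q, ?_⟩
    · exact List.mem_append_left _ (List.mem_map.2 ⟨y, hy, rfl⟩)
    · exact C.whiskerLeft_comp _ _ _
  exact this ha

lemma whiskerRight_mem_null {i j m : B} {P : ProjAb k (C.Hom j m)} (Q : ProjAb k (C.Hom i j))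
    {Z : C.Hom j m} {a : Z ⟶ P.X} (ha : a ∈ P.null Z) :
    a ▷ₛ Q.X ∈ (C.projAbHcomp P Q).null (Z ⊚ Q.X) := by
  have : P.null Z ≤ ((C.projAbHcomp P Q).null (Z ⊚ Q.X)).comap (whiskerRightₗ Z P.X Q.X) := by
    refine Submodule.span_le.2 ?_
    rintro _ ⟨y, hy, q, rfl⟩
    refine Submodule.subset_span ⟨⟨y.1 ⊚ Q.X, y.2 ▷ₛ Q.X⟩, ?_, q ▷ₛ Q.X, ?_⟩
    · exact List.mem_append_right _ (List.mem_map.2 ⟨y, hy, rfl⟩)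
    · exact C.comp_whiskerRight _ _ _
  exact this ha

/-- To be admissible out of a horizontal composite is a condition on the two kinds of relations. -/
lemma mem_admissible_hcomp {i j m : B} {P : ProjAb k (C.Hom j m)} {Q : ProjAb k (C.Hom i j)}
    {R : ProjAb k (C.Hom i m)} {g : P.X ⊚ Q.X ⟶ R.X}
    (h₁ : ∀ y ∈ Q.rel, (P.X ◁ₛ y.2) ≫ g ∈ R.null (P.X ⊚ y.1))
    (h₂ : ∀ y ∈ P.rel, (y.2 ▷ₛ Q.X) ≫ g ∈ R.null (y.1 ⊚ Q.X)) :
    g ∈ ProjAb.admissible (C.projAbHcomp P Q) R := by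
  intro y hy
  rcases List.mem_append.1 hy with hy | hy
  · obtain ⟨z, hz, rfl⟩ := List.mem_map.1 hy
    exact h₁ z hz
  · obtain ⟨z, hz, rfl⟩ := List.mem_map.1 hy
    exact h₂ z hz

lemma mem_null_self {i j : B} (P : ProjAb k (C.Hom i j)) {y} (hy : y ∈ P.rel) :
    y.2 ∈ P.null y.1 :=
  Submodule.subset_span ⟨y, hy, 𝟙 _, (Category.id_comp _).symm⟩

lemma whiskerLeft_mem {i j m : B} (P : ProjAb k (C.Hom j m)) {Q Q' : ProjAb k (C.Hom i j)}
    {f : Q.X ⟶ Q'.X} (hf : f ∈ ProjAb.admissible Q Q') :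
    P.X ◁ₛ f ∈ ProjAb.admissible (C.projAbHcomp P Q) (C.projAbHcomp P Q') := by
  refine mem_admissible_hcomp (R := C.projAbHcomp P Q') ?_ ?_
  · intro y hy
    rw [← C.whiskerLeft_comp]
    exact whiskerLeft_mem_null P (hf y hy)
  · intro y hy
    rw [← C.whisker_exchange]
    exact ProjAb.comp_mem_null _ _ (whiskerRight_mem_null Q' (mem_null_self P hy))

lemma whiskerRight_mem {i j m : B} {P P' : ProjAb k (C.Hom j m)} (Q : ProjAb k (C.Hom i j))
    {g : P.X ⟶ P'.X} (hg : g ∈ ProjAb.admissible P P') :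
    g ▷ₛ Q.X ∈ ProjAb.admissible (C.projAbHcomp P Q) (C.projAbHcomp P' Q) := by
  refine mem_admissible_hcomp (R := C.projAbHcomp P' Q) ?_ ?_
  · intro y hy
    rw [C.whisker_exchange]
    exact ProjAb.comp_mem_null _ _ (whiskerLeft_mem_null P' (mem_null_self Q hy))
  · intro y hy
    rw [← C.comp_whiskerRight]
    exact whiskerRight_mem_null Q (hg y hy)

/-- Left whiskering in the projective abelianization. -/
def projAbWhiskerLeft {i j m : B} (P : ProjAb k (C.Hom j m)) {Q Q' : ProjAb k (C.Hom i j)}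
    (f : Q ⟶ Q') : C.projAbHcomp P Q ⟶ C.projAbHcomp P Q' :=
  Quotient.liftOn' (s₁ := Submodule.quotientRel _) f
    (fun a => ProjAb.homMk (P := C.projAbHcomp P Q) (Q := C.projAbHcomp P Q') (P.X ◁ₛ a.1)
      (whiskerLeft_mem P a.2)) (by
    intro a a' h
    have h' : a.1 - a'.1 ∈ Q'.null Q.X := (Submodule.quotientRel_def (Submodule.comap _ _)).1 h
    refine ProjAb.homMk_eq.2 ?_
    have e : (P.X ◁ₛ a.1) - (P.X ◁ₛ a'.1) = P.X ◁ₛ (a.1 - a'.1) :=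
      (map_sub (whiskerLeftₗ P.X _ _) _ _).symm
    rw [e]
    exact whiskerLeft_mem_null P h')

/-- Right whiskering in the projective abelianization. -/
def projAbWhiskerRight {i j m : B} {P P' : ProjAb k (C.Hom j m)} (g : P ⟶ P')
    (Q : ProjAb k (C.Hom i j)) : C.projAbHcomp P Q ⟶ C.projAbHcomp P' Q :=
  Quotient.liftOn' (s₁ := Submodule.quotientRel _) g
    (fun a => ProjAb.homMk (P := C.projAbHcomp P Q) (Q := C.projAbHcomp P' Q) (a.1 ▷ₛ Q.X)
      (whiskerRight_mem Q a.2)) (by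
    intro a a' h
    have h' : a.1 - a'.1 ∈ P'.null P.X := (Submodule.quotientRel_def (Submodule.comap _ _)).1 h
    refine ProjAb.homMk_eq.2 ?_
    have e : (a.1 ▷ₛ Q.X) - (a'.1 ▷ₛ Q.X) = (a.1 - a'.1) ▷ₛ Q.X :=
      (map_sub (whiskerRightₗ _ _ Q.X) _ _).symm
    rw [e]
    exact whiskerRight_mem_null Q h')

lemma associator_hom_mem {i j m n : B} (P : ProjAb k (C.Hom m n)) (Q : ProjAb k (C.Hom j m))
    (R : ProjAb k (C.Hom i j)) : (assoc P.X Q.X R.X).hom ∈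
      ProjAb.admissible (C.projAbHcomp (C.projAbHcomp P Q) R)
        (C.projAbHcomp P (C.projAbHcomp Q R)) := by
  refine mem_admissible_hcomp (P := C.projAbHcomp P Q)
    (R := C.projAbHcomp P (C.projAbHcomp Q R)) ?_ ?_
  · intro y hy
    have e := C.associator_naturality_right P.X Q.X y.2
    refine e ▸ ?_
    exact ProjAb.comp_mem_null _ _ (whiskerLeft_mem_null P (Q := C.projAbHcomp Q R)
      (whiskerLeft_mem_null Q (mem_null_self R hy)))
  · intro y hy
    rcases List.mem_append.1 hy with hy | hy
    · obtain ⟨z, hz, rfl⟩ := List.mem_map.1 hy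
      have e := C.associator_naturality_middle P.X z.2 R.X
      refine e ▸ ?_
      exact ProjAb.comp_mem_null _ _ (whiskerLeft_mem_null P (Q := C.projAbHcomp Q R)
        (whiskerRight_mem_null R (mem_null_self Q hz)))
    · obtain ⟨z, hz, rfl⟩ := List.mem_map.1 hy
      have e := C.associator_naturality_left z.2 Q.X R.X
      refine e ▸ ?_
      exact ProjAb.comp_mem_null _ _ (whiskerRight_mem_null (C.projAbHcomp Q R)
        (mem_null_self P hz))

lemma associator_inv_mem {i j m n : B} (P : ProjAb k (C.Hom m n)) (Q : ProjAb k (C.Hom j m))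
    (R : ProjAb k (C.Hom i j)) : (assoc P.X Q.X R.X).inv ∈
      ProjAb.admissible (C.projAbHcomp P (C.projAbHcomp Q R))
        (C.projAbHcomp (C.projAbHcomp P Q) R) := by
  refine mem_admissible_hcomp (Q := C.projAbHcomp Q R)
    (R := C.projAbHcomp (C.projAbHcomp P Q) R) ?_ ?_
  · intro y hy
    rcases List.mem_append.1 hy with hy | hy
    · obtain ⟨z, hz, rfl⟩ := List.mem_map.1 hy
      have e : (P.X ◁ₛ (Q.X ◁ₛ z.2)) ≫ (assoc P.X Q.X R.X).inv =
          (assoc P.X Q.X z.1).inv ≫ ((P.X ⊚ Q.X) ◁ₛ z.2) := by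
        rw [Iso.comp_inv_eq, Category.assoc, C.associator_naturality_right,
          Iso.inv_hom_id_assoc]
      refine e ▸ ?_
      exact ProjAb.comp_mem_null _ _ (whiskerLeft_mem_null (C.projAbHcomp P Q)
        (mem_null_self R hz))
    · obtain ⟨z, hz, rfl⟩ := List.mem_map.1 hy
      have e : (P.X ◁ₛ (z.2 ▷ₛ R.X)) ≫ (assoc P.X Q.X R.X).inv =
          (assoc P.X z.1 R.X).inv ≫ ((P.X ◁ₛ z.2) ▷ₛ R.X) := by
        rw [Iso.comp_inv_eq, Category.assoc, C.associator_naturality_middle,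
          Iso.inv_hom_id_assoc]
      refine e ▸ ?_
      exact ProjAb.comp_mem_null _ _ (whiskerRight_mem_null (P := C.projAbHcomp P Q) R
        (whiskerLeft_mem_null P (mem_null_self Q hz)))
  · intro y hy
    have e : (y.2 ▷ₛ (Q.X ⊚ R.X)) ≫ (assoc P.X Q.X R.X).inv =
        (assoc y.1 Q.X R.X).inv ≫ ((y.2 ▷ₛ Q.X) ▷ₛ R.X) := by
      rw [Iso.comp_inv_eq, Category.assoc, C.associator_naturality_left,
        Iso.inv_hom_id_assoc]
    refine e ▸ ?_
    exact ProjAb.comp_mem_null _ _ (whiskerRight_mem_null (P := C.projAbHcomp P Q) R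
      (whiskerRight_mem_null Q (mem_null_self P hy)))

variable (C) in
/-- The projective abelianization of a 2-semicategory. -/
def projAb : TwoSemicat.{v, max u v} k B where
  Hom i j := ProjAb k (C.Hom i j)
  hcomp P Q := C.projAbHcomp P Q
  whiskerLeft P _ _ f := projAbWhiskerLeft P f
  whiskerRight g Q := projAbWhiskerRight g Q
  associator P Q R :=
    { hom := ProjAb.homMk _ (associator_hom_mem P Q R)
      inv := ProjAb.homMk _ (associator_inv_mem P Q R)
      hom_inv_id := ProjAb.homMk_congr (assoc P.X Q.X R.X).hom_inv_id
      inv_hom_id := ProjAb.homMk_congr (assoc P.X Q.X R.X).inv_hom_id }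
  whiskerLeft_id _ _ := ProjAb.homMk_congr (C.whiskerLeft_id _ _)
  whiskerLeft_comp _ _ _ _ f f' := by
    obtain ⟨f, hf, rfl⟩ := ProjAb.homMk_surjective f
    obtain ⟨f', hf', rfl⟩ := ProjAb.homMk_surjective f'
    exact ProjAb.homMk_congr (C.whiskerLeft_comp _ _ _)
  id_whiskerRight _ _ := ProjAb.homMk_congr (C.id_whiskerRight _ _)
  comp_whiskerRight g g' _ := by
    obtain ⟨g, hg, rfl⟩ := ProjAb.homMk_surjective g
    obtain ⟨g', hg', rfl⟩ := ProjAb.homMk_surjective g'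
    exact ProjAb.homMk_congr (C.comp_whiskerRight _ _ _)
  whisker_exchange g f := by
    obtain ⟨g, hg, rfl⟩ := ProjAb.homMk_surjective g
    obtain ⟨f, hf, rfl⟩ := ProjAb.homMk_surjective f
    exact ProjAb.homMk_congr (C.whisker_exchange _ _)
  whiskerLeft_add _ _ _ f f' := by
    obtain ⟨f, hf, rfl⟩ := ProjAb.homMk_surjective f
    obtain ⟨f', hf', rfl⟩ := ProjAb.homMk_surjective f'
    exact ProjAb.homMk_congr (C.whiskerLeft_add _ _ _)
  whiskerLeft_smul _ _ _ c f := by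
    obtain ⟨f, hf, rfl⟩ := ProjAb.homMk_surjective f
    exact ProjAb.homMk_congr (C.whiskerLeft_smul _ _ _)
  add_whiskerRight g g' _ := by
    obtain ⟨g, hg, rfl⟩ := ProjAb.homMk_surjective g
    obtain ⟨g', hg', rfl⟩ := ProjAb.homMk_surjective g'
    exact ProjAb.homMk_congr (C.add_whiskerRight _ _ _)
  smul_whiskerRight c g _ := by
    obtain ⟨g, hg, rfl⟩ := ProjAb.homMk_surjective g
    exact ProjAb.homMk_congr (C.smul_whiskerRight _ _ _)
  associator_naturality_left h _ _ := by
    obtain ⟨h, hh, rfl⟩ := ProjAb.homMk_surjective h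
    exact ProjAb.homMk_congr (C.associator_naturality_left _ _ _)
  associator_naturality_middle _ _ _ g _ := by
    obtain ⟨g, hg, rfl⟩ := ProjAb.homMk_surjective g
    exact ProjAb.homMk_congr (C.associator_naturality_middle _ _ _)
  associator_naturality_right _ _ _ _ f := by
    obtain ⟨f, hf, rfl⟩ := ProjAb.homMk_surjective f
    exact ProjAb.homMk_congr (C.associator_naturality_right _ _ _)
  pentagon _ _ _ _ := ProjAb.homMk_congr (C.pentagon _ _ _ _)

variable (C) in
/-- The embedding of a 2-semicategory into its projective abelianization. -/
def embed (i j : B) : C.Hom i j ⥤ C.projAb.Hom i j := ProjAb.emb k (C.Hom i j)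

/-! ## Adjoining weak units -/

/-- A choice of a coequalizer `ξ : I_i ⟶ 1_i`, in the projective abelianization, of the two
2-morphisms `l, r : I_i ⊚ I_i ⟶ I_i` given by the left and the right unitor at `I_i`. -/
structure UnitCoequalizer (U : BilaxUnits C) (i : B) where
  one : C.projAb.Hom i i
  ξ : (C.embed i i).obj (U.I i) ⟶ one
  w : (C.embed i i).map ((U.lax i).l (U.I i)) ≫ ξ = (C.embed i i).map ((U.lax i).r (U.I i)) ≫ ξ
  isColimit : IsColimit (Cofork.ofπ ξ w)

/-- The additive closure of a class of objects: the direct summands of finite direct sums of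
objects in the class. -/
def additiveClosure {A : Type u} [Category.{v} A] [Preadditive A] (P : ObjectProperty A) :
    ObjectProperty A := fun X =>
  ∃ (n : ℕ) (Y : Fin n → A) (b : Bicone Y),
    (∀ t, P (Y t)) ∧ Nonempty b.IsBilimit ∧ Nonempty (Retract X b.pt)

lemma le_additiveClosure {A : Type u} [Category.{v} A] [Preadditive A] {P : ObjectProperty A}
    {X : A} (h : P X) : additiveClosure P X :=
  ⟨1, fun _ => X, (limitBiconeOfUnique fun _ : Fin 1 => X).bicone, fun _ => h,
    ⟨(limitBiconeOfUnique fun _ : Fin 1 => X).isBilimit⟩, ⟨Retract.refl X⟩⟩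

/-- The 1-morphisms of the extension of `C` by the `1_i`, as a class of 1-morphisms of the
projective abelianization: off the diagonal these are the 1-morphisms of `C` (up to isomorphism),
and at the pair `(i, i)` it is the additive closure of `C(i, i)` and `1_i`. -/
inductive IsHat {U : BilaxUnits C} (E : ∀ i, UnitCoequalizer U i) :
    ∀ i j : B, ObjectProperty (C.projAb.Hom i j)
  | offDiag {i j : B} (hij : i ≠ j) {X : C.projAb.Hom i j} (F : C.Hom i j)
      (e : X ≅ (C.embed i j).obj F) : IsHat E i j X
  | diag {i : B} {X : C.projAb.Hom i i}
      (h : additiveClosure (fun Y => (∃ F : C.Hom i i, Nonempty (Y ≅ (C.embed i i).obj F)) ∨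
        Nonempty (Y ≅ (E i).one)) X) : IsHat E i i X

lemma isHat_embed {U : BilaxUnits C} (E : ∀ i, UnitCoequalizer U i) {i j : B} (F : C.Hom i j) :
    IsHat E i j ((C.embed i j).obj F) := by
  by_cases h : i = j
  · subst h
    exact .diag (le_additiveClosure (Or.inl ⟨F, ⟨Iso.refl _⟩⟩))
  · exact .offDiag h F (Iso.refl _)

lemma isHat_one {U : BilaxUnits C} (E : ∀ i, UnitCoequalizer U i) (i : B) :
    IsHat E i i (E i).one :=
  .diag (le_additiveClosure (Or.inr ⟨Iso.refl _⟩))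

/-- The class `IsHat` is closed under horizontal composition. -/
def HatClosed {U : BilaxUnits C} (E : ∀ i, UnitCoequalizer U i) : Prop :=
  ∀ {i j m : B} (G : C.projAb.Hom j m) (F : C.projAb.Hom i j),
    IsHat E j m G → IsHat E i j F → IsHat E i m (G ⊚ F)

section Hat

variable {U : BilaxUnits C} (E : ∀ i, UnitCoequalizer U i) (hE : HatClosed E)

/-- The 2-full sub-2-semicategory of the projective abelianization obtained from `C` by adjoining
the 1-morphisms `1_i`. -/
def hat : TwoSemicat.{v, max u v} k B := C.projAb.full (IsHat E) hE

/-- The embedding of `C`. -/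
def hatEmbed (i j : B) : C.Hom i j ⥤ (hat E hE).Hom i j :=
  (IsHat E i j).lift (C.embed i j) (fun F => isHat_embed E F)

/-- The embedding is strictly compatible with horizontal composition. -/
def hatEmbedComp {i j m : B} (G : C.Hom j m) (F : C.Hom i j) :
    (hatEmbed E hE i m).obj (G ⊚ F) ≅ (hatEmbed E hE j m).obj G ⊚ (hatEmbed E hE i j).obj F :=
  Iso.refl _

/-- The 1-morphism `1_i`. -/
def hatOne (i : B) : (hat E hE).Hom i i := ⟨(E i).one, isHat_one E i⟩

/-- The canonical 2-morphism `ξ : I_i ⟶ 1_i`. -/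
def hatξ (i : B) : (hatEmbed E hE i i).obj (U.I i) ⟶ hatOne E hE i :=
  ObjectProperty.homMk (E i).ξ

variable {E hE} in
/-- The weak unit structures `W` on the `1_i` are induced by the lax units `I_i`: the unitors of
`I_i` factor through `ξ` and the unitors of `1_i`. -/
def IsInducedUnit (W : ∀ i, WeakUnit (hat E hE) (hatOne E hE i)) : Prop :=
  (∀ {i j : B} (F : C.Hom j i),
    (hatξ E hE i ▷ₛ (hatEmbed E hE j i).obj F) ≫ (W i).l ((hatEmbed E hE j i).obj F) =
      (hatEmbedComp E hE (U.I i) F).inv ≫ (hatEmbed E hE j i).map ((U.lax i).l F)) ∧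
  (∀ {i m : B} (G : C.Hom i m),
    ((hatEmbed E hE i m).obj G ◁ₛ hatξ E hE i) ≫ (W i).r ((hatEmbed E hE i m).obj G) =
      (hatEmbedComp E hE G (U.I i)).inv ≫ (hatEmbed E hE i m).map ((U.lax i).r G))

variable {E hE} in
/-- `T` extends `S` from `C`: there are isomorphisms `S(F) ≅ T(F)` for the 1-morphisms `F` of `C`,
natural in 2-morphisms and compatible with horizontal composition. -/
def ExtendsStar (S : AntiEquivalence C) (T : AntiEquivalence (hat E hE)) : Prop :=
  ∃ θ : ∀ {i j : B} (F : C.Hom i j),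
      (hatEmbed E hE j i).obj (S.obj F) ≅ T.obj ((hatEmbed E hE i j).obj F),
    (∀ {i j : B} {F G : C.Hom i j} (γ : F ⟶ G),
      (hatEmbed E hE j i).map (S.map γ) ≫ (θ F).hom =
        (θ G).hom ≫ T.map ((hatEmbed E hE i j).map γ)) ∧
    (∀ {i j m : B} (G : C.Hom j m) (F : C.Hom i j),
      (θ (G ⊚ F)).hom ≫ T.map (hatEmbedComp E hE G F).inv ≫ (T.μ _ _).hom =
        (hatEmbed E hE m i).map (S.μ G F).hom ≫ (hatEmbedComp E hE (S.obj F) (S.obj G)).hom ≫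
          ((θ F).hom ▷ₛ _) ≫ (_ ◁ₛ (θ G).hom))

end Hat

end TwoSemicat

open TwoSemicat

/-! The only input needed for the weak units is that the unitors of `I` are split epimorphisms. For
`l` this is a triangle identity of the adjoint pair (F, F⋆); for `r` it is the other one, because
every 1-morphism is isomorphic to a dual (`FiaxStructure.isSplit`).

The cokernel of l - r : II → I in the projective abelianization is `I` with the single relation l -
r. Let s be a section of l_F. Whiskering it with `I` and applying r_I gives the identity of IF,
while applying l_I gives l_F followed by s. So the difference of the two endomorphisms factors
through (l - r)F: the section becomes a two-sided inverse of l_F modulo the relations, and the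
cokernel is a weak unit of the whole projective abelianization (`LaxUnit.isIso_l`,
`LaxUnit.isIso_r`). Every other coequalizer is isomorphic to this one.

The extension consists of the direct summands of finite sums of generators, which are the
1-morphisms of `C` and the `1_i`. Generators are closed under composition because 1F ≅ F ≅ F1, hence
so are their summands, and `C` is an ideal. For finitarity, a 2-endomorphism of `1_i` lifts to one
of the indecomposable `I_i`, which is nilpotent or invertible by Fitting's lemma. So `1_i` has no
nontrivial idempotents, and an indecomposable of the extension is a summand of a single generator.

For the involution, an adjoint pair of `C` becomes a classical adjunction: the counit is followed by
ξ, and the unit is 1 → I'1 → (GF)1 → GF (`AdjointPair.extend`). Condition 3 then says that ⋆ on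
2-morphisms of `C` is the passage to mates. Right adjoints pass to summands of finite sums, so every
1-morphism of the extension has one, and a choice of them, with mates, is the candidate for the
involution.

Two points remain. The given isomorphisms (GF)⋆ ≅ F⋆G⋆ need not be the canonical ones between right
adjoints. They differ by natural automorphisms ψ of the composites GF, and coherence makes ψ a
cocycle. A cocycle extends to the projective abelianization, since it is applied to the underlying
1-morphisms, and twisting the canonical isomorphisms by it gives an involution that restricts to the
given one. Its values at the identities enter condition 1 through the choice of ε. Secondly, ⋆⋆ ≅ Id
is given only on `C`. Every 1-morphism f is the coequalizer of f composed with the two maps II → I,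
and fI lies in `C`, so the isomorphism descends from the ideal `C` to the extension
(`UnitResolution.isoId`). -/

namespace ProjAb

variable {k : Type x} [Field k] {A : Type u} [Category.{v} A] [Preadditive A] [Linear k A]

/-- Whether a representative is zero in the quotient depends only on the relations of its target, so
changing the relations of the source loses nothing. -/
lemma epi_homMk_id {X : A} {r r' : List (Σ Y : A, Y ⟶ X)}
    (h : 𝟙 X ∈ admissible (k := k) ⟨X, r⟩ ⟨X, r'⟩) :
    Epi (homMk (P := ⟨X, r⟩) (Q := ⟨X, r'⟩) (𝟙 X) h) := by
  refine Preadditive.epi_of_cancel_zero _ fun {Q} f hf => ?_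
  obtain ⟨f, h, rfl⟩ := homMk_surjective f
  have : 𝟙 X ≫ f - 0 ∈ Q.null X := homMk_eq.1 hf
  rw [Category.id_comp] at this
  exact homMk_eq.2 this

end ProjAb

namespace TwoSemicat

variable {k : Type x} [Field k] {B : Type w} {C : TwoSemicat.{v, u} k B}

/-! ## Units of the projective abelianization -/

section

variable {i j : B} {I : C.Hom i i}

lemma OplaxUnit.l_mem (L : OplaxUnit C I) (P : ProjAb k (C.Hom j i)) :
    L.l P.X ∈ ProjAb.admissible P (C.projAbHcomp ⟨I, []⟩ P) := fun y hy => by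
  rw [L.l_naturality]
  exact ProjAb.comp_mem_null _ _ (whiskerLeft_mem_null ⟨I, []⟩ (mem_null_self P hy))

lemma OplaxUnit.r_mem (L : OplaxUnit C I) (P : ProjAb k (C.Hom i j)) :
    L.r P.X ∈ ProjAb.admissible P (C.projAbHcomp P ⟨I, []⟩) := fun y hy => by
  rw [L.r_naturality]
  exact ProjAb.comp_mem_null _ _ (whiskerRight_mem_null ⟨I, []⟩ (mem_null_self P hy))

lemma LaxUnit.l_comp_mem (L : LaxUnit C I) (P : ProjAb k (C.Hom j i)) {y} (hy : y ∈ P.rel) :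
    (I ◁ₛ y.2) ≫ L.l P.X ∈ P.null (I ⊚ y.1) := by
  rw [L.l_naturality]
  exact ProjAb.comp_mem_null _ _ (mem_null_self P hy)

lemma LaxUnit.r_comp_mem (L : LaxUnit C I) (P : ProjAb k (C.Hom i j)) {y} (hy : y ∈ P.rel) :
    (y.2 ▷ₛ I) ≫ L.r P.X ∈ P.null (y.1 ⊚ I) := by
  rw [L.r_naturality]
  exact ProjAb.comp_mem_null _ _ (mem_null_self P hy)

end

/-- A lax unit of `C` is a lax unit of the projective abelianization. -/
def LaxUnit.projAb {i : B} {I : C.Hom i i} (L : LaxUnit C I) :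
    LaxUnit C.projAb ((C.embed i i).obj I) where
  l {j} P := ProjAb.homMk (P := C.projAbHcomp ((C.embed i i).obj I) P) (Q := P) (L.l P.X)
    (mem_admissible_hcomp (P := (C.embed i i).obj I)
      (fun _ hy => L.l_comp_mem P hy)
      (fun _ hy => absurd hy List.not_mem_nil))
  r {m} P := ProjAb.homMk (P := C.projAbHcomp P ((C.embed i i).obj I)) (Q := P) (L.r P.X)
    (mem_admissible_hcomp (Q := (C.embed i i).obj I)
      (fun _ hy => absurd hy List.not_mem_nil)
      (fun _ hy => L.r_comp_mem P hy))
  l_naturality f := by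
    obtain ⟨f, hf, rfl⟩ := ProjAb.homMk_surjective f
    exact ProjAb.homMk_congr (L.l_naturality f)
  r_naturality f := by
    obtain ⟨f, hf, rfl⟩ := ProjAb.homMk_surjective f
    exact ProjAb.homMk_congr (L.r_naturality f)
  compat F G := ProjAb.homMk_congr (L.compat F.X G.X)
  l_hcomp F H := ProjAb.homMk_congr (L.l_hcomp F.X H.X)
  r_hcomp K G := ProjAb.homMk_congr (L.r_hcomp K.X G.X)

/-- An oplax unit of `C` is an oplax unit of the projective abelianization. -/
def OplaxUnit.projAb {i : B} {I : C.Hom i i} (L : OplaxUnit C I) :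
    OplaxUnit C.projAb ((C.embed i i).obj I) where
  l {j} P := ProjAb.homMk (P := P) (Q := C.projAbHcomp ((C.embed i i).obj I) P) (L.l P.X)
      (L.l_mem P)
  r {m} P := ProjAb.homMk (P := P) (Q := C.projAbHcomp P ((C.embed i i).obj I)) (L.r P.X)
      (L.r_mem P)
  l_naturality f := by
    obtain ⟨f, hf, rfl⟩ := ProjAb.homMk_surjective f
    exact ProjAb.homMk_congr (L.l_naturality f)
  r_naturality f := by
    obtain ⟨f, hf, rfl⟩ := ProjAb.homMk_surjective f
    exact ProjAb.homMk_congr (L.r_naturality f)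
  compat F G := ProjAb.homMk_congr (L.compat F.X G.X)
  l_hcomp F H := ProjAb.homMk_congr (L.l_hcomp F.X H.X)
  r_hcomp K G := ProjAb.homMk_congr (L.r_hcomp K.X G.X)

/-- Bilax units of `C` are bilax units of the projective abelianization. -/
def BilaxUnits.projAb (U : BilaxUnits C) : BilaxUnits C.projAb where
  I i := (C.embed i i).obj (U.I i)
  I' i := (C.embed i i).obj (U.I' i)
  lax i := (U.lax i).projAb
  oplax i := (U.oplax i).projAb

/-- An adjoint pair of `C` is an adjoint pair of the projective abelianization. -/
def AdjointPair.projAb {U : BilaxUnits C} {i j : B} {F : C.Hom i j} {G : C.Hom j i}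
    (A : AdjointPair U F G) : AdjointPair U.projAb ((C.embed i j).obj F) ((C.embed j i).obj G) where
  α := (C.embed i i).map A.α
  β := (C.embed j j).map A.β
  triangle_left := ProjAb.homMk_congr A.triangle_left
  triangle_right := ProjAb.homMk_congr A.triangle_right

/-- All unitors of a lax unit are split epimorphisms. -/
structure LaxUnit.IsSplit {i : B} {I : C.Hom i i} (L : LaxUnit C I) : Prop where
  l : ∀ {j : B} (F : C.Hom j i), ∃ s, s ≫ L.l F = 𝟙 F
  r : ∀ {m : B} (G : C.Hom i m), ∃ s, s ≫ L.r G = 𝟙 G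

/-- The triangle identity for F ends in l_F, and the one for F⋆ ends in r at F⋆. Essential
surjectivity of ⋆ together with naturality of r carries the second to an arbitrary G. -/
lemma FiaxStructure.isSplit {U : BilaxUnits C} (S : FiaxStructure U) (i : B) :
    (U.lax i).IsSplit where
  l {j} F := ⟨(U.oplax j).r F ≫ (F ◁ₛ (S.adj F).α) ≫ (assoc F _ F).inv ≫ ((S.adj F).β ▷ₛ F), by
    simpa only [Category.assoc] using (S.adj F).triangle_left⟩
  r {m} G := by
    obtain ⟨F, ⟨e⟩⟩ := S.obj_essSurj G
    refine ⟨e.inv ≫ ((U.oplax m).l (S.obj F) ≫ ((S.adj F).α ▷ₛ S.obj F) ≫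
      (assoc _ F _).hom ≫ (S.obj F ◁ₛ (S.adj F).β)) ≫ (e.hom ▷ₛ U.I i), ?_⟩
    have h := (S.adj F).triangle_right
    rw [Category.assoc, Category.assoc, (U.lax i).r_naturality]
    simp only [Category.assoc]
    rw [reassoc_of% h, Iso.inv_hom_id]

/-! ### The cokernel of l - r is a weak unit -/

namespace LaxUnit

variable {i : B} {I : C.Hom i i} (L : LaxUnit C I)

/-- The cokernel, in the projective abelianization, of the difference of the unitors at `I`. -/
abbrev coker : ProjAb k (C.Hom i i) := ⟨I, [⟨I ⊚ I, L.l I - L.r I⟩]⟩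

/-- The cokernel of the difference of the unitors, as a 1-morphism. -/
def one : C.projAb.Hom i i := L.coker

lemma sub_mem_null : L.l I - L.r I ∈ L.coker.null (I ⊚ I) :=
  mem_null_self L.coker (List.mem_singleton.2 rfl)

/-- The projection of `I` onto the cokernel. -/
def toOne : (C.embed i i).obj I ⟶ L.one :=
  ProjAb.homMk (P := (C.embed i i).obj I) (Q := L.coker) (𝟙 I)
    (fun _ hy => absurd hy List.not_mem_nil)

/-- The kernel of l_Q is accounted for by the relations. For a section s of l_Q, the map I ◁ s
followed by r_I ▷ Q is the identity (`e1`), and followed by l_I ▷ Q it is l_Q followed by s (`e2`),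
so a map killed by l_Q factors through (l - r) ▷ Q. -/
lemma mem_null_one_hcomp (hL : L.IsSplit) {j : B} {Q : ProjAb k (C.Hom j i)} {Z : C.Hom j i}
    {d : Z ⟶ I ⊚ Q.X} (hd : d ≫ L.l Q.X ∈ Q.null Z) : d ∈ (C.projAbHcomp L.coker Q).null Z := by
  have key : ∀ d : Z ⟶ I ⊚ Q.X, d ≫ L.l Q.X = 0 → d ∈ (C.projAbHcomp L.coker Q).null Z := by
    intro d hd
    obtain ⟨s, hs⟩ := hL.l Q.X
    have e1 : (I ◁ₛ s) ≫ (assoc I I Q.X).inv ≫ (L.r I ▷ₛ Q.X) = 𝟙 _ := by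
      rw [← L.compat, Iso.inv_hom_id_assoc, ← C.whiskerLeft_comp, hs, C.whiskerLeft_id]
    have e2 : (I ◁ₛ s) ≫ (assoc I I Q.X).inv ≫ (L.l I ▷ₛ Q.X) = L.l Q.X ≫ s := by
      rw [← L.l_hcomp, Iso.inv_hom_id_assoc, L.l_naturality]
    have e : d = (- (d ≫ (I ◁ₛ s) ≫ (assoc I I Q.X).inv)) ≫ ((L.l I - L.r I) ▷ₛ Q.X) := by
      have : (L.l I - L.r I) ▷ₛ Q.X = L.l I ▷ₛ Q.X - L.r I ▷ₛ Q.X :=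
        map_sub (whiskerRightₗ _ _ Q.X) _ _
      rw [this, Preadditive.comp_sub]
      simp only [Category.assoc, Preadditive.neg_comp, e1, e2]
      rw [reassoc_of% hd]
      simp
    rw [e]
    exact ProjAb.comp_mem_null _ _ (whiskerRight_mem_null Q L.sub_mem_null)
  -- Relations of Q lift through l along sections at their sources. Subtracting such a lift leaves a
  -- map killed by l, to which `key` applies.
  have h : Q.null Z ≤ ((C.projAbHcomp L.coker Q).null Z).map (Linear.rightComp k Z (L.l Q.X)) := by
    refine Submodule.span_le.2 ?_
    rintro _ ⟨y, hy, q, rfl⟩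
    obtain ⟨s, hs⟩ := hL.l y.1
    refine ⟨q ≫ s ≫ (I ◁ₛ y.2), ?_, ?_⟩
    · rw [← Category.assoc]
      exact ProjAb.comp_mem_null _ _ (whiskerLeft_mem_null L.coker (mem_null_self Q hy))
    · change (q ≫ s ≫ (I ◁ₛ y.2)) ≫ L.l Q.X = _
      simp only [Category.assoc]
      rw [L.l_naturality, reassoc_of% hs]
  obtain ⟨d', hd', e⟩ := h hd
  have := add_mem hd' (key (d - d') (by
    rw [Preadditive.sub_comp, sub_eq_zero]; exact e.symm))
  rwa [add_sub_cancel] at this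

/-- The mirror image of `mem_null_one_hcomp`. The unitors l and r exchange roles while the relation
is still l - r, which is why no sign appears here. -/
lemma mem_null_hcomp_one (hL : L.IsSplit) {m : B} {P : ProjAb k (C.Hom i m)} {Z : C.Hom i m}
    {d : Z ⟶ P.X ⊚ I} (hd : d ≫ L.r P.X ∈ P.null Z) : d ∈ (C.projAbHcomp P L.coker).null Z := by
  have key : ∀ d : Z ⟶ P.X ⊚ I, d ≫ L.r P.X = 0 → d ∈ (C.projAbHcomp P L.coker).null Z := by
    intro d hd
    obtain ⟨s, hs⟩ := hL.r P.X
    have e1 : (s ▷ₛ I) ≫ (assoc P.X I I).hom ≫ (P.X ◁ₛ L.l I) = 𝟙 _ := by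
      rw [L.compat, ← C.comp_whiskerRight, hs, C.id_whiskerRight]
    have e2 : (s ▷ₛ I) ≫ (assoc P.X I I).hom ≫ (P.X ◁ₛ L.r I) = L.r P.X ≫ s := by
      rw [← L.r_hcomp, L.r_naturality]
    have e : d = (d ≫ (s ▷ₛ I) ≫ (assoc P.X I I).hom) ≫ (P.X ◁ₛ (L.l I - L.r I)) := by
      have : P.X ◁ₛ (L.l I - L.r I) = P.X ◁ₛ L.l I - P.X ◁ₛ L.r I :=
        map_sub (whiskerLeftₗ P.X _ _) _ _
      rw [this, Preadditive.comp_sub]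
      simp only [Category.assoc, e1, e2]
      rw [reassoc_of% hd]
      simp
    rw [e]
    exact ProjAb.comp_mem_null _ _ (whiskerLeft_mem_null P L.sub_mem_null)
  have h : P.null Z ≤ ((C.projAbHcomp P L.coker).null Z).map (Linear.rightComp k Z (L.r P.X)) := by
    refine Submodule.span_le.2 ?_
    rintro _ ⟨y, hy, q, rfl⟩
    obtain ⟨s, hs⟩ := hL.r y.1
    refine ⟨q ≫ s ≫ (y.2 ▷ₛ I), ?_, ?_⟩
    · rw [← Category.assoc]
      exact ProjAb.comp_mem_null _ _ (whiskerRight_mem_null L.one (mem_null_self P hy))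
    · change (q ≫ s ≫ (y.2 ▷ₛ I)) ≫ L.r P.X = _
      simp only [Category.assoc]
      rw [L.r_naturality, reassoc_of% hs]
  obtain ⟨d', hd', e⟩ := h hd
  have := add_mem hd' (key (d - d') (by
    rw [Preadditive.sub_comp, sub_eq_zero]; exact e.symm))
  rwa [add_sub_cancel] at this

/-- The unitors of `I` induce a lax unit structure on the cokernel. -/
def projAbOne : LaxUnit C.projAb L.one where
  l {j} P := ProjAb.homMk (P := C.projAbHcomp L.coker P) (Q := P) (L.l P.X)
    (mem_admissible_hcomp (P := L.coker)
      (fun _ hy => L.l_comp_mem P hy)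
      (fun y hy => by
        obtain rfl := List.mem_singleton.1 hy
        -- Up to the associator, l_I ▷ P is l at the composite I ⊚ P and r_I ▷ P is I ◁ l_P. They
        -- agree after l_P by naturality of l at l_P.
        have : ((L.l I - L.r I) ▷ₛ P.X) ≫ L.l P.X = 0 := by
          have : (L.l I - L.r I) ▷ₛ P.X = L.l I ▷ₛ P.X - L.r I ▷ₛ P.X :=
            map_sub (whiskerRightₗ _ _ P.X) _ _
          rw [this, Preadditive.sub_comp, ← L.l_hcomp, ← L.compat, Category.assoc, Category.assoc,
            L.l_naturality, sub_self]
        change ((L.l I - L.r I) ▷ₛ P.X) ≫ L.l P.X ∈ _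
        rw [this]
        exact zero_mem _))
  r {m} P := ProjAb.homMk (P := C.projAbHcomp P L.coker) (Q := P) (L.r P.X)
    (mem_admissible_hcomp (Q := L.coker)
      (fun y hy => by
        obtain rfl := List.mem_singleton.1 hy
        have : (P.X ◁ₛ (L.l I - L.r I)) ≫ L.r P.X = 0 := by
          have : P.X ◁ₛ (L.l I - L.r I) = P.X ◁ₛ L.l I - P.X ◁ₛ L.r I :=
            map_sub (whiskerLeftₗ P.X _ _) _ _
          rw [this, ← cancel_epi (assoc P.X I I).hom, Preadditive.sub_comp, Preadditive.comp_sub,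
            ← Category.assoc, ← Category.assoc, L.compat, ← L.r_hcomp, L.r_naturality, sub_self,
            comp_zero]
        change (P.X ◁ₛ (L.l I - L.r I)) ≫ L.r P.X ∈ _
        rw [this]
        exact zero_mem _)
      (fun _ hy => L.r_comp_mem P hy))
  l_naturality f := by
    obtain ⟨f, hf, rfl⟩ := ProjAb.homMk_surjective f
    exact ProjAb.homMk_congr (L.l_naturality f)
  r_naturality f := by
    obtain ⟨f, hf, rfl⟩ := ProjAb.homMk_surjective f
    exact ProjAb.homMk_congr (L.r_naturality f)
  compat F G := ProjAb.homMk_congr (L.compat F.X G.X)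
  l_hcomp F H := ProjAb.homMk_congr (L.l_hcomp F.X H.X)
  r_hcomp K G := ProjAb.homMk_congr (L.r_hcomp K.X G.X)

/-- Any section of l_P in `C` represents the inverse. Both its admissibility and the missing half of
invertibility compare maps that agree after l_P, which `mem_null_one_hcomp` converts into equality
modulo relations. -/
lemma isIso_l (hL : L.IsSplit) {j : B} (P : ProjAb k (C.Hom j i)) :
    IsIso (L.projAbOne.l P) := by
  obtain ⟨s, hs⟩ := hL.l P.X
  have h1 : s ∈ ProjAb.admissible P (C.projAbHcomp L.coker P) := fun y hy =>
    L.mem_null_one_hcomp hL (by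
      rw [Category.assoc, hs, Category.comp_id]
      exact mem_null_self P hy)
  have h2 : L.l P.X ≫ s - 𝟙 (I ⊚ P.X) ∈ (C.projAbHcomp L.coker P).null (I ⊚ P.X) :=
    L.mem_null_one_hcomp hL (by
      rw [Preadditive.sub_comp, Category.assoc, hs, Category.comp_id, Category.id_comp, sub_self]
      exact zero_mem _)
  exact ⟨ProjAb.homMk s h1, ProjAb.homMk_eq.2 h2, ProjAb.homMk_congr hs⟩

lemma isIso_r (hL : L.IsSplit) {m : B} (P : ProjAb k (C.Hom i m)) :
    IsIso (L.projAbOne.r P) := by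
  obtain ⟨s, hs⟩ := hL.r P.X
  have h1 : s ∈ ProjAb.admissible P (C.projAbHcomp P L.coker) := fun y hy =>
    L.mem_null_hcomp_one hL (by
      rw [Category.assoc, hs, Category.comp_id]
      exact mem_null_self P hy)
  have h2 : L.r P.X ≫ s - 𝟙 (P.X ⊚ I) ∈ (C.projAbHcomp P L.coker).null (P.X ⊚ I) :=
    L.mem_null_hcomp_one hL (by
      rw [Preadditive.sub_comp, Category.assoc, hs, Category.comp_id, Category.id_comp, sub_self]
      exact zero_mem _)
  exact ⟨ProjAb.homMk s h1, ProjAb.homMk_eq.2 h2, ProjAb.homMk_congr hs⟩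

/-- If the unitors of `I` are split epimorphisms, then the cokernel is a weak unit. -/
def projAbWeakUnit (hL : L.IsSplit) : WeakUnit C.projAb L.one where
  toLaxUnit := L.projAbOne
  isIso_l P := L.isIso_l hL P
  isIso_r P := L.isIso_r hL P

lemma toOne_whiskerRight_l {j : B} (P : C.projAb.Hom j i) :
    C.projAb.whiskerRight L.toOne P ≫ L.projAbOne.l P = L.projAb.l P :=
  ProjAb.homMk_congr (by
    change (𝟙 I ▷ₛ P.X) ≫ L.l P.X = L.l P.X
    rw [C.id_whiskerRight, Category.id_comp])

lemma whiskerLeft_toOne_r {m : B} (P : C.projAb.Hom i m) :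
    C.projAb.whiskerLeft P L.toOne ≫ L.projAbOne.r P = L.projAb.r P :=
  ProjAb.homMk_congr (by
    change (P.X ◁ₛ 𝟙 I) ≫ L.r P.X = L.r P.X
    rw [C.whiskerLeft_id, Category.id_comp])

lemma desc_mem {m : B} {P Q : ProjAb k (C.Hom i m)} {g : P.X ⊚ I ⟶ Q.X}
    (h : g ∈ ProjAb.admissible (C.projAbHcomp P ⟨I, []⟩) Q)
    (hg : (P.X ◁ₛ L.l I) ≫ g - (P.X ◁ₛ L.r I) ≫ g ∈ Q.null (P.X ⊚ I ⊚ I)) :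
    g ∈ ProjAb.admissible (C.projAbHcomp P L.coker) Q :=
  mem_admissible_hcomp (Q := L.coker)
    (fun y hy => by
      obtain rfl := List.mem_singleton.1 hy
      have : P.X ◁ₛ (L.l I - L.r I) = P.X ◁ₛ L.l I - P.X ◁ₛ L.r I :=
        map_sub (whiskerLeftₗ P.X _ _) _ _
      change (P.X ◁ₛ (L.l I - L.r I)) ≫ g ∈ _
      rwa [this, Preadditive.sub_comp])
    (fun y hy => h _ (List.mem_append_right _ (List.mem_map.2 ⟨y, hy, rfl⟩)))

/-- Composition with P preserves the cokernel presentation, and the unitor identifies P ⊚ 1 with P.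
Hence r_P is a coequalizer of P ⊚ l and P ⊚ r, which is what makes the 1-morphisms of `C` resolve
all others. -/
lemma projAb_r_desc (hL : L.IsSplit) {m : B} {P Q : C.projAb.Hom i m}
    (g : P ⊚ (C.embed i i).obj I ⟶ Q)
    (hg : (P ◁ₛ (C.embed i i).map (L.l I)) ≫ g = (P ◁ₛ (C.embed i i).map (L.r I)) ≫ g) :
    ∃ f : P ⟶ Q, L.projAb.r P ≫ f = g := by
  obtain ⟨f, hf⟩ : ∃ f : P ⊚ L.one ⟶ Q, (P ◁ₛ L.toOne) ≫ f = g := by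
    obtain ⟨g, h, rfl⟩ := ProjAb.homMk_surjective g
    refine ⟨ProjAb.homMk (P := C.projAbHcomp P L.coker) (Q := Q) g
      (L.desc_mem h (ProjAb.homMk_eq.1 hg)), ProjAb.homMk_congr ?_⟩
    exact (congrArg (· ≫ g) (C.whiskerLeft_id P.X I)).trans (Category.id_comp _)
  have : IsIso (L.projAbOne.r P) := L.isIso_r hL P
  refine ⟨inv (L.projAbOne.r P) ≫ f, ?_⟩
  rw [← hf, ← L.whiskerLeft_toOne_r, Category.assoc, IsIso.hom_inv_id_assoc]

/-- The section s lives in `C` and need not be admissible for P, but nullity concerns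
representatives only. The subtraction of 0 is the shape in which `homMk_eq` expresses vanishing. -/
lemma null_of_r_comp (hL : L.IsSplit) {m : B} {P Q : ProjAb k (C.Hom i m)} {f : P.X ⟶ Q.X}
    (hf : L.r P.X ≫ f - 0 ∈ Q.null (P.X ⊚ I)) : f - 0 ∈ Q.null P.X := by
  obtain ⟨s, hs⟩ := hL.r P.X
  have := ProjAb.comp_mem_null Q s hf
  rwa [sub_zero, reassoc_of% hs, ← sub_zero f] at this

lemma projAb_r_epi (hL : L.IsSplit) {m : B} (P : C.projAb.Hom i m) : Epi (L.projAb.r P) := by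
  refine Preadditive.epi_of_cancel_zero _ fun {Q} f hf => ?_
  obtain ⟨f, h, rfl⟩ := ProjAb.homMk_surjective f
  exact ProjAb.homMk_eq.2 (L.null_of_r_comp hL (ProjAb.homMk_eq.1 hf))

lemma toOne_desc {Q : C.projAb.Hom i i} (g : (C.embed i i).obj I ⟶ Q)
    (hg : (C.embed i i).map (L.l I) ≫ g = (C.embed i i).map (L.r I) ≫ g) :
    ∃ f : L.one ⟶ Q, L.toOne ≫ f = g := by
  obtain ⟨g, h, rfl⟩ := ProjAb.homMk_surjective g
  refine ⟨ProjAb.homMk (P := L.coker) g fun y hy => ?_, ProjAb.homMk_congr (Category.id_comp _)⟩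
  obtain rfl := List.mem_singleton.1 hy
  exact Set.mem_of_eq_of_mem (Preadditive.sub_comp (L.l I) (L.r I) g)
    (ProjAb.homMk_eq.1 hg)

lemma toOne_condition :
    (C.embed i i).map (L.l I) ≫ L.toOne = (C.embed i i).map (L.r I) ≫ L.toOne :=
  ProjAb.homMk_eq.2 (by
    have := L.sub_mem_null
    rwa [← Category.comp_id (L.l I), ← Category.comp_id (L.r I)] at this)

lemma toOne_epi : Epi L.toOne := ProjAb.epi_homMk_id _

end LaxUnit

/-- The cokernel of the difference of the unitors is their coequalizer. -/
noncomputable def stdUnitCoequalizer (U : BilaxUnits C) (i : B) : UnitCoequalizer U i where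
  one := (U.lax i).one
  ξ := (U.lax i).toOne
  w := (U.lax i).toOne_condition
  isColimit := Cofork.IsColimit.mk _
    (fun s => ((U.lax i).toOne_desc s.π s.condition).choose)
    (fun s => ((U.lax i).toOne_desc s.π s.condition).choose_spec)
    (fun s m hm => by
      have := (U.lax i).toOne_epi
      exact (cancel_epi (U.lax i).toOne).1
        (hm.trans ((U.lax i).toOne_desc s.π s.condition).choose_spec.symm))

/-- Transport of a weak unit along an isomorphism. -/
def WeakUnit.ofIso {i : B} {I J : C.Hom i i} (W : WeakUnit C I) (e : I ≅ J) : WeakUnit C J where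
  l F := (e.inv ▷ₛ F) ≫ W.l F
  r G := (G ◁ₛ e.inv) ≫ W.r G
  l_naturality f := by
    rw [← Category.assoc, C.whisker_exchange, Category.assoc, W.l_naturality, Category.assoc]
  r_naturality f := by
    rw [← Category.assoc, ← C.whisker_exchange, Category.assoc, W.r_naturality, Category.assoc]
  compat F G := by
    rw [C.whiskerLeft_comp, ← Category.assoc, ← C.associator_naturality_middle, Category.assoc,
      W.compat, C.comp_whiskerRight]
  l_hcomp F H := by
    rw [← Category.assoc, ← C.associator_naturality_left, Category.assoc, W.l_hcomp,
      C.comp_whiskerRight]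
  r_hcomp K G := by
    rw [W.r_hcomp, ← Category.assoc, C.associator_naturality_right, Category.assoc,
      C.whiskerLeft_comp]
  isIso_l F := by
    have : IsIso (e.inv ▷ₛ F) := ⟨e.hom ▷ₛ F, by
      rw [← C.comp_whiskerRight, Iso.inv_hom_id, C.id_whiskerRight], by
      rw [← C.comp_whiskerRight, Iso.hom_inv_id, C.id_whiskerRight]⟩
    infer_instance
  isIso_r F := by
    have : IsIso (F ◁ₛ e.inv) := ⟨F ◁ₛ e.hom, by
      rw [← C.whiskerLeft_comp, Iso.inv_hom_id, C.whiskerLeft_id], by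
      rw [← C.whiskerLeft_comp, Iso.hom_inv_id, C.whiskerLeft_id]⟩
    infer_instance

/-! ### Independence of the chosen coequalizer -/

namespace UnitCoequalizer

variable {U : BilaxUnits C} {i : B} (E : UnitCoequalizer U i)

/-- Any two choices of the coequalizer are isomorphic. -/
noncomputable def isoStd : (U.lax i).one ≅ E.one :=
  (stdUnitCoequalizer U i).isColimit.coconePointUniqueUpToIso E.isColimit

lemma toOne_isoStd : (U.lax i).toOne ≫ E.isoStd.hom = E.ξ :=
  (stdUnitCoequalizer U i).isColimit.comp_coconePointUniqueUpToIso_hom E.isColimit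
    WalkingParallelPair.one

lemma ξ_isoStd_inv : E.ξ ≫ E.isoStd.inv = (U.lax i).toOne := by
  rw [← E.toOne_isoStd, Category.assoc, Iso.hom_inv_id, Category.comp_id]

/-- A coequalizer is a weak unit of the projective abelianization. -/
noncomputable def weakUnit (hL : (U.lax i).IsSplit) : WeakUnit C.projAb E.one :=
  ((U.lax i).projAbWeakUnit hL).ofIso E.isoStd

lemma ξ_whiskerRight_l (hL : (U.lax i).IsSplit) {j : B} (P : C.projAb.Hom j i) :
    (E.ξ ▷ₛ P) ≫ (E.weakUnit hL).l P = (U.projAb.lax i).l P := by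
  refine Eq.trans ?_ ((U.lax i).toOne_whiskerRight_l P)
  rw [← E.ξ_isoStd_inv, C.projAb.comp_whiskerRight, Category.assoc]
  rfl

lemma whiskerLeft_ξ_r (hL : (U.lax i).IsSplit) {m : B} (P : C.projAb.Hom i m) :
    (P ◁ₛ E.ξ) ≫ (E.weakUnit hL).r P = (U.projAb.lax i).r P := by
  refine Eq.trans ?_ ((U.lax i).whiskerLeft_toOne_r P)
  rw [← E.ξ_isoStd_inv, C.projAb.whiskerLeft_comp, Category.assoc]
  rfl

end UnitCoequalizer

end TwoSemicat

namespace CategoryTheory.Bicategory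

open _root_.CategoryTheory.Bicategory

variable {𝔹 : Type w} [Bicategory.{v, u} 𝔹]

/-! ## Contravariant structures on a bicategory -/

variable (𝔹) in
/-- A structure which reverses 1-morphisms and 2-morphisms, compatible with composition of
1-morphisms up to a coherent isomorphism. -/
structure DualStructure where
  R : ∀ {a b : 𝔹}, (a ⟶ b) → (b ⟶ a)
  M : ∀ {a b : 𝔹} {f g : a ⟶ b}, (f ⟶ g) → (R g ⟶ R f)
  M_id : ∀ {a b : 𝔹} (f : a ⟶ b), M (𝟙 f) = 𝟙 (R f)
  M_comp : ∀ {a b : 𝔹} {f g h : a ⟶ b} (γ : f ⟶ g) (δ : g ⟶ h), M (γ ≫ δ) = M δ ≫ M γ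
  μ : ∀ {a b c : 𝔹} (f : a ⟶ b) (g : b ⟶ c), R (f ≫ g) ≅ R g ≫ R f
  nat_left : ∀ {a b c : 𝔹} (f : a ⟶ b) {g g' : b ⟶ c} (η : g ⟶ g'),
    M (f ◁ η) ≫ (μ f g).hom = (μ f g').hom ≫ M η ▷ R f
  nat_right : ∀ {a b c : 𝔹} {f f' : a ⟶ b} (η : f ⟶ f') (g : b ⟶ c),
    M (η ▷ g) ≫ (μ f g).hom = (μ f' g).hom ≫ R g ◁ M η
  assoc : ∀ {a b c d : 𝔹} (f : a ⟶ b) (g : b ⟶ c) (h : c ⟶ d),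
    M (α_ f g h).inv ≫ (μ f (g ≫ h)).hom ≫ (μ g h).hom ▷ R f =
      (μ (f ≫ g) h).hom ≫ R h ◁ (μ f g).hom ≫ (α_ (R h) (R g) (R f)).inv

variable (𝔹) in
/-- A covariant structure, identical on objects and compatible with composition of 1-morphisms up
to a coherent isomorphism; there is no condition on identities. -/
structure SemiFunctor where
  N : ∀ {a b : 𝔹}, (a ⟶ b) → (a ⟶ b)
  M : ∀ {a b : 𝔹} {f g : a ⟶ b}, (f ⟶ g) → (N f ⟶ N g)
  M_id : ∀ {a b : 𝔹} (f : a ⟶ b), M (𝟙 f) = 𝟙 (N f)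
  M_comp : ∀ {a b : 𝔹} {f g h : a ⟶ b} (γ : f ⟶ g) (δ : g ⟶ h), M (γ ≫ δ) = M γ ≫ M δ
  ν : ∀ {a b c : 𝔹} (f : a ⟶ b) (g : b ⟶ c), N (f ≫ g) ≅ N f ≫ N g
  nat_left : ∀ {a b c : 𝔹} (f : a ⟶ b) {g g' : b ⟶ c} (η : g ⟶ g'),
    M (f ◁ η) ≫ (ν f g').hom = (ν f g).hom ≫ N f ◁ M η
  nat_right : ∀ {a b c : 𝔹} {f f' : a ⟶ b} (η : f ⟶ f') (g : b ⟶ c),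
    M (η ▷ g) ≫ (ν f' g).hom = (ν f g).hom ≫ M η ▷ N g
  assoc : ∀ {a b c d : 𝔹} (f : a ⟶ b) (g : b ⟶ c) (h : c ⟶ d),
    M (α_ f g h).hom ≫ (ν f (g ≫ h)).hom ≫ N f ◁ (ν g h).hom =
      (ν (f ≫ g) h).hom ≫ (ν f g).hom ▷ N h ≫ (α_ (N f) (N g) (N h)).hom

namespace DualStructure

variable (T : DualStructure 𝔹)

/-- The action on invertible 2-morphisms. -/
@[simps]
def mapIso {a b : 𝔹} {f g : a ⟶ b} (e : f ≅ g) : T.R g ≅ T.R f where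
  hom := T.M e.hom
  inv := T.M e.inv
  hom_inv_id := by rw [← T.M_comp, e.inv_hom_id, T.M_id]
  inv_hom_id := by rw [← T.M_comp, e.hom_inv_id, T.M_id]

lemma assoc_inv {a b c d : 𝔹} (f : a ⟶ b) (g : b ⟶ c) (h : c ⟶ d) :
    (μ T g h).inv ▷ T.R f ≫ (T.μ f (g ≫ h)).inv ≫ T.M (α_ f g h).hom =
      (α_ (T.R h) (T.R g) (T.R f)).hom ≫ T.R h ◁ (T.μ f g).inv ≫ (T.μ (f ≫ g) h).inv := by
  have h1 : (T.mapIso (α_ f g h).symm ≪≫ T.μ f (g ≫ h) ≪≫ whiskerRightIso (T.μ g h) (T.R f)) =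
      (T.μ (f ≫ g) h ≪≫ whiskerLeftIso (T.R h) (T.μ f g) ≪≫
        (α_ (T.R h) (T.R g) (T.R f)).symm) := Iso.ext (T.assoc f g h)
  simpa using congrArg Iso.inv h1

/-- The double dual. -/
def double : SemiFunctor 𝔹 where
  N f := T.R (T.R f)
  M γ := T.M (T.M γ)
  M_id f := by rw [T.M_id, T.M_id]
  M_comp γ δ := by rw [T.M_comp, T.M_comp]
  ν f g := T.mapIso (T.μ f g).symm ≪≫ T.μ (T.R g) (T.R f)
  nat_left f g g' η := by
    have h : (T.μ f g').inv ≫ T.M (f ◁ η) = T.M η ▷ T.R f ≫ (T.μ f g).inv := by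
      rw [Iso.inv_comp_eq, ← reassoc_of% T.nat_left, Iso.hom_inv_id, Category.comp_id]
    simp only [Iso.trans_hom, mapIso_hom, Iso.symm_hom, Category.assoc]
    rw [← Category.assoc, ← T.M_comp, h, T.M_comp, Category.assoc, T.nat_right]
  nat_right {_ _ _ f f'} η g := by
    have h : (T.μ f' g).inv ≫ T.M (η ▷ g) = T.R g ◁ T.M η ≫ (T.μ f g).inv := by
      rw [Iso.inv_comp_eq, ← reassoc_of% T.nat_right, Iso.hom_inv_id, Category.comp_id]
    simp only [Iso.trans_hom, mapIso_hom, Iso.symm_hom, Category.assoc]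
    rw [← Category.assoc, ← T.M_comp, h, T.M_comp, Category.assoc, T.nat_left]
  assoc f g h := by
    simp only [Iso.trans_hom]
    -- Coherence of the double dual combines two instances of coherence of μ: the dual of the one at
    -- (f, g, h), and the one at the three duals in reverse order.
    have h1 := congrArg T.M (T.assoc_inv f g h)
    simp only [T.M_comp, Category.assoc] at h1
    have h2 := T.assoc (T.R h) (T.R g) (T.R f)
    have h3 : T.M (α_ (T.R h) (T.R g) (T.R f)).hom ≫ (T.μ (T.R h ≫ T.R g) (T.R f)).hom ≫
        T.R (T.R f) ◁ (T.μ (T.R h) (T.R g)).hom =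
        (T.μ (T.R h) (T.R g ≫ T.R f)).hom ≫ (T.μ (T.R g) (T.R f)).hom ▷ T.R (T.R h) ≫
          (α_ (T.R (T.R f)) (T.R (T.R g)) (T.R (T.R h))).hom := by
      rw [← cancel_epi (T.mapIso (α_ (T.R h) (T.R g) (T.R f)).symm).hom, mapIso_hom,
        Iso.symm_hom, ← Category.assoc, ← T.M_comp,
        Iso.hom_inv_id, T.M_id, Category.id_comp, reassoc_of% h2, Iso.inv_hom_id,
        Category.comp_id]
    simp only [Bicategory.whiskerLeft_comp, Bicategory.comp_whiskerRight, Category.assoc,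
      mapIso_hom,
      Iso.symm_hom]
    rw [← reassoc_of% T.nat_right, reassoc_of% h1, h3, ← reassoc_of% T.nat_left]

end DualStructure

/-! ## Twisted adjoints -/

/-- A natural family of automorphisms of the composites of 1-morphisms which satisfies the
cocycle condition. -/
structure Cocycle (ψ : ∀ {a b c : 𝔹} (f : a ⟶ b) (g : b ⟶ c), f ≫ g ≅ f ≫ g) : Prop where
  nat_left : ∀ {a b c : 𝔹} (f : a ⟶ b) {g g' : b ⟶ c} (η : g ⟶ g'),
    f ◁ η ≫ (ψ f g').hom = (ψ f g).hom ≫ f ◁ η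
  nat_right : ∀ {a b c : 𝔹} {f f' : a ⟶ b} (η : f ⟶ f') (g : b ⟶ c),
    η ▷ g ≫ (ψ f' g).hom = (ψ f g).hom ≫ η ▷ g
  cocycle : ∀ {a b c d : 𝔹} (f : a ⟶ b) (g : b ⟶ c) (h : c ⟶ d),
    f ◁ (ψ g h).hom ≫ (ψ f (g ≫ h)).hom ≫ (α_ f g h).inv =
      (α_ f g h).inv ≫ (ψ f g).hom ▷ h ≫ (ψ (f ≫ g) h).hom

namespace Cocycle

variable {ψ : ∀ {a b c : 𝔹} (f : a ⟶ b) (g : b ⟶ c), f ≫ g ≅ f ≫ g} (hψ : Cocycle @ψ)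

variable (ψ) in
/-- The value of a cocycle at the identities. -/
def unit (a : 𝔹) : 𝟙 a ≅ 𝟙 a := (λ_ (𝟙 a)).symm ≪≫ ψ (𝟙 a) (𝟙 a) ≪≫ λ_ (𝟙 a)

include hψ

/-- In the cocycle identity at (f, 1, 1), naturality along the unitors turns every term into ψ(f,
1), except the one that is f whiskered with the value at the identities. Cancelling one copy of the
invertible ψ(f, 1) leaves the claim. -/
lemma apply_id {a b : 𝔹} (f : a ⟶ b) : (ψ f (𝟙 b)).hom = f ◁ (unit @ψ b).hom := by
  have h := hψ.cocycle f (𝟙 b) (𝟙 b)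
  have h1 := hψ.nat_left f (λ_ (𝟙 b)).hom
  have h2 := hψ.nat_right (ρ_ f).hom (𝟙 b)
  have h1' : (ψ f (𝟙 b ≫ 𝟙 b)).hom = f ◁ (λ_ (𝟙 b)).hom ≫ (ψ f (𝟙 b)).hom ≫
      f ◁ (λ_ (𝟙 b)).inv := by
    rw [reassoc_of% h1]; simp
  have h2' : (ψ (f ≫ 𝟙 b) (𝟙 b)).hom = (ρ_ f).hom ▷ 𝟙 b ≫ (ψ f (𝟙 b)).hom ≫
      (ρ_ f).inv ▷ 𝟙 b := by
    rw [reassoc_of% h2, hom_inv_whiskerRight, Category.comp_id]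
  have h3 : (ψ (𝟙 b) (𝟙 b)).hom = (λ_ (𝟙 b)).hom ≫ (unit @ψ b).hom ≫ (λ_ (𝟙 b)).inv := by
    simp [unit]
  have h4 : (ψ f (𝟙 b)).hom ▷ 𝟙 b = (ρ_ f).hom ▷ 𝟙 b ≫ (ψ f (𝟙 b)).hom ≫ (ρ_ f).inv ▷ 𝟙 b := by
    simp
  rw [h1', h2', h3, h4] at h
  have h5 : f ◁ (λ_ (𝟙 b)).hom ≫ (f ◁ (unit @ψ b).hom ≫ (ψ f (𝟙 b)).hom) ≫
      f ◁ (λ_ (𝟙 b)).inv ≫ (α_ f (𝟙 b) (𝟙 b)).inv =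
      f ◁ (λ_ (𝟙 b)).hom ≫ ((ψ f (𝟙 b)).hom ≫ (ψ f (𝟙 b)).hom) ≫
      f ◁ (λ_ (𝟙 b)).inv ≫ (α_ f (𝟙 b) (𝟙 b)).inv := by
    have e1 : f ◁ (λ_ (𝟙 b)).hom = (α_ f (𝟙 b) (𝟙 b)).inv ≫ (ρ_ f).hom ▷ 𝟙 b := by
      rw [← triangle, Iso.inv_hom_id_assoc]
    have e2 : f ◁ (λ_ (𝟙 b)).inv ≫ (α_ f (𝟙 b) (𝟙 b)).inv = (ρ_ f).inv ▷ 𝟙 b :=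
      triangle_assoc_comp_left_inv f (𝟙 b)
    rw [e2]
    simp only [whiskerLeft_comp, Category.assoc, whiskerLeft_inv_hom_assoc,
      inv_hom_whiskerRight_assoc, e2] at h ⊢
    rw [h, e1]
    simp only [Category.assoc]
  rw [cancel_epi, cancel_mono, cancel_mono] at h5
  exact h5.symm

lemma id_apply {a b : 𝔹} (f : a ⟶ b) : (ψ (𝟙 a) f).hom = (unit @ψ a).hom ▷ f := by
  have h := hψ.cocycle (𝟙 a) (𝟙 a) f
  have h1 := hψ.nat_left (𝟙 a) (λ_ f).hom
  have h2 := hψ.nat_right (λ_ (𝟙 a)).hom f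
  have h1' : (ψ (𝟙 a) (𝟙 a ≫ f)).hom = 𝟙 a ◁ (λ_ f).hom ≫ (ψ (𝟙 a) f).hom ≫
      𝟙 a ◁ (λ_ f).inv := by
    rw [reassoc_of% h1, whiskerLeft_hom_inv, Category.comp_id]
  have h2' : (ψ (𝟙 a ≫ 𝟙 a) f).hom = (λ_ (𝟙 a)).hom ▷ f ≫ (ψ (𝟙 a) f).hom ≫
      (λ_ (𝟙 a)).inv ▷ f := by
    rw [reassoc_of% h2, hom_inv_whiskerRight, Category.comp_id]
  have h3 : (ψ (𝟙 a) (𝟙 a)).hom = (λ_ (𝟙 a)).hom ≫ (unit @ψ a).hom ≫ (λ_ (𝟙 a)).inv := by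
    simp [unit]
  have h4 : 𝟙 a ◁ (ψ (𝟙 a) f).hom = 𝟙 a ◁ (λ_ f).hom ≫ (ψ (𝟙 a) f).hom ≫ 𝟙 a ◁ (λ_ f).inv := by
    simp
  rw [h1', h2', h3, h4] at h
  have e1 : 𝟙 a ◁ (λ_ f).hom = (α_ (𝟙 a) (𝟙 a) f).inv ≫ (λ_ (𝟙 a)).hom ▷ f := by
    rw [unitors_equal, ← triangle, Iso.inv_hom_id_assoc]
  have e2 : 𝟙 a ◁ (λ_ f).inv ≫ (α_ (𝟙 a) (𝟙 a) f).inv = (λ_ (𝟙 a)).inv ▷ f := by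
    rw [unitors_inv_equal]
    exact triangle_assoc_comp_left_inv (𝟙 a) f
  have h5 : 𝟙 a ◁ (λ_ f).hom ≫ ((ψ (𝟙 a) f).hom ≫ (ψ (𝟙 a) f).hom) ≫ (λ_ (𝟙 a)).inv ▷ f =
      𝟙 a ◁ (λ_ f).hom ≫ ((unit @ψ a).hom ▷ f ≫ (ψ (𝟙 a) f).hom) ≫ (λ_ (𝟙 a)).inv ▷ f := by
    simp only [comp_whiskerRight, Category.assoc, whiskerLeft_inv_hom_assoc,
      inv_hom_whiskerRight_assoc, e2] at h ⊢
    rw [h, e1]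
    simp only [Category.assoc]
  rw [cancel_epi, cancel_mono, cancel_mono] at h5
  exact h5

end Cocycle

section Twist

variable (R : ∀ {a b : 𝔹}, (a ⟶ b) → (b ⟶ a)) (adj : ∀ {a b : 𝔹} (f : a ⟶ b), f ⊣ R f)
  {ψ : ∀ {a b c : 𝔹} (f : a ⟶ b) (g : b ⟶ c), f ≫ g ≅ f ≫ g} (hψ : Cocycle @ψ)

/-- Right adjoints form a contravariant structure, where the canonical isomorphisms
`R (f ≫ g) ≅ R g ≫ R f` can be twisted by a cocycle. -/
def DualStructure.ofAdj : DualStructure 𝔹 where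
  R := R
  M {_ _ f g} γ := conjugateEquiv (adj g) (adj f) γ
  M_id f := conjugateEquiv_id _
  M_comp γ δ := (conjugateEquiv_comp _ _ _ _ _).symm
  μ f g := conjugateIsoEquiv (adj (f ≫ g)) ((adj f).comp (adj g)) (ψ f g)
  nat_left f g g' η := by
    rw [← conjugateEquiv_whiskerLeft (adj f) (adj g') (adj g) η]
    simp only [conjugateIsoEquiv_apply_hom, conjugateEquiv_comp, hψ.nat_left]
  nat_right {_ _ _ f f'} η g := by
    rw [← conjugateEquiv_whiskerRight (adj f') (adj f) (adj g) η]
    simp only [conjugateIsoEquiv_apply_hom, conjugateEquiv_comp, hψ.nat_right]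
  assoc f g h := by
    simp only [conjugateIsoEquiv_apply_hom]
    rw [← conjugateEquiv_whiskerLeft (adj f) (adj (g ≫ h)) ((adj g).comp (adj h)),
      ← conjugateEquiv_whiskerRight (adj (f ≫ g)) ((adj f).comp (adj g)) (adj h)]
    have := (conjugateIsoEquiv (((adj f).comp (adj g)).comp (adj h))
      ((adj f).comp ((adj g).comp (adj h)))).injective
    have h2 := conjugateEquiv_associator_hom (adj f) (adj g) (adj h)
    -- The inverse associator of the duals is itself a mate, so both sides become mates for the same
    -- pair of adjunctions and the identity reduces to the cocycle condition.
    have h3 : (α_ (R h) (R g) (R f)).inv = conjugateEquiv (((adj f).comp (adj g)).comp (adj h))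
        ((adj f).comp ((adj g).comp (adj h))) (α_ f g h).inv := by
      rw [← cancel_epi (α_ (R h) (R g) (R f)).hom, Iso.hom_inv_id, ← h2, conjugateEquiv_comp,
        Iso.inv_hom_id, conjugateEquiv_id]
    rw [h3]
    simp only [conjugateEquiv_comp]
    congr 1
    simpa using hψ.cocycle f g h

include hψ

/-- This is the unit condition of a fiax structure for twisted duals. The twist ψ(f, 1) is f
whiskered with the value at the identity, which the inverse in the last factor cancels; what remains
is the untwisted statement about unitors and mates. -/
lemma map_rightUnitor_comp_μ {a b : 𝔹} (f : a ⟶ b) :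
    conjugateEquiv (adj f) (adj (f ≫ 𝟙 b)) (ρ_ f).hom ≫
      conjugateEquiv (adj (f ≫ 𝟙 b)) ((adj f).comp (adj (𝟙 b))) (ψ f (𝟙 b)).hom ≫
        conjugateEquiv (adj (𝟙 b)) (Adjunction.id b) (Cocycle.unit @ψ b).inv ▷ R f =
      (λ_ (R f)).inv := by
  rw [← conjugateEquiv_whiskerLeft (adj f) (adj (𝟙 b)) (Adjunction.id b), conjugateEquiv_comp,
    conjugateEquiv_comp, hψ.apply_id, Category.assoc, whiskerLeft_inv_hom_assoc]
  simpa using conjugateEquiv_comp_id_right_apply (adj f) (adj f) (𝟙 _)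

lemma map_leftUnitor_comp_μ {a b : 𝔹} (f : a ⟶ b) :
    conjugateEquiv (adj f) (adj (𝟙 a ≫ f)) (λ_ f).hom ≫
      conjugateEquiv (adj (𝟙 a ≫ f)) ((adj (𝟙 a)).comp (adj f)) (ψ (𝟙 a) f).hom ≫
        R f ◁ conjugateEquiv (adj (𝟙 a)) (Adjunction.id a) (Cocycle.unit @ψ a).inv =
      (ρ_ (R f)).inv := by
  rw [← conjugateEquiv_whiskerRight (adj (𝟙 a)) (Adjunction.id a) (adj f), conjugateEquiv_comp,
    conjugateEquiv_comp, hψ.id_apply, Category.assoc, inv_hom_whiskerRight_assoc]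
  simpa using conjugateEquiv_id_comp_right_apply (adj f) (adj f) (𝟙 _)

end Twist

end CategoryTheory.Bicategory

namespace CategoryTheory.Bicategory

open _root_.CategoryTheory.Bicategory

variable {𝔹 : Type w} [Bicategory.{v, u} 𝔹]

/-! ## Extending isomorphisms to the identity from an ideal -/

/-- A monoidal natural isomorphism from `T` to the identity. -/
structure SemiFunctor.IsoId (T : SemiFunctor 𝔹) where
  app : ∀ {a b : 𝔹} (f : a ⟶ b), T.N f ≅ f
  naturality : ∀ {a b : 𝔹} {f g : a ⟶ b} (γ : f ⟶ g), T.M γ ≫ (app g).hom = (app f).hom ≫ γ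
  app_comp : ∀ {a b c : 𝔹} (f : a ⟶ b) (g : b ⟶ c),
    (app (f ≫ g)).hom = (T.ν f g).hom ≫ (app f).hom ▷ T.N g ≫ f ◁ (app g).hom

variable (𝔹) in
/-- A right ideal `P` of 1-morphisms together with `ξ a : I a ⟶ 𝟙 a` in `P` which is a coequalizer
of the two induced 2-morphisms `I a ≫ I a ⟶ I a`, universally. -/
structure UnitResolution where
  I : ∀ a : 𝔹, a ⟶ a
  ξ : ∀ a, I a ⟶ 𝟙 a
  epi : ∀ {a b : 𝔹} (f : a ⟶ b), Epi (ξ a ▷ f ≫ (λ_ f).hom)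
  desc : ∀ {a b : 𝔹} {f g : a ⟶ b} (t : I a ≫ f ⟶ g),
    (ξ a ▷ I a ≫ (λ_ (I a)).hom) ▷ f ≫ t = (I a ◁ ξ a ≫ (ρ_ (I a)).hom) ▷ f ≫ t →
      ∃ s : f ⟶ g, (ξ a ▷ f ≫ (λ_ f).hom) ≫ s = t
  P : ∀ {a b : 𝔹}, (a ⟶ b) → Prop
  mem_I : ∀ a, P (I a)
  mem_comp : ∀ {a b c : 𝔹} (f : a ⟶ b) (g : b ⟶ c), P f → P (f ≫ g)
  split : ∀ {a b : 𝔹} (f : a ⟶ b), P f → ∃ s, s ≫ f ◁ ξ b ≫ (ρ_ f).hom = 𝟙 f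

namespace UnitResolution

variable (X : UnitResolution 𝔹)

/-- The projection `I a ≫ f ⟶ f`. -/
def proj {a b : 𝔹} (f : a ⟶ b) : X.I a ≫ f ⟶ f := X.ξ a ▷ f ≫ (λ_ f).hom

instance {a b : 𝔹} (f : a ⟶ b) : Epi (X.proj f) := X.epi f

lemma proj_naturality {a b : 𝔹} {f g : a ⟶ b} (γ : f ⟶ g) :
    X.I a ◁ γ ≫ X.proj g = X.proj f ≫ γ := by
  rw [proj, proj, ← Category.assoc, whisker_exchange, Category.assoc, leftUnitor_naturality,
    Category.assoc]

/-- By interchange both sides are the horizontal square of ξ followed by the unitor of the identity,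
where the two unitors coincide. -/
lemma proj_eq (a : 𝔹) : (X.ξ a ▷ X.I a ≫ (λ_ (X.I a)).hom) ≫ X.ξ a =
    (X.I a ◁ X.ξ a ≫ (ρ_ (X.I a)).hom) ≫ X.ξ a := by
  rw [Category.assoc, Category.assoc, ← leftUnitor_naturality, ← rightUnitor_naturality,
    ← Category.assoc, ← Category.assoc, whisker_exchange, unitors_equal]

/-- The coequalizer presenting f is taken along two maps of the form γ ▷ f. A pair (t, t') that
commutes with whiskering by every γ is therefore a map of the parallel pairs and descends. -/
lemma exists_desc {a b : 𝔹} {f g : a ⟶ b} (t : X.I a ≫ f ⟶ X.I a ≫ g)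
    (t' : (X.I a ≫ X.I a) ≫ f ⟶ (X.I a ≫ X.I a) ≫ g)
    (h : ∀ γ : X.I a ≫ X.I a ⟶ X.I a, γ ▷ f ≫ t = t' ≫ γ ▷ g) :
    ∃ s : f ⟶ g, X.proj f ≫ s = t ≫ X.proj g := by
  refine X.desc _ ?_
  rw [reassoc_of% h, reassoc_of% h, proj, ← comp_whiskerRight_assoc, proj_eq,
    comp_whiskerRight_assoc]

lemma whiskerLeft_injective {a b : 𝔹} {f g : a ⟶ b} {γ δ : f ⟶ g}
    (h : X.I a ◁ γ = X.I a ◁ δ) : γ = δ := by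
  rw [← cancel_epi (X.proj f), ← proj_naturality, h, proj_naturality]

variable {X} {T : SemiFunctor 𝔹} (φ : ∀ {a b : 𝔹} (f : a ⟶ b), X.P f → (T.N f ≅ f))

/-- The comparison `f ≫ T.N g ⟶ f ≫ g`, for `f` in the ideal. -/
def compare {a b c : 𝔹} (f : a ⟶ b) (hf : X.P f) (g : b ⟶ c) : f ≫ T.N g ≅ f ≫ g :=
  whiskerRightIso (φ f hf).symm (T.N g) ≪≫ (T.ν f g).symm ≪≫ φ (f ≫ g) (X.mem_comp f g hf)

lemma ν_compare {a b c : 𝔹} (f : a ⟶ b) (hf : X.P f) (g : b ⟶ c) :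
    (T.ν f g).hom ≫ (φ f hf).hom ▷ T.N g ≫ (compare @φ f hf g).hom =
      (φ (f ≫ g) (X.mem_comp f g hf)).hom := by
  simp [compare]

variable (hφ : ∀ {a b : 𝔹} {f g : a ⟶ b} (hf : X.P f) (hg : X.P g) (γ : f ⟶ g),
    T.M γ ≫ (φ g hg).hom = (φ f hf).hom ≫ γ)
include hφ

lemma compare_naturality_left {a b c : 𝔹} {f f' : a ⟶ b} (hf : X.P f) (hf' : X.P f')
    (γ : f ⟶ f') (g : b ⟶ c) :
    γ ▷ T.N g ≫ (compare @φ f' hf' g).hom = (compare @φ f hf g).hom ≫ γ ▷ g := by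
  have h1 : γ ≫ (φ f' hf').inv = (φ f hf).inv ≫ T.M γ := by
    rw [Iso.comp_inv_eq, Category.assoc, hφ hf hf', Iso.inv_hom_id_assoc]
  have h2 : T.M γ ▷ T.N g ≫ (T.ν f' g).inv = (T.ν f g).inv ≫ T.M (γ ▷ g) := by
    rw [Iso.comp_inv_eq, Category.assoc, T.nat_right, Iso.inv_hom_id_assoc]
  simp only [compare, Iso.trans_hom, whiskerRightIso_hom, Iso.symm_hom, Category.assoc]
  rw [← comp_whiskerRight_assoc, h1, comp_whiskerRight_assoc, reassoc_of% h2,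
    hφ (X.mem_comp f g hf) (X.mem_comp f' g hf')]

lemma compare_naturality_right {a b c : 𝔹} (f : a ⟶ b) (hf : X.P f) {g g' : b ⟶ c}
    (γ : g ⟶ g') :
    f ◁ T.M γ ≫ (compare @φ f hf g').hom = (compare @φ f hf g).hom ≫ f ◁ γ := by
  have h2 : T.N f ◁ T.M γ ≫ (T.ν f g').inv = (T.ν f g).inv ≫ T.M (f ◁ γ) := by
    rw [Iso.comp_inv_eq, Category.assoc, T.nat_left, Iso.inv_hom_id_assoc]
  simp only [compare, Iso.trans_hom, whiskerRightIso_hom, Iso.symm_hom, Category.assoc]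
  rw [whisker_exchange_assoc, reassoc_of% h2, hφ (X.mem_comp f g hf) (X.mem_comp f g' hf)]

variable (hφ' : ∀ {a b c : 𝔹} (f : a ⟶ b) (g : b ⟶ c) (hf : X.P f) (hg : X.P g),
    (φ (f ≫ g) (X.mem_comp f g hf)).hom =
      (T.ν f g).hom ≫ (φ f hf).hom ▷ T.N g ≫ f ◁ (φ g hg).hom)
include hφ'

/-- Here monoidality of φ on the ideal enters: expanding φ on f ≫ (g ≫ h) in two ways with the
coherence of ν, and cancelling the invertible factors, shows that the comparison for f ≫ g depends
on g only. -/
lemma compare_comp {a b c d : 𝔹} (f : a ⟶ b) (g : b ⟶ c) (hf : X.P f) (hg : X.P g)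
    (h : c ⟶ d) :
    (compare @φ (f ≫ g) (X.mem_comp f g hf) h).hom =
      (α_ f g (T.N h)).hom ≫ f ◁ (compare @φ g hg h).hom ≫ (α_ f g h).inv := by
  have e1 : (φ ((f ≫ g) ≫ h) (X.mem_comp (f ≫ g) h (X.mem_comp f g hf))).hom =
      T.M (α_ f g h).hom ≫ (φ (f ≫ (g ≫ h)) (X.mem_comp f _ hf)).hom ≫ (α_ f g h).inv := by
    rw [reassoc_of% hφ (X.mem_comp (f ≫ g) h (X.mem_comp f g hf)) (X.mem_comp f _ hf),
      Iso.hom_inv_id, Category.comp_id]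
  have e2 := ν_compare @φ (f ≫ g) (X.mem_comp f g hf) h
  rw [e1, hφ' f (g ≫ h) hf (X.mem_comp g h hg), hφ' f g hf hg, ← ν_compare @φ g hg h] at e2
  simp only [comp_whiskerRight, whiskerLeft_comp, Category.assoc] at e2
  have e3 := T.assoc f g h
  rw [← whisker_exchange_assoc, reassoc_of% e3, cancel_epi] at e2
  have e4 : (α_ (T.N f) (T.N g) (T.N h)).hom ≫ (φ f hf).hom ▷ (T.N g ≫ T.N h) =
      (φ f hf).hom ▷ T.N g ▷ T.N h ≫ (α_ f (T.N g) (T.N h)).hom := by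
    rw [associator_naturality_left]
  have e5 : (α_ f (T.N g) (T.N h)).hom ≫ f ◁ (φ g hg).hom ▷ T.N h =
      (f ◁ (φ g hg).hom) ▷ T.N h ≫ (α_ f g (T.N h)).hom := by
    rw [associator_naturality_middle]
  rw [reassoc_of% e4, reassoc_of% e5] at e2
  rwa [← cancel_epi ((f ◁ (φ g hg).hom) ▷ T.N h), ← cancel_epi ((φ f hf).hom ▷ T.N g ▷ T.N h),
    ← cancel_epi ((T.ν f g).hom ▷ T.N h)]

/-- For `I` in the ideal, `compare` identifies I ≫ T.N f with I ≫ f naturally in the first factor.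
So it descends along the coequalizers presenting T.N f and f, and so does its inverse; the
epimorphisms `proj` make the two results mutually inverse. -/
lemma exists_app {a b : 𝔹} (f : a ⟶ b) : ∃ s : T.N f ≅ f,
    X.proj (T.N f) ≫ s.hom = (compare @φ (X.I a) (X.mem_I a) f).hom ≫ X.proj f := by
  have hI := X.mem_I a
  have hII := X.mem_comp _ (X.I a) hI
  obtain ⟨s, hs⟩ := X.exists_desc (compare @φ (X.I a) hI f).hom (compare @φ _ hII f).hom
    (fun γ => compare_naturality_left @φ hφ hII hI γ f)
  obtain ⟨t, ht⟩ := X.exists_desc (compare @φ (X.I a) hI f).inv (compare @φ _ hII f).inv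
    (fun γ => by
      rw [Iso.comp_inv_eq, Category.assoc, compare_naturality_left @φ hφ hII hI γ f,
        Iso.inv_hom_id_assoc])
  refine ⟨⟨s, t, ?_, ?_⟩, hs⟩
  · rw [← cancel_epi (X.proj (T.N f)), reassoc_of% hs, ht, Iso.hom_inv_id_assoc,
      Category.comp_id]
  · rw [← cancel_epi (X.proj f), reassoc_of% ht, hs, Iso.inv_hom_id_assoc, Category.comp_id]

/-- By construction of the left-hand side and `compare_comp`, both agree after restriction along the
projection f ≫ I → f whiskered with T.N g. For f in the ideal this projection has a section, so it
can be cancelled. -/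
lemma whiskerLeft_app {a b c : 𝔹} (f : a ⟶ b) (hf : X.P f) (g : b ⟶ c) :
    f ◁ (exists_app @φ hφ hφ' g).choose.hom = (compare @φ f hf g).hom := by
  have h := (exists_app @φ hφ hφ' g).choose_spec
  set s := (exists_app @φ hφ hφ' g).choose
  obtain ⟨t, ht⟩ := X.split f hf
  have hfI := X.mem_comp f (X.I b) hf
  have e (k : b ⟶ c) : (f ◁ X.ξ b ≫ (ρ_ f).hom) ▷ k = (α_ _ _ _).hom ≫ f ◁ X.proj k := by
    simp [proj]
  have h1 : (f ◁ X.ξ b ≫ (ρ_ f).hom) ▷ T.N g ≫ f ◁ s.hom =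
      (f ◁ X.ξ b ≫ (ρ_ f).hom) ▷ T.N g ≫ (compare @φ f hf g).hom := by
    rw [compare_naturality_left @φ hφ hfI hf,
      compare_comp @φ hφ hφ' f (X.I b) hf (X.mem_I b) g, e, e]
    simp only [Category.assoc, Iso.inv_hom_id_assoc, ← whiskerLeft_comp, h]
  have h2 := congrArg (t ▷ T.N g ≫ ·) h1
  simpa only [← comp_whiskerRight_assoc, ht, id_whiskerRight, Category.id_comp] using h2

/-- A monoidal natural isomorphism to the identity on the ideal extends. -/
noncomputable def isoId : T.IsoId where
  app f := (exists_app @φ hφ hφ' f).choose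
  naturality {a b f g} γ := by
    have hf := (exists_app @φ hφ hφ' f).choose_spec
    have hg := (exists_app @φ hφ hφ' g).choose_spec
    rw [← cancel_epi (X.proj (T.N f)), ← reassoc_of% X.proj_naturality, hg, reassoc_of% hf,
      reassoc_of% compare_naturality_right @φ hφ, X.proj_naturality]
  app_comp {a b c} f g := by
    have hI := X.mem_I a
    have hIf := X.mem_comp _ f hI
    -- After whiskering with `I` every component is a `compare`, by `whiskerLeft_app`, applied to
    -- `I` or to I ≫ f. Both are in the ideal, so the claim becomes associativity coherence of ν and
    -- φ.
    apply X.whiskerLeft_injective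
    rw [whiskerLeft_app @φ hφ hφ' _ hI, ← cancel_epi ((φ _ hI).hom ▷ T.N (f ≫ g)),
      ← cancel_epi (T.ν _ (f ≫ g)).hom, ν_compare]
    have e1 : (φ (X.I a ≫ (f ≫ g)) (X.mem_comp _ _ hI)).hom =
        T.M (α_ _ f g).inv ≫ (φ ((X.I a ≫ f) ≫ g) (X.mem_comp _ g hIf)).hom ≫ (α_ _ f g).hom := by
      rw [reassoc_of% hφ (X.mem_comp _ (f ≫ g) hI) (X.mem_comp _ g hIf), Iso.inv_hom_id,
        Category.comp_id]
    have w1 := whiskerLeft_app @φ hφ hφ' _ hIf g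
    have w2 := whiskerLeft_app @φ hφ hφ' _ hI f
    generalize (exists_app @φ hφ hφ' f).choose = s at w2 ⊢
    generalize (exists_app @φ hφ hφ' g).choose = t at w1 ⊢
    rw [e1, ← ν_compare @φ _ hIf g, ← ν_compare @φ _ hI f, ← w1, ← w2]
    have e3 := T.assoc (X.I a) f g
    have e4 : T.M (α_ (X.I a) f g).inv ≫ (T.ν (X.I a ≫ f) g).hom ≫ (T.ν (X.I a) f).hom ▷ T.N g =
        (T.ν (X.I a) (f ≫ g)).hom ≫ T.N (X.I a) ◁ (T.ν f g).hom ≫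
          (α_ (T.N (X.I a)) (T.N f) (T.N g)).inv := by
      have : T.M (α_ (X.I a) f g).inv ≫ T.M (α_ (X.I a) f g).hom = 𝟙 _ := by
        rw [← T.M_comp, Iso.inv_hom_id, T.M_id]
      rw [← cancel_mono (α_ (T.N (X.I a)) (T.N f) (T.N g)).hom]
      simp only [Category.assoc, Iso.inv_hom_id, Category.comp_id]
      rw [← e3, reassoc_of% this]
    simp only [comp_whiskerRight, Category.assoc, whiskerLeft_comp]
    have e5 := whisker_exchange (φ _ hI).hom (T.ν f g).hom
    rw [reassoc_of% e4, ← reassoc_of% e5]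
    simp [comp_whiskerLeft]

end UnitResolution

end CategoryTheory.Bicategory

namespace TwoSemicat

open Bicategory

variable {k : Type x} [Field k] {B : Type w} {D : TwoSemicat.{v, u} k B}

/-! ## The bicategory of a 2-semicategory with weak units -/

/-- The objects of a 2-semicategory with weak units. -/
@[nolint unusedArguments]
def Obj {one : ∀ i : B, D.Hom i i} (_ : ∀ i, WeakUnit D (one i)) : Type w := B

section

variable {one : ∀ i : B, D.Hom i i} {W : ∀ i, WeakUnit D (one i)}

lemma pentagon_inv {i j m n p : B} (K : D.Hom n p) (H : D.Hom m n) (G : D.Hom j m)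
    (F : D.Hom i j) :
    (K ◁ₛ (assoc H G F).inv) ≫ (assoc K (H ⊚ G) F).inv ≫ ((assoc K H G).inv ▷ₛ F) =
      (assoc K H (G ⊚ F)).inv ≫ (assoc (K ⊚ H) G F).inv := by
  have h1 : (K ◁ₛ (assoc H G F).hom) ≫ (K ◁ₛ (assoc H G F).inv) = 𝟙 _ := by
    rw [← D.whiskerLeft_comp, Iso.hom_inv_id, D.whiskerLeft_id]
  have h2 : ((assoc K H G).hom ▷ₛ F) ≫ ((assoc K H G).inv ▷ₛ F) = 𝟙 _ := by
    rw [← D.comp_whiskerRight, Iso.hom_inv_id, D.id_whiskerRight]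
  have h := D.pentagon K H G F
  rw [← cancel_epi ((assoc (K ⊚ H) G F).hom ≫ (assoc K H (G ⊚ F)).hom)]
  conv_lhs => rw [← h]
  simp only [Category.assoc, Iso.hom_inv_id_assoc, Iso.hom_inv_id]
  rw [reassoc_of% h1, Iso.hom_inv_id_assoc, h2]

lemma whiskerRight_hcomp {i j m n : B} {H H' : D.Hom m n} (η : H ⟶ H') (G : D.Hom j m)
    (F : D.Hom i j) : η ▷ₛ (G ⊚ F) =
      (assoc H G F).inv ≫ ((η ▷ₛ G) ▷ₛ F) ≫ (assoc H' G F).hom := by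
  rw [D.associator_naturality_left, Iso.inv_hom_id_assoc]

lemma whiskerLeft_whiskerRight {i j m n : B} (H : D.Hom m n) {G G' : D.Hom j m} (η : G ⟶ G')
    (F : D.Hom i j) : H ◁ₛ (η ▷ₛ F) =
      (assoc H G F).inv ≫ ((H ◁ₛ η) ▷ₛ F) ≫ (assoc H G' F).hom := by
  rw [D.associator_naturality_middle, Iso.inv_hom_id_assoc]

lemma hcomp_whiskerLeft {i j m n : B} (H : D.Hom m n) (G : D.Hom j m) {F F' : D.Hom i j}
    (η : F ⟶ F') : (H ⊚ G) ◁ₛ η =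
      (assoc H G F).hom ≫ (H ◁ₛ (G ◁ₛ η)) ≫ (assoc H G F').inv := by
  rw [← Category.assoc, Iso.eq_comp_inv, D.associator_naturality_right]

/-- The inverse associativity isomorphism. -/
def assocSymm {i j m n : B} (H : D.Hom m n) (G : D.Hom j m) (F : D.Hom i j) :
    H ⊚ G ⊚ F ≅ (H ⊚ G) ⊚ F :=
  (assoc H G F).symm

/-- The left unitor of a weak unit. -/
noncomputable def WeakUnit.lIso {i j : B} {I : D.Hom i i} (V : WeakUnit D I) (F : D.Hom j i) :
    I ⊚ F ≅ F := asIso (V.l F)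

/-- The right unitor of a weak unit. -/
noncomputable def WeakUnit.rIso {i j : B} {I : D.Hom i i} (V : WeakUnit D I) (F : D.Hom i j) :
    F ⊚ I ≅ F := asIso (V.r F)

lemma WeakUnit.one_whiskerLeft {i j : B} {I : D.Hom i i} (V : WeakUnit D I) {F G : D.Hom j i}
    (η : F ⟶ G) : I ◁ₛ η = (V.lIso F).hom ≫ η ≫ (V.lIso G).inv := by
  rw [← Category.assoc, Iso.eq_comp_inv]
  exact V.l_naturality η

lemma WeakUnit.whiskerRight_one {i j : B} {I : D.Hom i i} (V : WeakUnit D I) {F G : D.Hom i j}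
    (η : F ⟶ G) : η ▷ₛ I = (V.rIso F).hom ≫ η ≫ (V.rIso G).inv := by
  rw [← Category.assoc, Iso.eq_comp_inv]
  exact V.r_naturality η

lemma WeakUnit.triangle {i j m : B} {I : D.Hom i i} (V : WeakUnit D I) (F : D.Hom j i)
    (G : D.Hom i m) : (assoc G I F).inv ≫ ((V.rIso G).hom ▷ₛ F) = G ◁ₛ (V.lIso F).hom :=
  (Iso.inv_comp_eq _).2 (V.compat F G).symm

/-- A 2-semicategory with weak units is a bicategory, where `F ≫ G` is `G ⊚ F`. -/
noncomputable instance bicategory : Bicategory (Obj W) where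
  Hom i j := D.Hom i j
  id i := one i
  comp F G := D.hcomp G F
  homCategory i j := D.cat i j
  whiskerLeft F _ _ η := D.whiskerRight η F
  whiskerRight η G := D.whiskerLeft G η
  associator F G H := assocSymm H G F
  leftUnitor {i _} F := (W i).rIso F
  rightUnitor {_ j} F := (W j).lIso F
  whiskerLeft_id F G := D.id_whiskerRight G F
  whiskerLeft_comp F _ _ _ η θ := D.comp_whiskerRight η θ F
  id_whiskerLeft {i _ _ _} η := (W i).whiskerRight_one η
  comp_whiskerLeft F G _ _ η := whiskerRight_hcomp η G F
  id_whiskerRight F G := D.whiskerLeft_id G F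
  comp_whiskerRight η θ G := D.whiskerLeft_comp G η θ
  whiskerRight_id {_ j _ _} η := (W j).one_whiskerLeft η
  whiskerRight_comp η G H := hcomp_whiskerLeft H G η
  whisker_assoc F _ _ η H := whiskerLeft_whiskerRight H η F
  whisker_exchange η θ := (D.whisker_exchange θ η).symm
  pentagon F G H K := pentagon_inv K H G F
  triangle {_ j _} F G := (W j).triangle F G

end

end TwoSemicat

/-! ### Adjoint pairs for weak units as adjunctions, and mates -/

namespace CategoryTheory.Bicategory

open _root_.CategoryTheory.Bicategory

variable {𝔹 : Type w} [Bicategory.{v, u} 𝔹]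

/-- The zigzag is defined through coherence isomorphisms; this form with a visible associator is the
one that matches `AdjointPair`. -/
lemma leftZigzag_eq {a b : 𝔹} {f : a ⟶ b} {g : b ⟶ a} (η : 𝟙 a ⟶ f ≫ g) (θ : g ≫ f ⟶ 𝟙 b) :
    leftZigzag η θ = η ▷ f ≫ (α_ f g f).hom ≫ f ◁ θ := by
  rw [leftZigzag]; bicategory

lemma rightZigzag_eq {a b : 𝔹} {f : a ⟶ b} {g : b ⟶ a} (η : 𝟙 a ⟶ f ≫ g) (θ : g ≫ f ⟶ 𝟙 b) :
    rightZigzag η θ = g ◁ η ≫ (α_ g f g).inv ≫ θ ▷ g := by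
  rw [rightZigzag]; bicategory

end CategoryTheory.Bicategory

namespace TwoSemicat

variable {k : Type x} [Field k] {B : Type w} {D : TwoSemicat.{v, u} k B}
  {one : ∀ i : B, D.Hom i i} {W : ∀ i, WeakUnit D (one i)}

lemma adjointPair_triangle_left_iff {i j : B} {F : D.Hom i j} {G : D.Hom j i}
    (α : one i ⟶ G ⊚ F) (β : F ⊚ G ⟶ one j) :
    (F ◁ₛ α) ≫ (assoc F G F).inv ≫ (β ▷ₛ F) = (W i).r F ≫ inv ((W j).l F) ↔
    ((BilaxUnits.ofWeakUnits W).oplax i).r F ≫ (F ◁ₛ α) ≫ (assoc F G F).inv ≫ (β ▷ₛ F) ≫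
      ((BilaxUnits.ofWeakUnits W).lax j).l F = 𝟙 F := by
  change _ ↔ inv ((W i).r F) ≫ (F ◁ₛ α) ≫ (assoc F G F).inv ≫ (β ▷ₛ F) ≫ (W j).l F = 𝟙 F
  rw [IsIso.inv_comp_eq, IsIso.eq_comp_inv, Category.comp_id]
  simp only [Category.assoc]

lemma adjointPair_triangle_right_iff {i j : B} {F : D.Hom i j} {G : D.Hom j i}
    (α : one i ⟶ G ⊚ F) (β : F ⊚ G ⟶ one j) :
    (α ▷ₛ G) ≫ (assoc G F G).hom ≫ (G ◁ₛ β) = (W i).l G ≫ inv ((W j).r G) ↔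
    ((BilaxUnits.ofWeakUnits W).oplax i).l G ≫ (α ▷ₛ G) ≫ (assoc G F G).hom ≫ (G ◁ₛ β) ≫
      ((BilaxUnits.ofWeakUnits W).lax j).r G = 𝟙 G := by
  change _ ↔ inv ((W i).l G) ≫ (α ▷ₛ G) ≫ (assoc G F G).hom ≫ (G ◁ₛ β) ≫ (W j).r G = 𝟙 G
  rw [IsIso.inv_comp_eq, IsIso.eq_comp_inv, Category.comp_id]
  simp only [Category.assoc]

/-- A 1-morphism as a 1-morphism of the bicategory. -/
abbrev toHom (W : ∀ i, WeakUnit D (one i)) {i j : B} (F : D.Hom i j) :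
    (show Obj W from i) ⟶ (show Obj W from j) := F

/-- An adjoint pair is an adjunction in the bicategory. -/
def AdjointPair.toAdjunction {i j : B} {F : D.Hom i j} {G : D.Hom j i}
    (A : AdjointPair (BilaxUnits.ofWeakUnits W) F G) :
    Bicategory.Adjunction (toHom W F) (toHom W G) where
  unit := A.α
  counit := A.β
  left_triangle := (Bicategory.leftZigzag_eq _ _).trans
    ((adjointPair_triangle_left_iff (W := W) A.α A.β).2 A.triangle_left)
  right_triangle := (Bicategory.rightZigzag_eq _ _).trans
    ((adjointPair_triangle_right_iff (W := W) A.α A.β).2 A.triangle_right)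

/-- An adjunction in the bicategory is an adjoint pair. -/
def AdjointPair.ofAdjunction {i j : B} {F : D.Hom i j} {G : D.Hom j i}
    (A : Bicategory.Adjunction (toHom W F) (toHom W G)) :
    AdjointPair (BilaxUnits.ofWeakUnits W) F G where
  α := A.unit
  β := A.counit
  triangle_left := (adjointPair_triangle_left_iff (W := W) A.unit A.counit).1
    ((Bicategory.leftZigzag_eq _ _).symm.trans A.left_triangle)
  triangle_right := (adjointPair_triangle_right_iff (W := W) A.unit A.counit).1
    ((Bicategory.rightZigzag_eq _ _).symm.trans A.right_triangle)

/-- The mate of a 2-morphism under adjunctions. -/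
noncomputable def mate {i j : B} {F G : D.Hom i j} {F' G' : D.Hom j i}
    (A : Bicategory.Adjunction (toHom W F) (toHom W F'))
    (A' : Bicategory.Adjunction (toHom W G) (toHom W G'))
    (γ : F ⟶ G) : G' ⟶ F' :=
  Bicategory.conjugateEquiv A' A γ

/-- This is condition 3 of a fiax structure: for weak units it holds for any choice of right
adjoints, once ⋆ on 2-morphisms is defined as the mate. It also makes linearity of the mate visible.
-/
lemma mate_eq {i j : B} {F G : D.Hom i j} {F' G' : D.Hom j i}
    (A : Bicategory.Adjunction (toHom W F) (toHom W F'))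
    (A' : Bicategory.Adjunction (toHom W G) (toHom W G'))
    (γ : F ⟶ G) :
    mate A A' γ = ((BilaxUnits.ofWeakUnits W).oplax i).l G' ≫
      ((AdjointPair.ofAdjunction A).α ▷ₛ G') ≫ (assoc F' F G').hom ≫ (F' ◁ₛ (γ ▷ₛ G')) ≫
        (F' ◁ₛ (AdjointPair.ofAdjunction A').β) ≫
          ((BilaxUnits.ofWeakUnits W).lax j).r F' := by
  have h : ((F' ◁ₛ γ) ▷ₛ G') ≫ (assoc F' G G').hom = (assoc F' F G').hom ≫ (F' ◁ₛ (γ ▷ₛ G')) :=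
    D.associator_naturality_middle F' γ G'
  refine (Bicategory.conjugateEquiv_apply' A' A γ).trans ?_
  rw [← reassoc_of% h]
  rfl

lemma mate_add {i j : B} {F G : D.Hom i j} {F' G' : D.Hom j i}
    (A : Bicategory.Adjunction (toHom W F) (toHom W F'))
    (A' : Bicategory.Adjunction (toHom W G) (toHom W G'))
    (γ δ : F ⟶ G) : mate A A' (γ + δ) = mate A A' γ + mate A A' δ := by
  simp only [mate_eq, D.add_whiskerRight, D.whiskerLeft_add, Preadditive.comp_add,
    Preadditive.add_comp]

lemma mate_smul {i j : B} {F G : D.Hom i j} {F' G' : D.Hom j i}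
    (A : Bicategory.Adjunction (toHom W F) (toHom W F'))
    (A' : Bicategory.Adjunction (toHom W G) (toHom W G'))
    (c : k) (γ : F ⟶ G) : mate A A' (c • γ) = c • mate A A' γ := by
  simp only [mate_eq, D.smul_whiskerRight, D.whiskerLeft_smul, Linear.comp_smul,
    Linear.smul_comp]

/-! ### Fiax structures from chosen right adjoints and a cocycle -/

section Fiax

variable (R : ∀ {i j : B}, D.Hom i j → D.Hom j i)
  (adj : ∀ {i j : B} (F : D.Hom i j), Bicategory.Adjunction (toHom W F) (toHom W (R F)))
  {ψ : ∀ {i j m : B} (G : D.Hom j m) (F : D.Hom i j), G ⊚ F ≅ G ⊚ F}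
  (hψ : Bicategory.Cocycle (𝔹 := Obj W) (fun {_ _ _} F G => ψ G F))

/-- The contravariant structure given by chosen right adjoints and a cocycle. -/
noncomputable def dualOfAdj : Bicategory.DualStructure (Obj W) :=
  Bicategory.DualStructure.ofAdj (𝔹 := Obj W) (fun {_ _} F => R F) (fun {_ _} F => adj F) hψ

/-- Chosen right adjoints and a cocycle form an antiequivalence, if all 1-morphisms are right
adjoints. -/
noncomputable def antiEquivalenceOfAdj
    (hR : ∀ {i j : B} (G : D.Hom j i), ∃ F : D.Hom i j, Nonempty (R F ≅ G)) :
    AntiEquivalence D where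
  obj := R
  map {_ _ F G} γ := mate (adj F) (adj G) γ
  map_id F := (dualOfAdj R adj hψ).M_id F
  map_comp f g := (dualOfAdj R adj hψ).M_comp f g
  map_add {_ _ F G} f g := mate_add (adj F) (adj G) f g
  map_smul {_ _ F G} c f := mate_smul (adj F) (adj G) c f
  map_bijective F G := (Bicategory.conjugateEquiv (adj G) (adj F)).bijective
  obj_essSurj G := hR G
  μ G F := (dualOfAdj R adj hψ).μ F G
  μ_naturality_left g F := (dualOfAdj R adj hψ).nat_left F g
  μ_naturality_right G _ _ f := (dualOfAdj R adj hψ).nat_right f G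
  μ_assoc H G F := (dualOfAdj R adj hψ).assoc F G H

/-- Chosen right adjoints and a cocycle form a fiax structure, if the double dual is isomorphic to
the identity. -/
noncomputable def fiaxOfAdj (φ : (dualOfAdj R adj hψ).double.IsoId) :
    FiaxStructure (BilaxUnits.ofWeakUnits W) where
  -- Essential surjectivity comes from the double dual: G is isomorphic to the dual of R G.
  toAntiEquivalence := antiEquivalenceOfAdj R adj hψ fun G => ⟨R G, ⟨φ.app (toHom W G)⟩⟩
  -- The inverse of the cocycle at the identity compensates the twist in μ, as the unit conditions
  -- require.
  ε i := Bicategory.conjugateIsoEquiv (adj (one i)) (Bicategory.Adjunction.id (show Obj W from i))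
    (Bicategory.Cocycle.unit (𝔹 := Obj W) (fun {_ _ _} F G => ψ G F) (show Obj W from i)).symm
  map_l F := Bicategory.map_rightUnitor_comp_μ (𝔹 := Obj W) (fun {_ _} F => R F)
    (fun {_ _} F => adj F) hψ F
  map_r F := Bicategory.map_leftUnitor_comp_μ (𝔹 := Obj W) (fun {_ _} F => R F)
    (fun {_ _} F => adj F) hψ F
  adj F := AdjointPair.ofAdjunction (adj F)
  map_eq {_ _ F G} γ := mate_eq (adj F) (adj G) γ
  doubleDual := ⟨{
    app F := φ.app (toHom W F)
    naturality f := φ.naturality (a := show Obj W from _) f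
    app_hcomp {_ _ _} G F := by
      refine (φ.app_comp (toHom W F) (toHom W G)).trans ((Category.assoc _ _ _).trans ?_)
      exact congrArg (fun t => _ ≫ _ ≫ t)
        (D.whisker_exchange (φ.app (toHom W G)).hom (φ.app (toHom W F)).hom) }⟩

end Fiax

end TwoSemicat

/-! ## Direct summands of finite direct sums -/

section

variable {A : Type u} [Category.{v} A] [Preadditive A]

/-- The class of objects which are direct summands of finite direct sums of objects in `P`,
without reference to the existence of these sums. -/
def SumRetract (P : ObjectProperty A) : ObjectProperty A := fun X =>
  ∃ (n : ℕ) (Y : Fin n → A) (s : ∀ t, X ⟶ Y t) (p : ∀ t, Y t ⟶ X),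
    (∀ t, P (Y t)) ∧ ∑ t, s t ≫ p t = 𝟙 X

namespace SumRetract

variable {P Q : ObjectProperty A}

lemma of_fintype {ι : Type*} [Fintype ι] {X : A} (Y : ι → A) (s : ∀ t, X ⟶ Y t)
    (p : ∀ t, Y t ⟶ X) (hY : ∀ t, P (Y t)) (h : ∑ t, s t ≫ p t = 𝟙 X) : SumRetract P X := by
  let e := (Fintype.equivFin ι).symm
  refine ⟨Fintype.card ι, fun t => Y (e t), fun t => s (e t), fun t => p (e t), fun t => hY _, ?_⟩
  rw [← h]
  exact Fintype.sum_equiv e _ _ fun _ => rfl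

lemma of_mem {X : A} (h : P X) : SumRetract P X :=
  of_fintype (ι := Unit) (fun _ => X) (fun _ => 𝟙 X) (fun _ => 𝟙 X) (fun _ => h) (by simp)

/-- Taking summands of finite sums twice gives nothing new: substitute the inner decompositions of
the identities into the outer one. -/
lemma bind (h : P ≤ SumRetract Q) {X : A} (hX : SumRetract P X) : SumRetract Q X := by
  obtain ⟨n, Y, s, p, hY, e⟩ := hX
  choose m Z s' p' hZ e' using fun t => h _ (hY t)
  refine of_fintype (ι := Σ t : Fin n, Fin (m t)) (fun a => Z a.1 a.2)
    (fun a => s a.1 ≫ s' a.1 a.2) (fun a => p' a.1 a.2 ≫ p a.1) (fun a => hZ _ _) ?_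
  rw [← e, Fintype.sum_sigma]
  refine Finset.sum_congr rfl fun t _ => ?_
  rw [← Category.id_comp (p t), ← e' t, Preadditive.sum_comp, Preadditive.comp_sum]
  simp only [Category.assoc]

lemma mono (h : P ≤ Q) {X : A} (hX : SumRetract P X) : SumRetract Q X :=
  hX.bind fun _ hY => of_mem (h _ hY)

lemma biproduct {n : ℕ} {Y : Fin n → A} (b : Bicone Y) (hb : b.IsBilimit)
    (hY : ∀ t, SumRetract P (Y t)) : SumRetract P b.pt :=
  bind (P := SumRetract P) (fun _ h => h) ⟨n, Y, b.π, b.ι, hY, IsBilimit.total hb⟩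

lemma retract {X Y : A} (r : Retract X Y) (hY : SumRetract P Y) : SumRetract P X :=
  bind (P := SumRetract P) (fun _ h => h)
    (of_fintype (ι := Unit) (fun _ => Y) (fun _ => r.i) (fun _ => r.r) (fun _ => hY) (by simp))

lemma of_additiveClosure {X : A} (h : additiveClosure P X) : SumRetract P X := by
  obtain ⟨n, Y, b, hY, ⟨hb⟩, ⟨r⟩⟩ := h
  exact (biproduct b hb fun t => of_mem (hY t)).retract r

lemma additiveClosure [HasFiniteBiproducts A] {X : A} (h : SumRetract P X) :
    additiveClosure P X := by
  obtain ⟨n, Y, s, p, hY, e⟩ := h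
  refine ⟨n, Y, biproduct.bicone Y, hY, ⟨biproduct.isBilimit Y⟩,
    ⟨⟨biproduct.lift s, biproduct.desc p, ?_⟩⟩⟩
  change biproduct.lift s ≫ biproduct.desc p = _
  rw [biproduct.lift_desc, e]

/-- The essential image of a fully faithful functor on an additive idempotent complete category is
closed under finite direct sums and direct summands. -/
lemma essImage {A' : Type*} [Category A'] [Preadditive A'] [HasFiniteBiproducts A']
    [IsIdempotentComplete A'] (F : A' ⥤ A) [F.Full] [F.Faithful] [F.Additive] {X : A}
    (h : SumRetract (fun Y => ∃ Z, Nonempty (Y ≅ F.obj Z)) X) : ∃ Z, Nonempty (X ≅ F.obj Z) := by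
  obtain ⟨n, Y, s, p, hY, e⟩ := h
  choose Z a using hY
  have a' t := (a t).some
  let i : X ⟶ F.obj (⨁ Z) := ∑ t, s t ≫ (a' t).hom ≫ F.map (biproduct.ι Z t)
  let r : F.obj (⨁ Z) ⟶ X := ∑ t, F.map (biproduct.π Z t) ≫ (a' t).inv ≫ p t
  have hir : i ≫ r = 𝟙 X := by
    rw [← e, Preadditive.sum_comp]
    refine Finset.sum_congr rfl fun t _ => ?_
    rw [Preadditive.comp_sum, Finset.sum_eq_single t]
    · have : F.map (biproduct.ι Z t) ≫ F.map (biproduct.π Z t) = 𝟙 _ := by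
        rw [← F.map_comp, biproduct.ι_π_self, F.map_id]
      simp only [Category.assoc]
      rw [reassoc_of% this, Iso.hom_inv_id_assoc]
    · intro u _ hu
      have : F.map (biproduct.ι Z t) ≫ F.map (biproduct.π Z u) = 0 := by
        rw [← F.map_comp, biproduct.ι_π_ne _ hu.symm, F.map_zero]
      simp only [Category.assoc]
      rw [reassoc_of% this]
      simp
    · simp
  -- The maps i and r make X a retract of the image of an object of the small category. The
  -- resulting idempotent lifts because F is full and faithful, and its splitting there is mapped to
  -- X.
  obtain ⟨V, j, q, hjq, hqj⟩ := IsIdempotentComplete.idempotents_split (⨁ Z) (F.preimage (r ≫ i))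
    (F.map_injective (by simp [reassoc_of% hir]))
  have hqj' : F.map q ≫ F.map j = r ≫ i := by rw [← F.map_comp, hqj, F.map_preimage]
  have hjq' : F.map j ≫ F.map q = 𝟙 _ := by rw [← F.map_comp, hjq, F.map_id]
  refine ⟨V, ⟨⟨i ≫ F.map q, F.map j ≫ r, ?_, ?_⟩⟩⟩
  · rw [Category.assoc, reassoc_of% hqj', hir, Category.comp_id, hir]
  · rw [Category.assoc, ← reassoc_of% hqj', hjq', Category.comp_id, hjq']

end SumRetract

end

/-! ## Indecomposable objects -/

section

variable {k : Type x} [Field k]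

open Polynomial in
-- Fitting's lemma through the minimal polynomial. Write it as X^n q with q prime to X; the two
-- Bézout terms evaluate to complementary idempotents. If the one divisible by X is 0 then r^n = 0,
-- and if it is 1 then r is invertible.
lemma isNilpotent_or_isUnit_of_idempotents {R : Type*} [Ring R] [Algebra k R] [Module.Finite k R]
    (h : ∀ e : R, e * e = e → e = 0 ∨ e = 1) (r : R) : IsNilpotent r ∨ IsUnit r := by
  have hr : IsIntegral k r := Algebra.IsIntegral.isIntegral r
  obtain ⟨q, hq, hX⟩ := exists_eq_pow_rootMultiplicity_mul_and_not_dvd (minpoly k r)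
    (minpoly.ne_zero hr) 0
  generalize rootMultiplicity 0 (minpoly k r) = n at hq
  rw [C_0, sub_zero] at hq hX
  -- The exponent n + 1 guarantees a factor X even when n = 0; splitting it off produces the inverse
  -- of r in the unit case.
  obtain ⟨a, b, hab⟩ : IsCoprime (X ^ (n + 1)) q :=
    ((irreducible_X.coprime_iff_not_dvd).2 hX).pow_left
  have hp : aeval r (X ^ n * q) = 0 := by rw [← hq, minpoly.aeval]
  have hab' : aeval r (a * X ^ (n + 1)) + aeval r (b * q) = 1 := by
    rw [← map_add, hab, map_one]
  have h0 : aeval r (a * X ^ (n + 1)) * aeval r (b * q) = 0 := by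
    rw [← map_mul, show a * X ^ (n + 1) * (b * q) = a * X * b * (X ^ n * q) by ring, map_mul, hp,
      mul_zero]
  rcases h (aeval r (a * X ^ (n + 1))) (by
    conv_rhs => rw [← mul_one (aeval r (a * X ^ (n + 1))), ← hab', mul_add, h0, add_zero]) with
    h1 | h1
  · refine Or.inl ⟨n, ?_⟩
    rw [h1, zero_add] at hab'
    rw [← mul_one (r ^ n), ← hab', ← aeval_X_pow (R := k), ← map_mul,
      show X ^ n * (b * q) = b * (X ^ n * q) by ring, map_mul, hp, mul_zero]
  · refine Or.inr (isUnit_iff_exists.2 ⟨aeval r (a * X ^ n), ?_, ?_⟩)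
    · rw [← h1, show a * X ^ (n + 1) = X * (a * X ^ n) by ring, map_mul _ X, aeval_X]
    · rw [← h1, show a * X ^ (n + 1) = a * X ^ n * X by ring, map_mul _ _ X, aeval_X]

/-- If a summand divided by the total is nilpotent, then the remaining sum divided by the total is 1
minus a nilpotent, hence still a unit, and induction applies. -/
lemma exists_isUnit_of_isUnit_sum {R : Type*} [Ring R] [Nontrivial R]
    (h : ∀ r : R, IsNilpotent r ∨ IsUnit r) {ι : Type*} (s : Finset ι) (f : ι → R)
    (hf : IsUnit (∑ t ∈ s, f t)) : ∃ t ∈ s, IsUnit (f t) := by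
  classical
  induction s using Finset.induction_on with
  | empty => simp at hf
  | insert a s ha ih =>
    rw [Finset.sum_insert ha] at hf
    obtain ⟨u, hu⟩ := hf
    rcases h (f a * ↑u⁻¹) with h1 | h1
    · have h2 : (∑ t ∈ s, f t) * ↑u⁻¹ = 1 - f a * ↑u⁻¹ := by
        rw [eq_sub_iff_add_eq', ← add_mul, ← hu, Units.mul_inv]
      have h3 := h1.isUnit_one_sub
      rw [← h2, Units.isUnit_mul_units] at h3
      obtain ⟨t, ht, h⟩ := ih h3
      exact ⟨t, Finset.mem_insert_of_mem ht, h⟩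
    · rw [Units.isUnit_mul_units] at h1
      exact ⟨a, Finset.mem_insert_self _ _, h1⟩

variable {A : Type u} [Category.{v} A] [Preadditive A]

/-- A nonzero object whose only idempotent endomorphisms are `0` and `1`. -/
structure IsIndec (X : A) : Prop where
  id_ne_zero : 𝟙 X ≠ 0
  idem : ∀ e : X ⟶ X, e ≫ e = e → e = 0 ∨ e = 𝟙 X

lemma IsIndec.indecomposable [HasBinaryBiproducts A] {X : A} (h : IsIndec X) :
    Indecomposable X := by
  refine ⟨fun h0 => h.id_ne_zero (h0.eq_of_src _ _), fun Y Z e => ?_⟩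
  rcases h.idem (e.hom ≫ biprod.fst ≫ biprod.inl ≫ e.inv) (by simp) with h1 | h1
  · left
    have : (biprod.inl : Y ⟶ Y ⊞ Z) ≫ (e.inv ≫ (e.hom ≫ biprod.fst ≫ biprod.inl ≫ e.inv) ≫ e.hom) ≫
      biprod.fst = 𝟙 Y := by simp
    rw [h1] at this
    rw [IsZero.iff_id_eq_zero, ← this]
    simp
  · right
    have : (biprod.inr : Z ⟶ Y ⊞ Z) ≫ (e.inv ≫ (e.hom ≫ biprod.fst ≫ biprod.inl ≫ e.inv) ≫ e.hom) ≫
      biprod.snd = 0 := by simp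
    rw [h1] at this
    rw [IsZero.iff_id_eq_zero, ← this]
    simp

/-- Splitting e and its complement 1 - e writes X as a direct sum of their images, one of which must
vanish. -/
lemma IsIndec.of_indecomposable [HasBinaryBiproducts A] [IsIdempotentComplete A] {X : A}
    (h : Indecomposable X) : IsIndec X := by
  refine ⟨fun h0 => h.1 ((IsZero.iff_id_eq_zero X).2 h0), fun e he => ?_⟩
  obtain ⟨Y, i, p, hip, hpi⟩ := IsIdempotentComplete.idempotents_split X e he
  obtain ⟨Z, j, q, hjq, hqj⟩ := IsIdempotentComplete.idempotents_split X (𝟙 X - e)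
    (by simp [Preadditive.sub_comp, Preadditive.comp_sub, he])
  have hiq : i ≫ q = 0 := by
    have : i ≫ q = (i ≫ p) ≫ (i ≫ (q ≫ j)) ≫ q := by simp [hjq, hip]
    rw [this, hqj, Preadditive.comp_sub, Category.comp_id, ← hpi, reassoc_of% hip, sub_self]
    simp
  have hjp : j ≫ p = 0 := by
    have : j ≫ p = (j ≫ q) ≫ (j ≫ (p ≫ i)) ≫ p := by simp [hjq, hip]
    have h2 : p ≫ i = 𝟙 X - q ≫ j := by rw [hpi, hqj]; abel
    rw [this, h2, Preadditive.comp_sub, Category.comp_id, reassoc_of% hjq, sub_self]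
    simp
  rcases h.2 Y Z ⟨biprod.lift p q, biprod.desc i j, by simp [hpi, hqj], by
    ext <;> simp [hip, hjq, hiq, hjp]⟩ with h0 | h0
  · left
    rw [← hpi, h0.eq_of_src i 0, comp_zero]
  · right
    have : 𝟙 X - e = 0 := by rw [← hqj, h0.eq_of_src j 0, comp_zero]
    exact (sub_eq_zero.1 this).symm

lemma IsIndec.of_fullyFaithful {A' : Type*} [Category A'] [Preadditive A'] (F : A' ⥤ A) [F.Full]
    [F.Faithful] [F.Additive] {X : A'} (h : IsIndec (F.obj X)) : IsIndec X where
  id_ne_zero h0 := h.id_ne_zero (by rw [← F.map_id, h0, F.map_zero])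
  idem e he := by
    rcases h.idem (F.map e) (by rw [← F.map_comp, he]) with h1 | h1
    · exact Or.inl (F.map_injective (h1.trans (F.map_zero _ _).symm))
    · exact Or.inr (F.map_injective (h1.trans (F.map_id _).symm))

lemma IsIndec.ofIso {X Y : A} (h : IsIndec X) (i : X ≅ Y) : IsIndec Y where
  id_ne_zero h0 := h.id_ne_zero (by
    rw [← i.hom_inv_id, ← Category.id_comp i.inv, h0]; simp)
  idem e he := by
    rcases h.idem (i.hom ≫ e ≫ i.inv) (by simp [reassoc_of% he]) with h1 | h1
    · left
      rw [← cancel_epi i.hom, ← cancel_mono i.inv, Category.assoc, h1]; simp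
    · right
      rw [← cancel_epi i.hom, ← cancel_mono i.inv, Category.assoc, h1]; simp

variable [Linear k A]

lemma IsIndec.isNilpotent_or_isUnit {X : A} [FiniteDimensional k (X ⟶ X)] (h : IsIndec X)
    (f : End X) : IsNilpotent f ∨ IsUnit f :=
  haveI : Module.Finite k (End X) := inferInstanceAs (FiniteDimensional k (X ⟶ X))
  isNilpotent_or_isUnit_of_idempotents (k := k) (R := End X) (fun e he => h.idem e he) f

variable (k) in
/-- An indecomposable direct summand of a finite direct sum is a direct summand of one of the
terms. -/
lemma IsIndec.exists_retract {P : ObjectProperty A} {X : A} [FiniteDimensional k (X ⟶ X)]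
    (h : IsIndec X) (hX : SumRetract P X) : ∃ Y, P Y ∧ Nonempty (Retract X Y) := by
  obtain ⟨n, Y, s, p, hY, e⟩ := hX
  have : Nontrivial (End X) := ⟨𝟙 X, 0, h.id_ne_zero⟩
  -- The identity of X is the sum of the endomorphisms through the Y t. In this local endomorphism
  -- ring one of them is invertible, and its inverse corrects p t to a retraction.
  obtain ⟨t, -, ht⟩ := exists_isUnit_of_isUnit_sum (h.isNilpotent_or_isUnit (k := k)) Finset.univ
    (fun t => End.of (s t ≫ p t)) (Eq.subst (motive := IsUnit) (Eq.symm e)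
      (isUnit_one (M := End X)))
  rw [isUnit_iff_isIso] at ht
  exact ⟨Y t, hY t, ⟨⟨s t, p t ≫ inv (s t ≫ p t), by
    rw [← Category.assoc, IsIso.hom_inv_id]⟩⟩⟩

/-- A nonzero direct summand of an indecomposable object is the whole object. -/
lemma IsIndec.nonempty_iso {X Y : A} (hY : IsIndec Y) (hX : 𝟙 X ≠ 0) (r : Retract X Y) :
    Nonempty (X ≅ Y) := by
  rcases hY.idem (r.r ≫ r.i) (by simp) with h | h
  · refine absurd ?_ hX
    have : 𝟙 X = r.i ≫ (r.r ≫ r.i) ≫ r.r := by simp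
    rw [this, h]
    simp
  · exact ⟨⟨r.i, r.r, r.retract, h⟩⟩

end

/-! ## The projective abelianization as an additive category -/

namespace ProjAb

variable {k : Type x} [Field k] {A : Type u} [Category.{v} A] [Preadditive A] [Linear k A]

instance : (emb k A).Full where
  map_surjective f := by
    obtain ⟨g, hg, rfl⟩ := homMk_surjective f
    exact ⟨g, rfl⟩

lemma null_nil (X Z : A) : (⟨X, []⟩ : ProjAb k A).null Z = ⊥ := by
  rw [null, Submodule.span_eq_bot]
  rintro _ ⟨y, hy, -⟩
  exact absurd hy List.not_mem_nil

instance : (emb k A).Faithful where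
  map_injective {X Y f g} h := by
    have h1 := homMk_eq.1 h
    change f - g ∈ (⟨Y, []⟩ : ProjAb k A).null X at h1
    rw [null_nil] at h1
    exact sub_eq_zero.1 h1

instance : (emb k A).Additive where
  map_add := rfl

/-- The class of an admissible morphism, as a linear map. -/
def homMkₗ (P Q : ProjAb k A) : admissible P Q →ₗ[k] (P ⟶ Q) where
  toFun g := homMk g.1 g.2
  map_add' _ _ := rfl
  map_smul' _ _ := rfl

instance (P Q : ProjAb k A) [FiniteDimensional k (P.X ⟶ Q.X)] : FiniteDimensional k (P ⟶ Q) :=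
  Module.Finite.of_surjective (homMkₗ P Q) fun f => by
    obtain ⟨g, hg, rfl⟩ := homMk_surjective f
    exact ⟨⟨g, hg⟩, rfl⟩

/-- The image of an idempotent g is the cokernel of 1 - g, obtained by adding this relation to those
of P. The identity represents the projection and g the inclusion; nothing is required of A. -/
instance : IsIdempotentComplete (ProjAb k A) where
  idempotents_split P p hp := by
    obtain ⟨g, hg, rfl⟩ := homMk_surjective p
    have h1 : g ≫ g - g ∈ P.null P.X := homMk_eq.1 hp
    have le (Z : A) : P.null Z ≤
        (⟨P.X, ⟨P.X, 𝟙 P.X - g⟩ :: P.rel⟩ : ProjAb k A).null Z :=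
      Submodule.span_mono fun _ ⟨y, hy, h⟩ => ⟨y, List.mem_cons_of_mem _ hy, h⟩
    have h2 : 𝟙 P.X - g ∈ (⟨P.X, ⟨P.X, 𝟙 P.X - g⟩ :: P.rel⟩ : ProjAb k A).null P.X :=
      Submodule.subset_span ⟨_, List.mem_cons_self, 𝟙 _, (Category.id_comp _).symm⟩
    refine ⟨⟨P.X, ⟨P.X, 𝟙 P.X - g⟩ :: P.rel⟩, homMk (P := ⟨P.X, _⟩) g ?_,
      homMk (Q := ⟨P.X, _⟩) (𝟙 P.X) ?_, homMk_eq.2 ?_, homMk_congr (Category.id_comp _)⟩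
    · intro y hy
      rcases List.mem_cons.1 hy with rfl | hy
      · have e : (𝟙 P.X - g) ≫ g = -(g ≫ g - g) := by
          rw [Preadditive.sub_comp, Category.id_comp, neg_sub]
        exact Set.mem_of_eq_of_mem e (neg_mem h1)
      · exact hg y hy
    · intro y hy
      rw [Category.comp_id]
      exact le _ (P.id_mem y hy |> fun h => by rwa [Category.comp_id] at h)
    · have e : g ≫ 𝟙 P.X - 𝟙 P.X = -(𝟙 P.X - g) := by rw [Category.comp_id, neg_sub]
      exact Set.mem_of_eq_of_mem e (neg_mem h2)

section Biproducts

variable [HasFiniteBiproducts A] {n : ℕ} (P : Fin n → ProjAb k A)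

/-- The direct sum of finitely many objects of the projective abelianization. -/
noncomputable def sum : ProjAb k A where
  X := ⨁ fun t => (P t).X
  rel := (List.finRange n).flatMap fun t =>
    (P t).rel.map fun y => ⟨y.1, y.2 ≫ biproduct.ι (fun t => (P t).X) t⟩

lemma mem_admissible_sum {Q : ProjAb k A} {g : (⨁ fun t => (P t).X) ⟶ Q.X} :
    g ∈ admissible (sum P) Q ↔
      ∀ t, biproduct.ι (fun t => (P t).X) t ≫ g ∈ admissible (P t) Q := by
  constructor
  · intro h t y hy
    rw [← Category.assoc]
    exact h ⟨y.1, y.2 ≫ biproduct.ι (fun t => (P t).X) t⟩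
      (List.mem_flatMap.2 ⟨t, List.mem_finRange t, List.mem_map.2 ⟨y, hy, rfl⟩⟩)
  · intro h y hy
    obtain ⟨t, -, ht⟩ := List.mem_flatMap.1 hy
    obtain ⟨z, hz, rfl⟩ := List.mem_map.1 ht
    have := h t z hz
    rw [← Category.assoc] at this
    exact this

lemma ι_mem (t : Fin n) : biproduct.ι (fun t => (P t).X) t ∈ admissible (P t) (sum P) :=
  Set.mem_of_eq_of_mem (Category.comp_id (biproduct.ι (fun t => (P t).X) t)).symm
    ((mem_admissible_sum P).1 (id_mem (sum P)) t)

lemma π_mem (t : Fin n) : biproduct.π (fun t => (P t).X) t ∈ admissible (sum P) (P t) := by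
  rw [mem_admissible_sum]
  intro u
  by_cases h : u = t
  · subst h
    rw [biproduct.ι_π_self]
    exact id_mem _
  · rw [biproduct.ι_π_ne _ h]
    exact zero_mem _

/-- The direct sum of finitely many objects, with its structural morphisms. -/
noncomputable def sumBicone : Bicone P where
  pt := sum P
  π t := homMk (P := sum P) (biproduct.π (fun t => (P t).X) t) (π_mem P t)
  ι t := homMk (Q := sum P) (biproduct.ι (fun t => (P t).X) t) (ι_mem P t)
  ι_π t u := by
    by_cases h : t = u
    · subst h
      rw [dif_pos rfl]
      exact homMk_congr (biproduct.ι_π_self _ _)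
    · rw [dif_neg h]
      exact homMk_congr (biproduct.ι_π_ne _ h)

lemma sumBicone_total : ∑ t, (sumBicone P).π t ≫ (sumBicone P).ι t = 𝟙 (sumBicone P).pt := by
  refine (map_sum (homMkₗ (sum P) (sum P)) (fun t => ⟨biproduct.π (fun t => (P t).X) t ≫
    biproduct.ι (fun t => (P t).X) t, comp_mem (π_mem P t) (ι_mem P t)⟩) _).symm.trans ?_
  refine homMk_congr ?_
  rw [AddSubmonoidClass.coe_finsetSum]
  exact biproduct.total

instance : HasFiniteBiproducts (ProjAb k A) where
  out _ := ⟨fun P => HasBiproduct.mk ⟨_, isBilimitOfTotal (sumBicone P) (sumBicone_total P)⟩⟩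

end Biproducts

/-- An idempotent of P lifts to an endomorphism g of P.X, idempotent only modulo null maps. Since g
is nilpotent or invertible, either g is congruent to its powers and thus to 0, or cancelling g makes
it congruent to 1. -/
lemma isIndec {P : ProjAb k A} [FiniteDimensional k (P.X ⟶ P.X)] (h0 : 𝟙 P ≠ 0)
    (h : IsIndec P.X) : IsIndec P where
  id_ne_zero := h0
  idem e he := by
    obtain ⟨g, hg, rfl⟩ := homMk_surjective e
    have h1 : g ≫ g - g ∈ P.null P.X := homMk_eq.1 he
    rcases h.isNilpotent_or_isUnit (k := k) g with ⟨n, hn⟩ | h2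
    · left
      have key : ∀ m : ℕ, (End.of g ^ (m + 1)).asHom - g ∈ P.null P.X := by
        intro m
        induction m with
        | zero => rw [zero_add, pow_one]; exact (sub_self g).symm ▸ zero_mem _
        | succ m ih =>
          have e : (End.of g ^ (m + 1 + 1)).asHom = g ≫ (End.of g ^ (m + 1)).asHom :=
            pow_succ (End.of g) (m + 1)
          have e2 : g ≫ (End.of g ^ (m + 1)).asHom - g =
            g ≫ ((End.of g ^ (m + 1)).asHom - g) + (g ≫ g - g) := by
            rw [Preadditive.comp_sub]; abel
          rw [e, e2]
          exact add_mem (comp_mem_null _ _ ih) h1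
      have h3 := key n
      rw [pow_succ', show (End.of g ^ n : End P.X) = 0 from hn, mul_zero] at h3
      refine homMk_eq.2 (Set.mem_of_eq_of_mem ?_ (neg_mem h3))
      rw [neg_sub]
    · right
      rw [isUnit_iff_isIso] at h2
      refine homMk_eq.2 ?_
      have h3 := comp_mem_null P (inv g) h1
      rwa [Preadditive.comp_sub, IsIso.inv_hom_id_assoc, IsIso.inv_hom_id] at h3

/-- Serves strictness of the abelianization: it delivers the equality of presentations together with
the representative of its `eqToHom`, as needed to recognize the associator. -/
lemma eq_of_rel {P Q : ProjAb k A} (hX : P.X = Q.X)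
    (hr : P.rel.map (fun y => (⟨y.1, y.2 ≫ eqToHom hX⟩ : Σ Y : A, Y ⟶ Q.X)) = Q.rel) :
    ∃ h : P = Q, ∀ hm : eqToHom hX ∈ admissible P Q, homMk (eqToHom hX) hm = eqToHom h := by
  obtain ⟨X, r⟩ := P
  obtain ⟨X', r'⟩ := Q
  obtain rfl : X = X' := hX
  have : r = r' := by
    refine Eq.trans ?_ hr
    simp
  subst this
  exact ⟨rfl, fun _ => rfl⟩

end ProjAb

namespace TwoSemicat

variable {k : Type x} [Field k] {B : Type w} {C : TwoSemicat.{v, u} k B}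

/-! ## The 1-morphisms of the extension -/

/-- Horizontal composition of isomorphisms. -/
def hcompIso {i j m : B} {G G' : C.Hom j m} {F F' : C.Hom i j} (e : G ≅ G') (f : F ≅ F') :
    G ⊚ F ≅ G' ⊚ F' where
  hom := (e.hom ▷ₛ F) ≫ (G' ◁ₛ f.hom)
  inv := (G' ◁ₛ f.inv) ≫ (e.inv ▷ₛ F)
  hom_inv_id := by
    rw [Category.assoc, ← Category.assoc (G' ◁ₛ f.hom), ← C.whiskerLeft_comp, f.hom_inv_id,
      C.whiskerLeft_id, Category.id_comp, ← C.comp_whiskerRight, e.hom_inv_id, C.id_whiskerRight]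
  inv_hom_id := by
    rw [Category.assoc, ← Category.assoc (e.inv ▷ₛ F), ← C.comp_whiskerRight, e.inv_hom_id,
      C.id_whiskerRight, Category.id_comp, ← C.whiskerLeft_comp, f.inv_hom_id, C.whiskerLeft_id]

lemma sum_whiskerRight {i j m : B} {G G' : C.Hom j m} (F : C.Hom i j) {ι : Type*} (s : Finset ι)
    (g : ι → (G ⟶ G')) : (∑ t ∈ s, g t) ▷ₛ F = ∑ t ∈ s, g t ▷ₛ F :=
  map_sum (whiskerRightₗ G G' F) g s

lemma whiskerLeft_sum {i j m : B} (G : C.Hom j m) {F F' : C.Hom i j} {ι : Type*} (s : Finset ι)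
    (f : ι → (F ⟶ F')) : G ◁ₛ (∑ t ∈ s, f t) = ∑ t ∈ s, G ◁ₛ f t :=
  map_sum (whiskerLeftₗ G F F') f s

/-- Whiskering is additive, so decompositions of the identities of G and F multiply to one of the
identity of G ⊚ F. -/
lemma sumRetract_hcomp {i j m : B} {P : ObjectProperty (C.Hom j m)}
    {Q : ObjectProperty (C.Hom i j)} {R : ObjectProperty (C.Hom i m)}
    (h : ∀ G F, P G → Q F → R (G ⊚ F)) {G : C.Hom j m} {F : C.Hom i j} (hG : SumRetract P G)
    (hF : SumRetract Q F) : SumRetract R (G ⊚ F) := by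
  obtain ⟨n, Y, s, p, hY, e⟩ := hG
  obtain ⟨n', Y', s', p', hY', e'⟩ := hF
  refine SumRetract.of_fintype (ι := Fin n × Fin n') (fun t => Y t.1 ⊚ Y' t.2)
    (fun t => (s t.1 ▷ₛ F) ≫ (Y t.1 ◁ₛ s' t.2)) (fun t => (Y t.1 ◁ₛ p' t.2) ≫ (p t.1 ▷ₛ F))
    (fun t => h _ _ (hY _) (hY' _)) ?_
  rw [Fintype.sum_prod_type, ← C.id_whiskerRight, ← e, sum_whiskerRight]
  refine Finset.sum_congr rfl fun t _ => ?_
  have h1 : ∑ u, (Y t ◁ₛ s' u) ≫ (Y t ◁ₛ p' u) = 𝟙 _ := by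
    simp only [← C.whiskerLeft_comp]
    rw [← whiskerLeft_sum, e', C.whiskerLeft_id]
  rw [C.comp_whiskerRight, ← Category.id_comp (p t ▷ₛ F), ← h1, Preadditive.sum_comp,
    Preadditive.comp_sum]
  simp only [Category.assoc]

section

variable {U : BilaxUnits C} (E : ∀ i, UnitCoequalizer U i)

/-- The generators of the extension: the 1-morphisms of `C` and the `1_i`. -/
inductive IsGen : ∀ i j : B, ObjectProperty (C.projAb.Hom i j)
  | embed {i j : B} {X : C.projAb.Hom i j} (F : C.Hom i j) (e : X ≅ (C.embed i j).obj F) :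
    IsGen i j X
  | one {i : B} {X : C.projAb.Hom i i} (e : X ≅ (E i).one) : IsGen i i X

variable {E}

instance (i j : B) : (C.embed i j).Full := inferInstanceAs (ProjAb.emb k (C.Hom i j)).Full

instance (i j : B) : (C.embed i j).Faithful :=
  inferInstanceAs (ProjAb.emb k (C.Hom i j)).Faithful

instance (i j : B) : (C.embed i j).Additive :=
  inferInstanceAs (ProjAb.emb k (C.Hom i j)).Additive

/-- Composing with `1_i` changes nothing up to isomorphism, so `C` absorbs generators; by additivity
it absorbs the whole extension. -/
lemma IsGen.hcomp_embed (W : ∀ i, WeakUnit C.projAb (E i).one) {i j m : B} {G : C.projAb.Hom j m}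
    (hG : IsGen E j m G) {F : C.projAb.Hom i j}
    (hF : ∃ F', Nonempty (F ≅ (C.embed i j).obj F')) :
    ∃ F', Nonempty (G ⊚ F ≅ (C.embed i m).obj F') := by
  obtain ⟨F', ⟨f⟩⟩ := hF
  rcases hG with ⟨G', e⟩ | ⟨e⟩
  · exact ⟨G' ⊚ F', ⟨hcompIso e f⟩⟩
  · exact ⟨F', ⟨hcompIso e (Iso.refl F) ≪≫ (W _).lIso F ≪≫ f⟩⟩

lemma IsGen.hcomp (W : ∀ i, WeakUnit C.projAb (E i).one) {i j m : B} {G : C.projAb.Hom j m}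
    {F : C.projAb.Hom i j} (hG : IsGen E j m G) (hF : IsGen E i j F) : IsGen E i m (G ⊚ F) := by
  rcases hF with ⟨F', f⟩ | ⟨f⟩
  · obtain ⟨F'', ⟨e⟩⟩ := hG.hcomp_embed W ⟨F', ⟨f⟩⟩
    exact .embed F'' e
  · have e := hcompIso (Iso.refl G) f ≪≫ (W _).rIso G
    rcases hG with ⟨G', g⟩ | ⟨g⟩
    · exact .embed G' (e ≪≫ g)
    · exact .one (e ≪≫ g)

lemma IsHat.sumRetract {i j : B} {X : C.projAb.Hom i j} (h : IsHat E i j X) :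
    SumRetract (IsGen E i j) X := by
  rcases h with ⟨hij, F, e⟩ | h
  · exact SumRetract.of_mem (.embed F e)
  · refine (SumRetract.of_additiveClosure h).mono ?_
    rintro Y (⟨F, ⟨e⟩⟩ | ⟨⟨e⟩⟩)
    · exact .embed F e
    · exact .one e

lemma exists_embed_of_sumRetract {i j : B} (hU : IsFinitaryCategory k (C.Hom i j))
    {X : C.projAb.Hom i j}
    (h : SumRetract (fun Y => ∃ F, Nonempty (Y ≅ (C.embed i j).obj F)) X) :
    ∃ F, Nonempty (X ≅ (C.embed i j).obj F) := by
  have := hU.hasFiniteBiproducts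
  have := hU.isIdempotentComplete
  exact SumRetract.essImage (C.embed i j) h

lemma hasFiniteBiproducts_projAb {i j : B} (hU : IsFinitaryCategory k (C.Hom i j)) :
    HasFiniteBiproducts (C.projAb.Hom i j) :=
  haveI := hU.hasFiniteBiproducts
  inferInstanceAs (HasFiniteBiproducts (ProjAb k (C.Hom i j)))

/-- Gives one description on and off the diagonal. For i ≠ j the only generators come from `C`, and
C(i, j) is already closed under sums and summands, being additive and idempotent split. -/
lemma isHat_iff (hU : ∀ i j, IsFinitaryCategory k (C.Hom i j)) {i j : B}
    {X : C.projAb.Hom i j} : IsHat E i j X ↔ SumRetract (IsGen E i j) X := by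
  refine ⟨IsHat.sumRetract, fun h => ?_⟩
  by_cases hij : i = j
  · subst hij
    have := hasFiniteBiproducts_projAb (hU i i)
    refine .diag (SumRetract.additiveClosure (h.mono ?_))
    rintro Y (⟨F, e⟩ | ⟨e⟩)
    · exact Or.inl ⟨F, ⟨e⟩⟩
    · exact Or.inr ⟨e⟩
  · obtain ⟨F, ⟨e⟩⟩ := exists_embed_of_sumRetract (hU i j) (h.mono (by
      rintro Y (⟨F, e⟩ | ⟨e⟩)
      · exact ⟨F, ⟨e⟩⟩
      · exact absurd rfl hij))
    exact .offDiag hij F e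

lemma hatClosed (hU : ∀ i j, IsFinitaryCategory k (C.Hom i j))
    (W : ∀ i, WeakUnit C.projAb (E i).one) : HatClosed E := fun _ _ hG hF =>
  (isHat_iff hU).2 (sumRetract_hcomp (fun _ _ h h' => h.hcomp W h') hG.sumRetract hF.sumRetract)

/-- The 1-morphisms of `C` form an ideal. -/
lemma IsHat.hcomp_embed (hU : ∀ i j, IsFinitaryCategory k (C.Hom i j))
    (W : ∀ i, WeakUnit C.projAb (E i).one) {i j m : B} {G : C.projAb.Hom j m}
    (hG : IsHat E j m G) {F : C.projAb.Hom i j}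
    (hF : ∃ F', Nonempty (F ≅ (C.embed i j).obj F')) :
    ∃ F', Nonempty (G ⊚ F ≅ (C.embed i m).obj F') :=
  exists_embed_of_sumRetract (hU i m)
    (sumRetract_hcomp (fun _ _ h h' => h.hcomp_embed W h') hG.sumRetract
      (SumRetract.of_mem (P := fun F => ∃ F', Nonempty (F ≅ (C.embed i j).obj F')) hF))

/-! ## Strictness -/

/-- Strictness concerns the lists of relations too. A composite lists the relations of its right
factor first, so both bracketings of HGF list those of F, then G, then H, and naturality of the
associator matches them entry by entry. -/
lemma projAb_isStrict (hC : C.IsStrict) : C.projAb.IsStrict := by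
  have key {i j m n : B} (H : ProjAb k (C.Hom m n)) (G : ProjAb k (C.Hom j m))
      (F : ProjAb k (C.Hom i j)) :
      ∃ h : C.projAbHcomp (C.projAbHcomp H G) F = C.projAbHcomp H (C.projAbHcomp G F),
        ∀ hm, ProjAb.homMk (eqToHom (hC.hcomp_assoc H.X G.X F.X)) hm = eqToHom h := by
    refine ProjAb.eq_of_rel (P := C.projAbHcomp (C.projAbHcomp H G) F)
      (Q := C.projAbHcomp H (C.projAbHcomp G F)) (hC.hcomp_assoc H.X G.X F.X) ?_
    have e (X : C.Hom m n) (Y : C.Hom j m) (Z : C.Hom i j) :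
        eqToHom (hC.hcomp_assoc X Y Z) = (assoc X Y Z).hom := by
      rw [hC.associator_eq]; rfl
    have key {Y Y' : C.Hom i n} {T T' : C.Hom i n} (hY : Y = Y') (hT : T = T') (f : Y ⟶ T)
        (f' : Y' ⟶ T') (h : f ≫ eqToHom hT = eqToHom hY ≫ f') :
        (⟨Y, f ≫ eqToHom hT⟩ : Σ Y, Y ⟶ T') = ⟨Y', f'⟩ := by
      subst hY hT
      simp only [eqToHom_refl, Category.comp_id, Category.id_comp] at h ⊢
      rw [h]
    simp only [List.map_append, List.map_map, List.append_assoc]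
    refine congrArg₂ (· ++ ·) ?_ (congrArg₂ (· ++ ·) ?_ ?_)
    · refine List.map_congr_left fun y _ => key (hC.hcomp_assoc _ _ _) (hC.hcomp_assoc _ _ _) _ _ ?_
      rw [e, e]
      exact C.associator_naturality_right _ _ _
    · refine List.map_congr_left fun y _ => key (hC.hcomp_assoc _ _ _) (hC.hcomp_assoc _ _ _) _ _ ?_
      rw [e, e]
      exact C.associator_naturality_middle _ _ _
    · refine List.map_congr_left fun y _ => key (hC.hcomp_assoc _ _ _) (hC.hcomp_assoc _ _ _) _ _ ?_
      rw [e, e]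
      exact C.associator_naturality_left _ _ _
  refine ⟨fun H G F => (key H G F).choose, fun H G F => Iso.ext ?_⟩
  have h1 := (key H G F).choose_spec
  have h2 : (assoc H.X G.X F.X).hom = eqToHom (hC.hcomp_assoc H.X G.X F.X) := by
    rw [hC.associator_eq]; rfl
  exact (ProjAb.homMk_congr h2).trans (h1 (h2 ▸ associator_hom_mem H G F))

lemma full_isStrict (hC : C.IsStrict) (P : ∀ i j : B, ObjectProperty (C.Hom i j))
    (hP : ∀ {i j m : B} (G : C.Hom j m) (F : C.Hom i j), P j m G → P i j F → P i m (G ⊚ F)) :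
    (C.full P hP).IsStrict := by
  have key {i j : B} {X Y : (P i j).FullSubcategory} (h : X.obj = Y.obj) (f : X ⟶ Y)
      (hf : f.hom = eqToHom h) : ∃ h' : X = Y, f = eqToHom h' := by
    obtain ⟨X, hX⟩ := X
    obtain ⟨Y, hY⟩ := Y
    obtain rfl : X = Y := h
    exact ⟨rfl, ObjectProperty.hom_ext _ hf⟩
  have key' {i j m n : B} (H : (C.full P hP).Hom m n) (G : (C.full P hP).Hom j m)
      (F : (C.full P hP).Hom i j) := key (hC.hcomp_assoc H.obj G.obj F.obj) (assoc H G F).hom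
        (congrArg Iso.hom (hC.associator_eq H.obj G.obj F.obj))
  exact ⟨fun H G F => (key' H G F).choose, fun H G F => Iso.ext (key' H G F).choose_spec⟩

end

end TwoSemicat

/-! ## Finitary full subcategories -/

section

variable {k : Type x} [Field k] {A : Type u} [Category.{v} A] [Preadditive A] [Linear k A]

lemma IsIndec.map {A' : Type*} [Category A'] [Preadditive A'] (F : A' ⥤ A) [F.Full]
    [F.Faithful] [F.Additive] {X : A'} (h : IsIndec X) : IsIndec (F.obj X) where
  id_ne_zero h0 := h.id_ne_zero (F.map_injective (by rw [F.map_id, h0, F.map_zero]))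
  idem e he := by
    obtain ⟨e, rfl⟩ := F.map_surjective e
    rw [← F.map_comp] at he
    rcases h.idem e (F.map_injective he) with rfl | rfl
    · exact Or.inl (F.map_zero _ _)
    · exact Or.inr (F.map_id _)

/-- Closure under sums and summands lets biproducts and splittings be formed in A. Indecomposability
is compared with A through idempotents, as the decompositions themselves depend on the ambient
category. -/
lemma isFinitaryCategory_fullSubcategory [HasFiniteBiproducts A] [IsIdempotentComplete A]
    (hfd : ∀ X Y : A, FiniteDimensional k (X ⟶ Y)) {P Q : ObjectProperty A}
    (hPQ : ∀ {X}, P X ↔ SumRetract Q X) {s : Set A} (hs : s.Finite)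
    (h : ∀ X, P X → IsIndec X → ∃ Y ∈ s, P Y ∧ Nonempty (X ≅ Y)) :
    IsFinitaryCategory k P.FullSubcategory := by
  have h1 : HasFiniteBiproducts P.FullSubcategory := by
    refine ⟨fun n => ⟨fun f => ?_⟩⟩
    let pt : P.FullSubcategory := ⟨⨁ fun t => (f t).obj, hPQ.2
      (SumRetract.biproduct (biproduct.bicone fun t => (f t).obj) (biproduct.isBilimit _)
        fun t => hPQ.1 (f t).property)⟩
    let b : Bicone f :=
      { pt := pt
        π t := ObjectProperty.homMk (biproduct.π (fun t => (f t).obj) t)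
        ι t := ObjectProperty.homMk (biproduct.ι (fun t => (f t).obj) t)
        ι_π t t' := by
          by_cases ht : t = t'
          · subst ht
            rw [dif_pos rfl]
            exact ObjectProperty.hom_ext _ (biproduct.ι_π_self _ _)
          · rw [dif_neg ht]
            exact ObjectProperty.hom_ext _ (biproduct.ι_π_ne _ ht) }
    refine HasBiproduct.mk ⟨b, isBilimitOfTotal b (ObjectProperty.hom_ext _ ?_)⟩
    have : P.ι.map (∑ t, b.π t ≫ b.ι t) = ∑ t, P.ι.map (b.π t ≫ b.ι t) := P.ι.map_sum _ _
    exact this.trans biproduct.total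
  have h2 : IsIdempotentComplete P.FullSubcategory := by
    refine ⟨fun X p hp => ?_⟩
    obtain ⟨Y, i, q, hiq, hqi⟩ := IsIdempotentComplete.idempotents_split X.obj p.hom
      (congrArg (P.ι.map ·) hp)
    exact ⟨⟨Y, hPQ.2 ((hPQ.1 X.property).retract ⟨i, q, hiq⟩)⟩, ObjectProperty.homMk i,
      ObjectProperty.homMk q, ObjectProperty.hom_ext _ hiq, ObjectProperty.hom_ext _ hqi⟩
  refine ⟨h1, h2, fun X Y => ?_, ?_⟩
  · let φ : (X ⟶ Y) →ₗ[k] (X.obj ⟶ Y.obj) :=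
      { toFun f := f.hom
        map_add' _ _ := rfl
        map_smul' _ _ := rfl }
    exact FiniteDimensional.of_injective φ fun _ _ h => ObjectProperty.hom_ext _ h
  · have : HasBinaryBiproducts P.FullSubcategory := HasBinaryBiproducts.of_hasBinaryProducts
    refine ⟨P.ι.obj ⁻¹' s, hs.preimage ?_, fun X hX => ?_⟩
    · rintro ⟨X, _⟩ _ ⟨Y, _⟩ _ (rfl : X = Y)
      rfl
    · obtain ⟨Y, hY, hPY, ⟨e⟩⟩ := h X.obj X.property ((IsIndec.of_indecomposable hX).map P.ι)
      exact ⟨⟨Y, hPY⟩, hY, ⟨P.isoMk e⟩⟩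

end

/-! ### Finitarity of the extension -/

namespace TwoSemicat

variable {k : Type x} [Field k] {B : Type w} {C : TwoSemicat.{v, u} k B} {U : BilaxUnits C}

/-- If the cokernel vanished, the identity of `I` would factor through l - r. Whiskering with `I`
and applying l_I kills l - r, so l_I would be 0, although it is a split epimorphism onto a nonzero
object. -/
lemma LaxUnit.coker_id_ne_zero {i : B} {I : C.Hom i i} {L : LaxUnit C I} (hL : L.IsSplit)
    (hI : 𝟙 I ≠ 0) : 𝟙 L.coker ≠ 0 := by
  intro h
  have h1 : 𝟙 I - 0 ∈ L.coker.null I := ProjAb.homMk_eq.1 h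
  rw [sub_zero] at h1
  have h2 := ProjAb.null_comp_mem (P := C.projAbHcomp L.coker ⟨I, []⟩) (Q := ⟨I, []⟩)
    (whiskerRight_mem_null ⟨I, []⟩ h1) (g := L.l I) (mem_admissible_hcomp (P := L.coker)
      (Q := ⟨I, []⟩) (R := ⟨I, []⟩) (fun _ hy => absurd hy List.not_mem_nil)
      (fun y hy => by
        obtain rfl := List.mem_singleton.1 hy
        have : ((L.l I - L.r I) ▷ₛ I) ≫ L.l I = 0 := by
          have : (L.l I - L.r I) ▷ₛ I = L.l I ▷ₛ I - L.r I ▷ₛ I :=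
            map_sub (whiskerRightₗ _ _ I) _ _
          rw [this, Preadditive.sub_comp, ← L.l_hcomp, ← L.compat, Category.assoc, Category.assoc,
            L.l_naturality, sub_self]
        exact Set.mem_of_eq_of_mem this (zero_mem _)))
  obtain ⟨s, hs⟩ := hL.l I
  refine hI ?_
  rw [ProjAb.null_nil, Submodule.mem_bot] at h2
  have h3 : L.l I = 0 := by
    rw [← h2]
    exact ((congrArg (· ≫ L.l I) (C.id_whiskerRight I I)).trans (Category.id_comp _)).symm
  rw [← hs, h3, comp_zero]

lemma UnitCoequalizer.isIndec {i : B} (E : UnitCoequalizer U i)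
    (hC : IsFinitaryCategory k (C.Hom i i)) (hL : (U.lax i).IsSplit) (hI : IsIndec (U.I i)) :
    IsIndec E.one := by
  have := hC.finiteDimensional_hom (U.I i) (U.I i)
  have h : IsIndec (U.lax i).coker :=
    ProjAb.isIndec (P := (U.lax i).coker) (LaxUnit.coker_id_ne_zero hL hI.id_ne_zero) hI
  exact IsIndec.ofIso (A := C.projAb.Hom i i) h E.isoStd

/-- An indecomposable is a retract of a single generator. Retracts of 1-morphisms of `C` are
isomorphic to 1-morphisms of `C`, and a nonzero retract of the indecomposable `1_i` is all of it. -/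
lemma exists_indec_hat (E : ∀ i, UnitCoequalizer U i)
    (hU : ∀ i j, IsFinitaryCategory k (C.Hom i j)) (hE : ∀ i, IsIndec (E i).one) (i j : B) :
    ∃ s : Set (C.projAb.Hom i j), s.Finite ∧ ∀ X, IsHat E i j X → IsIndec X →
      ∃ Y ∈ s, IsHat E i j Y ∧ Nonempty (X ≅ Y) := by
  have := (hU i j).hasFiniteBiproducts
  have := (hU i j).isIdempotentComplete
  have fd := (hU i j).finiteDimensional_hom
  have fd' (X : ProjAb k (C.Hom i j)) : FiniteDimensional k (X ⟶ X) := inferInstance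
  have fd'' (X : C.projAb.Hom i j) : FiniteDimensional k (X ⟶ X) := fd' X
  have : HasBinaryBiproducts (C.Hom i j) := HasBinaryBiproducts.of_hasBinaryProducts
  obtain ⟨s, hs, h⟩ := (hU i j).finite_indecomposables
  have key : ∀ X : C.projAb.Hom i j, IsIndec X → (∃ F, Nonempty (X ≅ (C.embed i j).obj F)) →
      ∃ Y ∈ (C.embed i j).obj '' s, IsHat E i j Y ∧ Nonempty (X ≅ Y) := by
    rintro X hX ⟨F, ⟨e⟩⟩
    obtain ⟨Y, hY, ⟨f⟩⟩ := h F ((hX.ofIso e).of_fullyFaithful (C.embed i j)).indecomposable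
    exact ⟨_, ⟨Y, hY, rfl⟩, isHat_embed E Y, ⟨e ≪≫ (C.embed i j).mapIso f⟩⟩
  have key' : ∀ X : C.projAb.Hom i j, IsIndec X → ∀ F, Retract X ((C.embed i j).obj F) →
      ∃ Y ∈ (C.embed i j).obj '' s, IsHat E i j Y ∧ Nonempty (X ≅ Y) := fun X hX F r =>
    key X hX (SumRetract.essImage (C.embed i j)
      ((SumRetract.of_mem ⟨F, ⟨Iso.refl _⟩⟩).retract r))
  by_cases hij : i = j
  · subst hij
    refine ⟨(C.embed i i).obj '' s ∪ {(E i).one}, (hs.image _).union (Set.finite_singleton _),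
      fun X hX hXi => ?_⟩
    obtain ⟨Y, hY, ⟨r⟩⟩ := hXi.exists_retract k hX.sumRetract
    rcases hY with ⟨F, e⟩ | ⟨e⟩
    · obtain ⟨Z, hZ, h⟩ := key' X hXi F (r.trans (Retract.ofIso e))
      exact ⟨Z, Or.inl hZ, h⟩
    · exact ⟨_, Or.inr rfl, isHat_one E i,
        (hE i).nonempty_iso hXi.id_ne_zero (r.trans (Retract.ofIso e))⟩
  · refine ⟨(C.embed i j).obj '' s, hs.image _, fun X hX hXi => ?_⟩
    obtain ⟨Y, hY, ⟨r⟩⟩ := hXi.exists_retract k hX.sumRetract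
    rcases hY with ⟨F, e⟩ | ⟨e⟩
    · exact key' X hXi F (r.trans (Retract.ofIso e))
    · exact absurd rfl hij

lemma hat_finitary_hom {E : ∀ i, UnitCoequalizer U i} (hE : HatClosed E)
    (hU : ∀ i j, IsFinitaryCategory k (C.Hom i j)) (hI : ∀ i, IsIndec (E i).one) (i j : B) :
    IsFinitaryCategory k ((hat E hE).Hom i j) := by
  have := (hU i j).hasFiniteBiproducts
  have fd := (hU i j).finiteDimensional_hom
  obtain ⟨s, hs, h⟩ := exists_indec_hat E hU hI i j
  exact isFinitaryCategory_fullSubcategory (A := ProjAb k (C.Hom i j)) (fun X Y => inferInstance)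
    (isHat_iff hU) hs h

/-- The extension of a finitary bilax-unital 2-category is finitary. -/
lemma hat_isFinitary {E : ∀ i, UnitCoequalizer U i} (hE : HatClosed E) (hU : IsFinitary U)
    (hL : ∀ i, (U.lax i).IsSplit) (W : ∀ i : B, WeakUnit (hat E hE) (hatOne E hE i)) :
    IsFinitary (BilaxUnits.ofWeakUnits W) := by
  have hI (i : B) : IsIndec (E i).one := by
    have := (hU.finitary_hom i i).hasFiniteBiproducts
    have := (hU.finitary_hom i i).isIdempotentComplete
    have : HasBinaryBiproducts (C.Hom i i) := HasBinaryBiproducts.of_hasBinaryProducts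
    exact (E i).isIndec (hU.finitary_hom i i) (hL i)
      (IsIndec.of_indecomposable (hU.indecomposable_I i))
  have h := hat_finitary_hom hE hU.finitary_hom hI
  have h' (i : B) : IsIndec (hatOne E hE i) :=
    IsIndec.of_fullyFaithful (IsHat E i i).ι (hI i)
  have key (i : B) :
      haveI := (h i i).hasFiniteBiproducts
      haveI : HasBinaryBiproducts ((hat E hE).Hom i i) := HasBinaryBiproducts.of_hasBinaryProducts
      Indecomposable (hatOne E hE i) := by
    have := (h i i).hasFiniteBiproducts
    have : HasBinaryBiproducts ((hat E hE).Hom i i) := HasBinaryBiproducts.of_hasBinaryProducts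
    exact (h' i).indecomposable
  exact ⟨hU.finite_obj, h, key, key⟩

end TwoSemicat

namespace TwoSemicat

variable {k : Type x} [Field k] {B : Type w}

/-! ## Restriction of units and adjoint pairs to full sub-2-semicategories -/

section Full

variable {C : TwoSemicat.{v, u} k B} {P : ∀ i j : B, ObjectProperty (C.Hom i j)}
  (hP : ∀ {i j m : B} (G : C.Hom j m) (F : C.Hom i j), P j m G → P i j F → P i m (G ⊚ F))

/-- Restriction of a lax unit. -/
def LaxUnit.full {i : B} {I : C.Hom i i} (L : LaxUnit C I) (hI : P i i I) :
    LaxUnit (C.full P hP) (⟨I, hI⟩ : (P i i).FullSubcategory) where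
  l F := ObjectProperty.homMk (L.l F.obj)
  r G := ObjectProperty.homMk (L.r G.obj)
  l_naturality f := ObjectProperty.hom_ext _ (L.l_naturality f.hom)
  r_naturality f := ObjectProperty.hom_ext _ (L.r_naturality f.hom)
  compat F G := ObjectProperty.hom_ext _ (L.compat F.obj G.obj)
  l_hcomp F H := ObjectProperty.hom_ext _ (L.l_hcomp F.obj H.obj)
  r_hcomp K G := ObjectProperty.hom_ext _ (L.r_hcomp K.obj G.obj)

/-- Restriction of an oplax unit. -/
def OplaxUnit.full {i : B} {I : C.Hom i i} (L : OplaxUnit C I) (hI : P i i I) :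
    OplaxUnit (C.full P hP) (⟨I, hI⟩ : (P i i).FullSubcategory) where
  l F := ObjectProperty.homMk (L.l F.obj)
  r G := ObjectProperty.homMk (L.r G.obj)
  l_naturality f := ObjectProperty.hom_ext _ (L.l_naturality f.hom)
  r_naturality f := ObjectProperty.hom_ext _ (L.r_naturality f.hom)
  compat F G := ObjectProperty.hom_ext _ (L.compat F.obj G.obj)
  l_hcomp F H := ObjectProperty.hom_ext _ (L.l_hcomp F.obj H.obj)
  r_hcomp K G := ObjectProperty.hom_ext _ (L.r_hcomp K.obj G.obj)

/-- Restriction of a weak unit. -/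
def WeakUnit.full {i : B} {I : C.Hom i i} (L : WeakUnit C I) (hI : P i i I) :
    WeakUnit (C.full P hP) (⟨I, hI⟩ : (P i i).FullSubcategory) where
  toLaxUnit := L.toLaxUnit.full hP hI
  isIso_l {j} F := ((P j i).isoMk
    (X := (C.full P hP).hcomp (⟨I, hI⟩ : (P i i).FullSubcategory) F) (Y := F)
    (L.lIso F.obj)).isIso_hom
  isIso_r {m} G := ((P i m).isoMk
    (X := (C.full P hP).hcomp G (⟨I, hI⟩ : (P i i).FullSubcategory)) (Y := G)
    (L.rIso G.obj)).isIso_hom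

/-- Restriction of bilax units. -/
def BilaxUnits.full (U : BilaxUnits C) (hI : ∀ i, P i i (U.I i)) (hI' : ∀ i, P i i (U.I' i)) :
    BilaxUnits (C.full P hP) where
  I i := (⟨U.I i, hI i⟩ : (P i i).FullSubcategory)
  I' i := (⟨U.I' i, hI' i⟩ : (P i i).FullSubcategory)
  lax i := (U.lax i).full hP (hI i)
  oplax i := (U.oplax i).full hP (hI' i)

/-- Restriction of an adjoint pair. -/
def AdjointPair.full {U : BilaxUnits C} {hI : ∀ i, P i i (U.I i)} {hI' : ∀ i, P i i (U.I' i)}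
    {i j : B} {F : (P i j).FullSubcategory} {G : (P j i).FullSubcategory}
    (A : AdjointPair U F.obj G.obj) :
    AdjointPair (C := C.full P hP) (U.full hP hI hI') F G where
  α := ObjectProperty.homMk A.α
  β := ObjectProperty.homMk A.β
  triangle_left := ObjectProperty.hom_ext _ A.triangle_left
  triangle_right := ObjectProperty.hom_ext _ A.triangle_right

end Full

lemma LaxUnit.split_of_iso {C : TwoSemicat.{v, u} k B} {i j : B} {I : C.Hom i i}
    (L : LaxUnit C I) {f g : C.Hom j i} (e : f ≅ g) (s : g ⟶ I ⊚ g) (hs : s ≫ L.l g = 𝟙 g) :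
    ∃ s, s ≫ L.l f = 𝟙 f :=
  ⟨e.hom ≫ s ≫ (I ◁ₛ e.inv), by
    rw [Category.assoc, Category.assoc, L.l_naturality, reassoc_of% hs, e.hom_inv_id]⟩

/-! ## Comparison of bilax units with weak units -/

section Comparison

variable {D : TwoSemicat.{v, u} k B} {V : BilaxUnits D} {one : ∀ i : B, D.Hom i i}
  {W : ∀ i, WeakUnit D (one i)}

/-- 2-morphisms `I_i ⟶ 1_i` which are compatible with the unitors. -/
structure UnitComparison (V : BilaxUnits D) (W : ∀ i, WeakUnit D (one i)) where
  ξ : ∀ i, V.I i ⟶ one i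
  l : ∀ {i j : B} (X : D.Hom j i), (ξ i ▷ₛ X) ≫ (W i).l X = (V.lax i).l X
  r : ∀ {i m : B} (X : D.Hom i m), (X ◁ₛ ξ i) ≫ (W i).r X = (V.lax i).r X

variable (W) in
/-- The unit of an adjoint pair for the weak units. -/
def AdjointPair.unit {i j : B} {F : D.Hom i j} {G : D.Hom j i} (A : AdjointPair V F G) :
    one i ⟶ G ⊚ F :=
  (V.oplax i).l (one i) ≫ (A.α ▷ₛ one i) ≫ (W i).r (G ⊚ F)

/-- Whiskering removes the auxiliary `1_i` in the definition of the unit and leaves the old α next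
to an oplax unitor, so the triangle identities for the new unit are the old ones. With
`whiskerLeft_unit` this works on both sides, although the definition is one-sided. -/
lemma AdjointPair.unit_whiskerRight {i j m : B} {F : D.Hom i j} {G : D.Hom j i}
    (A : AdjointPair V F G) (X : D.Hom m i) :
    A.unit W ▷ₛ X = (W i).l X ≫ (V.oplax i).l X ≫ (A.α ▷ₛ X) := by
  rw [AdjointPair.unit, D.comp_whiskerRight, D.comp_whiskerRight, ← (W i).compat,
    ← Category.assoc ((A.α ▷ₛ one i) ▷ₛ X), D.associator_naturality_left, Category.assoc,
    ← Category.assoc, ← (V.oplax i).l_hcomp, ← D.whisker_exchange, ← Category.assoc,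
    ← (V.oplax i).l_naturality, Category.assoc]

lemma AdjointPair.whiskerLeft_unit {i j m : B} {F : D.Hom i j} {G : D.Hom j i}
    (A : AdjointPair V F G) (X : D.Hom i m) :
    X ◁ₛ A.unit W = (W i).r X ≫ (V.oplax i).r X ≫ (X ◁ₛ A.α) := by
  rw [AdjointPair.unit, D.whiskerLeft_comp, D.whiskerLeft_comp, (V.oplax i).compat,
    Category.assoc, ← Category.assoc (assoc X _ _).hom, ← D.associator_naturality_middle,
    Category.assoc, ← (W i).r_hcomp, (W i).r_naturality, ← Category.assoc, (W i).r_naturality,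
    Category.assoc]

/-- An adjoint pair for bilax units is one for the weak units. -/
noncomputable def AdjointPair.extend (c : UnitComparison V W) {i j : B}
    {F : D.Hom i j} {G : D.Hom j i}
    (A : AdjointPair V F G) : AdjointPair (BilaxUnits.ofWeakUnits W) F G where
  α := A.unit W
  β := A.β ≫ c.ξ j
  triangle_left := by
    have h : inv ((W i).r F) ≫ (F ◁ₛ A.unit W) ≫ (assoc F G F).inv ≫
        ((A.β ≫ c.ξ j : F ⊚ G ⟶ one j) ▷ₛ F) ≫ (W j).l F = 𝟙 F := by
      rw [A.whiskerLeft_unit, Category.assoc, Category.assoc, IsIso.inv_hom_id_assoc,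
        D.comp_whiskerRight, Category.assoc, c.l]
      exact A.triangle_left
    exact h
  triangle_right := by
    have h : inv ((W i).l G) ≫ (A.unit W ▷ₛ G) ≫ (assoc G F G).hom ≫
        (G ◁ₛ (A.β ≫ c.ξ j : F ⊚ G ⟶ one j)) ≫ (W j).r G = 𝟙 G := by
      rw [A.unit_whiskerRight, Category.assoc, Category.assoc, IsIso.inv_hom_id_assoc,
        D.whiskerLeft_comp, Category.assoc, c.r]
      exact A.triangle_right
    exact h

/-- Passing to weak units does not alter the formula for mates: ξ and the auxiliary unit cancel
against the unitors of `1_i`. -/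
lemma mate_extend (c : UnitComparison V W) {i j : B} {F G : D.Hom i j} {F' G' : D.Hom j i}
    (A : AdjointPair V F F') (A' : AdjointPair V G G') (γ : F ⟶ G) :
    mate (A.extend c).toAdjunction (A'.extend c).toAdjunction γ =
      (V.oplax i).l G' ≫ (A.α ▷ₛ G') ≫ (assoc F' F G').hom ≫ (F' ◁ₛ (γ ▷ₛ G')) ≫
        (F' ◁ₛ A'.β) ≫ (V.lax j).r F' := by
  rw [mate_eq]
  have h : inv ((W i).l G') ≫ (A.unit W ▷ₛ G') ≫ (assoc F' F G').hom ≫ (F' ◁ₛ (γ ▷ₛ G')) ≫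
      (F' ◁ₛ (A'.β ≫ c.ξ j : G ⊚ G' ⟶ one j)) ≫ (W j).r F' =
      (V.oplax i).l G' ≫ (A.α ▷ₛ G') ≫ (assoc F' F G').hom ≫ (F' ◁ₛ (γ ▷ₛ G')) ≫
        (F' ◁ₛ A'.β) ≫ (V.lax j).r F' := by
    rw [A.unit_whiskerRight, Category.assoc, Category.assoc, IsIso.inv_hom_id_assoc,
      D.whiskerLeft_comp, Category.assoc, c.r]
  exact h

end Comparison

/-! ## The units of the extension -/

section Hat

variable {C : TwoSemicat.{v, u} k B} {U : BilaxUnits C} {E : ∀ i, UnitCoequalizer U i}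
  (hE : HatClosed E)

/-- The given bilax units, as bilax units of the extension. -/
def hatBilax : BilaxUnits (hat E hE) :=
  U.projAb.full hE (fun i => isHat_embed E (U.I i)) (fun i => isHat_embed E (U.I' i))

variable (hL : ∀ i, (U.lax i).IsSplit)

/-- The weak units of the extension. -/
noncomputable def hatWeakUnit (i : B) : WeakUnit (hat E hE) (hatOne E hE i) :=
  ((E i).weakUnit (hL i)).full hE (isHat_one E i)

/-- The comparison of the given bilax units with the weak units of the extension. -/
noncomputable def hatComparison : UnitComparison (hatBilax hE) (hatWeakUnit hE hL) where
  ξ := hatξ E hE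
  l {i _} X := ObjectProperty.hom_ext _ ((E i).ξ_whiskerRight_l (hL i) X.obj)
  r {i _} X := ObjectProperty.hom_ext _ ((E i).whiskerLeft_ξ_r (hL i) X.obj)

lemma isInducedUnit_hatWeakUnit : IsInducedUnit (hatWeakUnit hE hL) :=
  ⟨fun _ => ((hatComparison hE hL).l _).trans (Category.id_comp _).symm,
    fun _ => ((hatComparison hE hL).r _).trans (Category.id_comp _).symm⟩

/-- An adjoint pair of `C`, as an adjoint pair of the extension for the given bilax units. -/
def AdjointPair.hat {i j : B} {F : C.Hom i j} {G : C.Hom j i} (A : AdjointPair U F G) :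
    AdjointPair (hatBilax hE) ((hatEmbed E hE i j).obj F) ((hatEmbed E hE j i).obj G) :=
  A.projAb.full (hI := fun i => isHat_embed E (U.I i)) (hI' := fun i => isHat_embed E (U.I' i)) hE

/-- An adjoint pair of `C`, as an adjunction of the extension. -/
noncomputable def AdjointPair.hatAdj {i j : B} {F : C.Hom i j} {G : C.Hom j i}
    (A : AdjointPair U F G) :
    Bicategory.Adjunction (toHom (hatWeakUnit hE hL) ((hatEmbed E hE i j).obj F))
      (toHom (hatWeakUnit hE hL) ((hatEmbed E hE j i).obj G)) :=
  ((A.hat hE).extend (hatComparison hE hL)).toAdjunction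

/-- Condition 3 for the given ⋆ says that it acts on 2-morphisms of `C` by mates. Every axiom of `S`
thereby becomes a statement about adjunctions in the extension. -/
lemma FiaxStructure.mate_hatAdj (S : FiaxStructure U) {i j : B} {F G : C.Hom i j} (γ : F ⟶ G) :
    mate ((S.adj F).hatAdj hE hL) ((S.adj G).hatAdj hE hL) ((hatEmbed E hE i j).map γ) =
      (hatEmbed E hE j i).map (S.map γ) := by
  refine (mate_extend (hatComparison hE hL) _ _ _).trans ?_
  exact (congrArg (hatEmbed E hE j i).map (S.map_eq γ)).symm

lemma hat_r_epi {i j : B} (f : (hat E hE).Hom i j) :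
    Epi ((f ◁ₛ hatξ E hE i) ≫ (hatWeakUnit hE hL i).r f) := by
  rw [show (f ◁ₛ hatξ E hE i) ≫ (hatWeakUnit hE hL i).r f = _ from (hatComparison hE hL).r f]
  exact (IsHat E i j).ι.epi_of_epi_map ((U.lax i).projAb_r_epi (hL i) f.obj)

/-- This is `projAb_r_desc` restricted to the full extension, with the unitors of `I` rewritten
through ξ and the weak unitors as `UnitResolution` demands. Composition in the bicategory is
reversed, so a left projection there is a right unitor here. -/
lemma hat_r_desc {i j : B} {f g : (hat E hE).Hom i j} (t : f ⊚ (hatBilax hE).I i ⟶ g)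
    (ht : (f ◁ₛ (((hatBilax hE).I i ◁ₛ hatξ E hE i) ≫
        (hatWeakUnit hE hL i).r ((hatBilax hE).I i))) ≫ t =
      (f ◁ₛ ((hatξ E hE i ▷ₛ (hatBilax hE).I i) ≫
        (hatWeakUnit hE hL i).l ((hatBilax hE).I i))) ≫ t) :
    ∃ s : f ⟶ g, ((f ◁ₛ hatξ E hE i) ≫ (hatWeakUnit hE hL i).r f) ≫ s = t := by
  have e (X : (hat E hE).Hom i j) := (hatComparison hE hL).r X
  have e1 := (hatComparison hE hL).r ((hatBilax hE).I i)
  have e2 := (hatComparison hE hL).l ((hatBilax hE).I i)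
  have ht' : ((hat E hE).whiskerLeft f (((hatBilax hE).lax i).r ((hatBilax hE).I i))) ≫ t =
      ((hat E hE).whiskerLeft f (((hatBilax hE).lax i).l ((hatBilax hE).I i))) ≫ t := by
    rw [← e1, ← e2]
    exact ht
  obtain ⟨s, hs⟩ := (U.lax i).projAb_r_desc (hL i) t.hom
    (congrArg (fun η => (IsHat E i j).ι.map η) ht').symm
  refine ⟨ObjectProperty.homMk s, ?_⟩
  refine (congrArg (· ≫ (ObjectProperty.homMk s : f ⟶ g)) (e f)).trans ?_
  exact ObjectProperty.hom_ext _ hs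

variable {hE} in
/-- The 1-morphisms of `C`, up to isomorphism. -/
def IsEmbedded {i j : B} (f : (hat E hE).Hom i j) : Prop :=
  ∃ F, Nonempty (f ≅ (hatEmbed E hE i j).obj F)

lemma IsEmbedded.embed {i j : B} (F : C.Hom i j) : IsEmbedded ((hatEmbed E hE i j).obj F) :=
  ⟨F, ⟨Iso.refl _⟩⟩

lemma IsEmbedded.hcomp (hU : ∀ i j, IsFinitaryCategory k (C.Hom i j))
    (W : ∀ i, WeakUnit C.projAb (E i).one) {i j m : B} {f : (hat E hE).Hom i j}
    (hf : IsEmbedded f) (g : (hat E hE).Hom j m) :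
    IsEmbedded (g ⊚ f) := by
  obtain ⟨F, ⟨e⟩⟩ := hf
  obtain ⟨G, ⟨e'⟩⟩ := IsHat.hcomp_embed hU W g.property
    (F := f.obj) ⟨F, ⟨(IsHat E i j).ι.mapIso e⟩⟩
  exact ⟨G, ⟨(IsHat E i m).isoMk e'⟩⟩

lemma IsEmbedded.split {i j : B} {f : (hat E hE).Hom i j} (hf : IsEmbedded f) :
    ∃ s, s ≫ (hatξ E hE j ▷ₛ f) ≫ (hatWeakUnit hE hL j).l f = 𝟙 f := by
  obtain ⟨F, ⟨e⟩⟩ := hf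
  obtain ⟨s, hs⟩ := (hL j).l F
  have hs' : (hatEmbed E hE i j).map s ≫ ((hatBilax hE).lax j).l ((hatEmbed E hE i j).obj F) =
    𝟙 _ := ObjectProperty.hom_ext _ (congrArg (C.embed i j).map hs)
  obtain ⟨t, ht⟩ := ((hatBilax hE).lax j).split_of_iso e _ hs'
  exact ⟨t, (congrArg (t ≫ ·) ((hatComparison hE hL).l f)).trans ht⟩

/-- The 1-morphisms of `C` form a resolution of the weak units. -/
noncomputable def hatResolution (hU : ∀ i j, IsFinitaryCategory k (C.Hom i j)) :
    Bicategory.UnitResolution (Obj (hatWeakUnit hE hL)) where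
  I i := (hatBilax hE).I i
  ξ i := hatξ E hE i
  epi f := hat_r_epi hE hL f
  desc t ht := hat_r_desc hE hL t ht
  P f := IsEmbedded f
  mem_I i := IsEmbedded.embed hE (U.I i)
  mem_comp _ g hf := IsEmbedded.hcomp hE hU (fun i => (E i).weakUnit (hL i)) hf g
  split _ hf := IsEmbedded.split hE hL hf

end Hat

end TwoSemicat

namespace CategoryTheory.Bicategory

open _root_.CategoryTheory.Bicategory

variable {𝔹 : Type w} [Bicategory.{v, u} 𝔹]

/-! ## Adjoints of direct summands of direct sums -/

section

variable {a b : 𝔹}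

/-- Transposing under the adjunction turns both sides into the mate of γ. Together with the counit
version, this moves a 2-morphism across an adjunction at the price of changing the adjunction. -/
lemma unit_conjugateEquiv {l₁ l₂ : a ⟶ b} {r₁ r₂ : b ⟶ a} (adj₁ : l₁ ⊣ r₁) (adj₂ : l₂ ⊣ r₂)
    (γ : l₂ ⟶ l₁) :
    adj₁.unit ≫ l₁ ◁ conjugateEquiv adj₁ adj₂ γ = adj₂.unit ≫ γ ▷ r₂ := by
  apply adj₁.homEquiv₁.injective
  have h : adj₁.unit ≫ l₁ ◁ conjugateEquiv adj₁ adj₂ γ =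
      adj₁.homEquiv₁.symm ((ρ_ _).hom ≫ conjugateEquiv adj₁ adj₂ γ) := by
    simp [Adjunction.homEquiv₁_symm_apply]
  rw [h, Equiv.apply_symm_apply, conjugateEquiv_apply', Adjunction.homEquiv₁_apply]
  simp

lemma conjugateEquiv_counit {l₁ l₂ : a ⟶ b} {r₁ r₂ : b ⟶ a} (adj₁ : l₁ ⊣ r₁) (adj₂ : l₂ ⊣ r₂)
    (γ : l₂ ⟶ l₁) :
    conjugateEquiv adj₁ adj₂ γ ▷ l₂ ≫ adj₂.counit = r₁ ◁ γ ≫ adj₁.counit := by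
  apply adj₂.homEquiv₂.injective
  have h : conjugateEquiv adj₁ adj₂ γ ▷ l₂ ≫ adj₂.counit =
      adj₂.homEquiv₂.symm (conjugateEquiv adj₁ adj₂ γ ≫ (λ_ _).inv) := by
    simp [Adjunction.homEquiv₂_symm_apply]
  rw [h, Equiv.apply_symm_apply, conjugateEquiv_apply', Adjunction.homEquiv₂_apply]
  simp

/-- One term of the zigzag for a summand X. The hypothesis on η trades the new unit for that of Y,
whose triangle identity leaves s ≫ p; summing over all terms gives the identity of X. -/
lemma left_triangle_summand {X Y : a ⟶ b} {Z R : b ⟶ a} (A : Y ⊣ Z) {η : 𝟙 a ⟶ X ≫ R}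
    {i : R ⟶ Z} {s : X ⟶ Y} {p : Y ⟶ X} (h : η ≫ X ◁ i = A.unit ≫ p ▷ Z) :
    η ▷ X ≫ (α_ X R X).hom ≫ X ◁ (i ▷ X ≫ Z ◁ s ≫ A.counit) =
      (λ_ X).hom ≫ (s ≫ p) ≫ (ρ_ X).inv := by
  have h1 := A.left_triangle
  rw [leftZigzag_eq] at h1
  calc _ = (η ≫ X ◁ i) ▷ X ≫ (X ≫ Z) ◁ s ≫ (α_ X Z Y).hom ≫ X ◁ A.counit := by
        simp
    _ = A.unit ▷ X ≫ (p ▷ Z) ▷ X ≫ (X ≫ Z) ◁ s ≫ (α_ X Z Y).hom ≫ X ◁ A.counit := by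
        rw [h, comp_whiskerRight, Category.assoc]
    _ = 𝟙 a ◁ s ≫ A.unit ▷ Y ≫ (p ▷ Z) ▷ Y ≫ (α_ X Z Y).hom ≫ X ◁ A.counit := by
        rw [← whisker_exchange_assoc, ← whisker_exchange_assoc]
    _ = 𝟙 a ◁ s ≫ (A.unit ▷ Y ≫ (α_ Y Z Y).hom ≫ Y ◁ A.counit) ≫ p ▷ 𝟙 b := by
        simp only [Category.assoc, associator_naturality_left_assoc, whisker_exchange]
    _ = _ := by
        rw [h1]; simp

lemma right_triangle_summand {X Y : a ⟶ b} {Z R : b ⟶ a} (A : Y ⊣ Z) {η : 𝟙 a ⟶ X ≫ R}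
    {θ : R ≫ X ⟶ 𝟙 b} {i : R ⟶ Z} {q : Z ⟶ R} {s : X ⟶ Y}
    (h : η ≫ s ▷ R = A.unit ≫ Y ◁ q) (h' : q ▷ X ≫ θ = Z ◁ s ≫ A.counit) :
    (i ≫ q) ▷ 𝟙 a ≫ R ◁ η ≫ (α_ R X R).inv ≫ θ ▷ R =
      (ρ_ R).hom ≫ (i ≫ q) ≫ (λ_ R).inv := by
  have h1 := A.right_triangle
  rw [rightZigzag_eq] at h1
  calc _ = i ▷ 𝟙 a ≫ Z ◁ η ≫ (α_ Z X R).inv ≫ (q ▷ X ≫ θ) ▷ R := by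
        rw [comp_whiskerRight, Category.assoc, ← whisker_exchange_assoc,
          associator_inv_naturality_left_assoc, comp_whiskerRight]
    _ = i ▷ 𝟙 a ≫ Z ◁ (η ≫ s ▷ R) ≫ (α_ Z Y R).inv ≫ A.counit ▷ R := by
        rw [h']; simp
    _ = i ▷ 𝟙 a ≫ (Z ◁ A.unit ≫ (α_ Z Y Z).inv ≫ A.counit ▷ Z) ≫ 𝟙 b ◁ q := by
        rw [h]
        simp only [whiskerLeft_comp, Category.assoc, ← whisker_exchange]
        simp
    _ = _ := by
        rw [h1]; simp

end

variable (𝔹) in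
/-- The categories of 1-morphisms are preadditive, and whiskering is additive. -/
class IsPreadditive where
  [preadditive : ∀ a b : 𝔹, Preadditive (a ⟶ b)]
  whiskerLeft_sum : ∀ {a b c : 𝔹} (f : a ⟶ b) {g h : b ⟶ c} {n : ℕ} (η : Fin n → (g ⟶ h)),
    f ◁ (∑ t, η t) = ∑ t, f ◁ η t
  sum_whiskerRight : ∀ {a b c : 𝔹} {f g : a ⟶ b} (h : b ⟶ c) {n : ℕ} (η : Fin n → (f ⟶ g)),
    (∑ t, η t) ▷ h = ∑ t, η t ▷ h

attribute [reducible, instance] IsPreadditive.preadditive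

lemma conjugateEquiv_sum [IsPreadditive 𝔹] {a b : 𝔹} {l₁ l₂ : a ⟶ b} {r₁ r₂ : b ⟶ a}
    (adj₁ : l₁ ⊣ r₁) (adj₂ : l₂ ⊣ r₂) {n : ℕ} (γ : Fin n → (l₂ ⟶ l₁)) :
    conjugateEquiv adj₁ adj₂ (∑ t, γ t) = ∑ t, conjugateEquiv adj₁ adj₂ (γ t) := by
  simp only [conjugateEquiv_apply', IsPreadditive.sum_whiskerRight, IsPreadditive.whiskerLeft_sum,
    Preadditive.sum_comp, Preadditive.comp_sum]

/-- A right adjoint of a direct summand `X` of a direct sum of the `Y t`, obtained from a direct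
summand of the direct sum of their right adjoints. -/
def adjunctionOfSummand [IsPreadditive 𝔹] {a b : 𝔹} {n : ℕ} {X : a ⟶ b} {Y : Fin n → (a ⟶ b)}
    {Z : Fin n → (b ⟶ a)} (A : ∀ t, Y t ⊣ Z t) {s : ∀ t, X ⟶ Y t} {p : ∀ t, Y t ⟶ X}
    (hsp : ∑ t, s t ≫ p t = 𝟙 X) {R : b ⟶ a} {i : ∀ t, R ⟶ Z t} {q : ∀ t, Z t ⟶ R}
    (hiq : ∑ t, i t ≫ q t = 𝟙 R)
    (hqi : ∀ t u, q t ≫ i u = conjugateEquiv (A t) (A u) (p u ≫ s t)) : X ⊣ R :=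
  -- The new unit and counit are sums over the Y t. In each of the three identities `hqi` replaces q
  -- ≫ i by a mate, the mate is moved across the adjunction, and the sum collapses by `hsp` or
  -- `hiq`.
  have h1 u : (∑ t, (A t).unit ≫ p t ▷ Z t ≫ X ◁ q t) ≫ X ◁ i u = (A u).unit ≫ p u ▷ Z u := by
    rw [Preadditive.sum_comp]
    trans ∑ t, (A u).unit ≫ (p u ≫ s t ≫ p t) ▷ Z u
    · refine Finset.sum_congr rfl fun t _ => ?_
      simp only [Category.assoc, ← whiskerLeft_comp]
      rw [hqi, ← whisker_exchange, ← Category.assoc, unit_conjugateEquiv]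
      simp
    · rw [← Preadditive.comp_sum, ← IsPreadditive.sum_whiskerRight, ← Preadditive.comp_sum, hsp,
        Category.comp_id]
  have h2 u : (∑ t, (A t).unit ≫ p t ▷ Z t ≫ X ◁ q t) ≫ s u ▷ R = (A u).unit ≫ Y u ◁ q u := by
    rw [Preadditive.sum_comp]
    trans ∑ t, (A u).unit ≫ Y u ◁ (q u ≫ i t ≫ q t)
    · refine Finset.sum_congr rfl fun t _ => ?_
      simp only [Category.assoc, whisker_exchange, ← comp_whiskerRight_assoc]
      rw [← Category.assoc (q u), hqi, whiskerLeft_comp, ← Category.assoc ((A u).unit),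
        unit_conjugateEquiv, Category.assoc]
    · rw [← Preadditive.comp_sum, ← IsPreadditive.whiskerLeft_sum, ← Preadditive.comp_sum, hiq,
        Category.comp_id]
  have h3 u : q u ▷ X ≫ (∑ t, i t ▷ X ≫ Z t ◁ s t ≫ (A t).counit) = Z u ◁ s u ≫ (A u).counit := by
    rw [Preadditive.comp_sum]
    trans ∑ t, Z u ◁ (s t ≫ p t ≫ s u) ≫ (A u).counit
    · refine Finset.sum_congr rfl fun t _ => ?_
      rw [← comp_whiskerRight_assoc, hqi, ← whisker_exchange_assoc, conjugateEquiv_counit]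
      simp
    · rw [← Preadditive.sum_comp, ← IsPreadditive.whiskerLeft_sum]
      simp only [← Category.assoc (s _)]
      rw [← Preadditive.sum_comp, hsp, Category.id_comp]
  { unit := ∑ t, (A t).unit ≫ p t ▷ Z t ≫ X ◁ q t
    counit := ∑ t, i t ▷ X ≫ Z t ◁ s t ≫ (A t).counit
    left_triangle := by
      rw [leftZigzag_eq, IsPreadditive.whiskerLeft_sum, Preadditive.comp_sum, Preadditive.comp_sum]
      simp only [fun t => left_triangle_summand (A t) (s := s t) (h1 t)]
      rw [← Preadditive.comp_sum, ← Preadditive.sum_comp, hsp, Category.id_comp]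
    right_triangle := by
      rw [rightZigzag_eq]
      -- Decomposing the identity of R breaks the right zigzag into the terms of
      -- `right_triangle_summand`.
      have h4 : (𝟙 R) ▷ 𝟙 a = ∑ t, (i t ≫ q t) ▷ 𝟙 a := by
        rw [← IsPreadditive.sum_whiskerRight, hiq]
      rw [id_whiskerRight] at h4
      rw [← Category.id_comp (R ◁ _ ≫ _), h4, Preadditive.sum_comp]
      simp only [fun t => right_triangle_summand (A t) (i := i t) (h2 t) (h3 t)]
      rw [← Preadditive.comp_sum, ← Preadditive.sum_comp, hiq, Category.id_comp] }

/-- A direct summand of a direct sum of 1-morphisms with right adjoints has a right adjoint. -/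
lemma exists_adjunction_of_summand [IsPreadditive 𝔹] {a b : 𝔹} [HasFiniteBiproducts (b ⟶ a)]
    [IsIdempotentComplete (b ⟶ a)] {X : a ⟶ b}
    (hX : SumRetract (fun Y => ∃ Z, Nonempty (Bicategory.Adjunction Y Z)) X) :
    ∃ R, Nonempty (Bicategory.Adjunction X R) := by
  obtain ⟨n, Y, s, p, hY, hsp⟩ := hX
  choose Z A using hY
  have A t := (A t).some
  -- X is the image of the idempotent matrix with entries p u ≫ s t on the sum of the Y t. M is its
  -- mate, with rows and columns exchanged, and its image is the right adjoint.
  let M : (⨁ Z) ⟶ ⨁ Z := biproduct.matrix fun t u => conjugateEquiv (A t) (A u) (p u ≫ s t)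
  have hM : M ≫ M = M := by
    ext v u
    have h : ∑ t, conjugateEquiv (A u) (A t) (p t ≫ s u) ≫
        conjugateEquiv (A t) (A v) (p v ≫ s t) = conjugateEquiv (A u) (A v) (p v ≫ s u) := by
      simp only [conjugateEquiv_comp]
      rw [← conjugateEquiv_sum]
      simp only [Category.assoc]
      rw [← Preadditive.comp_sum]
      simp only [← Category.assoc (s _)]
      rw [← Preadditive.sum_comp, hsp, Category.id_comp]
    simp only [M, biproduct.ι_matrix_assoc, Category.assoc, biproduct.matrix_π,
      biproduct.lift_desc, biproduct.ι_desc]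
    exact h
  obtain ⟨R, i, q, hiq, hqi⟩ := IsIdempotentComplete.idempotents_split _ M hM
  refine ⟨R, ⟨adjunctionOfSummand A hsp (i := fun t => i ≫ biproduct.π Z t)
    (q := fun t => biproduct.ι Z t ≫ q) ?_ ?_⟩⟩
  · simp only [Category.assoc]
    rw [← hiq, ← Preadditive.comp_sum]
    simp only [← Category.assoc (biproduct.π _ _)]
    rw [← Preadditive.sum_comp, biproduct.total, Category.id_comp]
  · intro t u
    simp [reassoc_of% hqi, M]

end CategoryTheory.Bicategory

/-! ### Existence of right adjoints in the extension -/

namespace TwoSemicat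

variable {k : Type x} [Field k] {B : Type w} {D : TwoSemicat.{v, u} k B}
  {one : ∀ i : B, D.Hom i i} {W : ∀ i, WeakUnit D (one i)}

instance : Bicategory.IsPreadditive (Obj W) where
  preadditive i j := D.preadditive i j
  whiskerLeft_sum f _ _ _ η := sum_whiskerRight f Finset.univ η
  sum_whiskerRight h _ η := whiskerLeft_sum h Finset.univ η

/-- A 1-morphism with a right adjoint. -/
def HasRightAdjoint (W : ∀ i, WeakUnit D (one i)) {i j : B} (F : D.Hom i j) : Prop :=
  ∃ G : D.Hom j i, Nonempty (Bicategory.Adjunction (toHom W F) (toHom W G))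

lemma hasRightAdjoint_of_sumRetract {i j : B} (h1 : HasFiniteBiproducts (D.Hom j i))
    (h2 : IsIdempotentComplete (D.Hom j i)) {F : D.Hom i j}
    (h : SumRetract (fun G => HasRightAdjoint W G) F) : HasRightAdjoint W F :=
  @Bicategory.exists_adjunction_of_summand (Obj W) _ _ _ _ h1 h2 F h

section Hat

variable {C : TwoSemicat.{v, u} k B} {U : BilaxUnits C} {E : ∀ i, UnitCoequalizer U i}
  (hE : HatClosed E) (hL : ∀ i, (U.lax i).IsSplit)

/-- The generators have right adjoints, F from the adjoint pair of `C` and `1_i` being its own, and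
these pass to summands of sums. Isomorphisms with generators are treated as retractions. -/
lemma hat_hasRightAdjoint (S : FiaxStructure U) (hU : ∀ i j, IsFinitaryCategory k (C.Hom i j))
    (h : ∀ i j, IsFinitaryCategory k ((hat E hE).Hom i j)) {i j : B} (F : (hat E hE).Hom i j) :
    HasRightAdjoint (hatWeakUnit hE hL) F := by
  refine hasRightAdjoint_of_sumRetract (h j i).hasFiniteBiproducts (h j i).isIdempotentComplete
    (SumRetract.bind (P := fun X : (hat E hE).Hom i j => IsGen E i j X.obj) ?_ ?_)
  · have key : ∀ {a b : B} {X : C.projAb.Hom a b} (hX : IsHat E a b X), IsGen E a b X →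
        SumRetract (fun G : (hat E hE).Hom a b => HasRightAdjoint (hatWeakUnit hE hL) G)
          (⟨X, hX⟩ : (IsHat E a b).FullSubcategory) := by
      intro a b X hX hg
      cases hg with
      | embed G f =>
        have e : (⟨X, hX⟩ : (IsHat E a b).FullSubcategory) ≅ (hatEmbed E hE a b).obj G :=
          (IsHat E a b).isoMk f
        exact SumRetract.retract (A := (hat E hE).Hom a b) (Retract.ofIso e)
          (SumRetract.of_mem ⟨_, ⟨(S.adj G).hatAdj hE hL⟩⟩)
      | @one X f =>
        have e : (⟨X, hX⟩ : (IsHat E a a).FullSubcategory) ≅ hatOne E hE a :=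
          (IsHat E a a).isoMk f
        exact SumRetract.retract (A := (hat E hE).Hom a a) (Retract.ofIso e)
          (SumRetract.of_mem ⟨_, ⟨Bicategory.Adjunction.id
            (show Obj (hatWeakUnit hE hL) from a)⟩⟩)
    exact fun X hX => key X.property hX
  · obtain ⟨n, Y, s, p, hY, e⟩ := F.property.sumRetract
    refine ⟨n, fun t => (⟨Y t, (isHat_iff hU).2 (SumRetract.of_mem (hY t))⟩ :
      (IsHat E i j).FullSubcategory), fun t => ObjectProperty.homMk (s t),
      fun t => ObjectProperty.homMk (p t), hY, ObjectProperty.hom_ext _ ?_⟩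
    exact ((IsHat E i j).ι.map_sum _ _).trans e

end Hat

end TwoSemicat

namespace CategoryTheory.Bicategory

open _root_.CategoryTheory.Bicategory

variable {𝔹 : Type w} [Bicategory.{v, u} 𝔹]

/-! ## Comparison of compatible isomorphisms with the canonical ones -/

section

variable {a b c d : 𝔹}

lemma comp_conj_nat_left {f : a ⟶ b} {g g' : b ⟶ c} {rf : b ⟶ a} {rg rg' : c ⟶ b} {r r' : c ⟶ a}
    (Af : f ⊣ rf) (Ag : g ⊣ rg) (Ag' : g' ⊣ rg') (A : f ≫ g ⊣ r) (A' : f ≫ g' ⊣ r')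
    {m : r ⟶ rg ≫ rf} {m' : r' ⟶ rg' ≫ rf} (η : g ⟶ g')
    (h : conjugateEquiv A' A (f ◁ η) ≫ m = m' ≫ conjugateEquiv Ag' Ag η ▷ rf) :
    f ◁ η ≫ (conjugateEquiv A' (Af.comp Ag')).symm m' =
      (conjugateEquiv A (Af.comp Ag)).symm m ≫ f ◁ η := by
  apply (conjugateEquiv A' (Af.comp Ag)).injective
  rw [← conjugateEquiv_comp A' (Af.comp Ag') (Af.comp Ag), ← conjugateEquiv_comp A' A (Af.comp Ag),
    Equiv.apply_symm_apply, Equiv.apply_symm_apply, conjugateEquiv_whiskerLeft, h]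

lemma comp_conj_nat_right {f f' : a ⟶ b} {g : b ⟶ c} {rf rf' : b ⟶ a} {rg : c ⟶ b} {r r' : c ⟶ a}
    (Af : f ⊣ rf) (Af' : f' ⊣ rf') (Ag : g ⊣ rg) (A : f ≫ g ⊣ r) (A' : f' ≫ g ⊣ r')
    {m : r ⟶ rg ≫ rf} {m' : r' ⟶ rg ≫ rf'} (η : f ⟶ f')
    (h : conjugateEquiv A' A (η ▷ g) ≫ m = m' ≫ rg ◁ conjugateEquiv Af' Af η) :
    η ▷ g ≫ (conjugateEquiv A' (Af'.comp Ag)).symm m' =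
      (conjugateEquiv A (Af.comp Ag)).symm m ≫ η ▷ g := by
  apply (conjugateEquiv A' (Af.comp Ag)).injective
  rw [← conjugateEquiv_comp A' (Af'.comp Ag) (Af.comp Ag), ← conjugateEquiv_comp A' A (Af.comp Ag),
    Equiv.apply_symm_apply, Equiv.apply_symm_apply, conjugateEquiv_whiskerRight, h]

lemma conjugateEquiv_associator_inv {f : a ⟶ b} {g : b ⟶ c} {h : c ⟶ d} {rf : b ⟶ a} {rg : c ⟶ b}
    {rh : d ⟶ c} (Af : f ⊣ rf) (Ag : g ⊣ rg) (Ah : h ⊣ rh) :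
    conjugateEquiv ((Af.comp Ag).comp Ah) (Af.comp (Ag.comp Ah)) (α_ f g h).inv =
      (α_ rh rg rf).inv := by
  rw [← cancel_epi (α_ rh rg rf).hom, Iso.hom_inv_id, ← conjugateEquiv_associator_hom Af Ag Ah,
    conjugateEquiv_comp, Iso.inv_hom_id, conjugateEquiv_id]

/-- Coherence of a family of isomorphisms m between duals of composites says, after taking mates,
that the discrepancies with the canonical isomorphisms satisfy the cocycle condition. The two lemmas
`comp_conj_nat_left` and `comp_conj_nat_right` treat naturality in the same way. -/
lemma comp_conj_cocycle {f : a ⟶ b} {g : b ⟶ c} {h : c ⟶ d} {rf : b ⟶ a} {rg : c ⟶ b} {rh : d ⟶ c}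
    {rfg : c ⟶ a} {rgh : d ⟶ b} {r r' : d ⟶ a} (Af : f ⊣ rf) (Ag : g ⊣ rg) (Ah : h ⊣ rh)
    (Afg : f ≫ g ⊣ rfg) (Agh : g ≫ h ⊣ rgh) (A : (f ≫ g) ≫ h ⊣ r) (A' : f ≫ (g ≫ h) ⊣ r')
    {m : rfg ⟶ rg ≫ rf} {m' : rgh ⟶ rh ≫ rg} {n : r ⟶ rh ≫ rfg} {n' : r' ⟶ rgh ≫ rf}
    (H : conjugateEquiv A A' (α_ f g h).inv ≫ n' ≫ m' ▷ rf =
      n ≫ rh ◁ m ≫ (α_ rh rg rf).inv) :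
    f ◁ (conjugateEquiv Agh (Ag.comp Ah)).symm m' ≫ (conjugateEquiv A' (Af.comp Agh)).symm n' ≫
        (α_ f g h).inv =
      (α_ f g h).inv ≫ (conjugateEquiv Afg (Af.comp Ag)).symm m ▷ h ≫
        (conjugateEquiv A (Afg.comp Ah)).symm n := by
  apply (conjugateEquiv A (Af.comp (Ag.comp Ah))).injective
  rw [← conjugateEquiv_comp A (Af.comp Agh) (Af.comp (Ag.comp Ah)),
    ← conjugateEquiv_comp A A' (Af.comp Agh), conjugateEquiv_whiskerLeft,
    ← conjugateEquiv_comp A ((Af.comp Ag).comp Ah) (Af.comp (Ag.comp Ah)),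
    ← conjugateEquiv_comp A (Afg.comp Ah) ((Af.comp Ag).comp Ah), conjugateEquiv_whiskerRight,
    conjugateEquiv_associator_inv]
  simp only [Equiv.apply_symm_apply, Category.assoc]
  exact H

lemma conjugateEquiv_comp_id {f : a ⟶ b} {g : b ⟶ c} {rf rf' : b ⟶ a} {rg rg' : c ⟶ b}
    (Af : f ⊣ rf) (Af' : f ⊣ rf') (Ag : g ⊣ rg) (Ag' : g ⊣ rg') :
    conjugateEquiv (Af.comp Ag) (Af'.comp Ag') (𝟙 (f ≫ g)) =
      rg ◁ conjugateEquiv Af Af' (𝟙 f) ≫ conjugateEquiv Ag Ag' (𝟙 g) ▷ rf' := by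
  rw [← conjugateEquiv_whiskerLeft Af' Ag Ag', ← conjugateEquiv_whiskerRight Af Af' Ag,
    conjugateEquiv_comp]
  simp

end

/-! ## Double duals -/

namespace SemiFunctor

variable (T : SemiFunctor 𝔹)

/-- The action on invertible 2-morphisms. -/
@[simps]
def mapIso {a b : 𝔹} {f g : a ⟶ b} (e : f ≅ g) : T.N f ≅ T.N g where
  hom := T.M e.hom
  inv := T.M e.inv
  hom_inv_id := by rw [← T.M_comp, e.hom_inv_id, T.M_id]
  inv_hom_id := by rw [← T.M_comp, e.inv_hom_id, T.M_id]

variable {T} {J : 𝔹 → 𝔹 → Type*} {ι : ∀ {a b : 𝔹}, J a b → (a ⟶ b)}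
  (φ : ∀ {a b : 𝔹} (F : J a b), T.N (ι F) ≅ ι F)

/-- Extension of a family of isomorphisms to the closure under isomorphisms. -/
noncomputable def extend {a b : 𝔹} (f : a ⟶ b) (hf : ∃ F : J a b, Nonempty (f ≅ ι F)) : T.N f ≅ f :=
  T.mapIso hf.choose_spec.some ≪≫ φ hf.choose ≪≫ hf.choose_spec.some.symm

variable (hφ : ∀ {a b : 𝔹} {F G : J a b} (γ : ι F ⟶ ι G),
    T.M γ ≫ (φ G).hom = (φ F).hom ≫ γ)
include hφ

/-- By naturality of φ the extension does not depend on the chosen isomorphism with a model, so any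
convenient one may be used. -/
lemma extend_hom {a b : 𝔹} (f : a ⟶ b) (hf : ∃ F : J a b, Nonempty (f ≅ ι F)) {F : J a b}
    (e : f ≅ ι F) : (extend @φ f hf).hom = T.M e.hom ≫ (φ F).hom ≫ e.inv := by
  have h := hφ (e.inv ≫ hf.choose_spec.some.hom)
  rw [T.M_comp, Category.assoc] at h
  have h1 : T.M e.hom ≫ T.M e.inv = 𝟙 _ := by rw [← T.M_comp, e.hom_inv_id, T.M_id]
  simp only [extend, Iso.trans_hom, mapIso_hom, Iso.symm_hom]
  rw [← Category.id_comp (T.M hf.choose_spec.some.hom), ← h1, Category.assoc, Category.assoc,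
    reassoc_of% h, Iso.hom_inv_id, Category.comp_id]

lemma extend_naturality {a b : 𝔹} {f g : a ⟶ b} (hf : ∃ F : J a b, Nonempty (f ≅ ι F))
    (hg : ∃ F : J a b, Nonempty (g ≅ ι F)) (γ : f ⟶ g) :
    T.M γ ≫ (extend @φ g hg).hom = (extend @φ f hf).hom ≫ γ := by
  obtain ⟨F, ⟨e⟩⟩ := id hf
  obtain ⟨G, ⟨e'⟩⟩ := id hg
  have h := hφ (e.inv ≫ γ ≫ e'.hom)
  have h1 : T.M e.hom ≫ T.M e.inv = 𝟙 _ := by rw [← T.M_comp, e.hom_inv_id, T.M_id]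
  rw [extend_hom @φ hφ f hf e, extend_hom @φ hφ g hg e']
  simp only [Category.assoc]
  rw [← cancel_mono e'.hom]
  simp only [Category.assoc, Iso.inv_hom_id, Category.comp_id]
  rw [← h, T.M_comp, T.M_comp, Category.assoc, Category.assoc, reassoc_of% h1]

lemma extend_comp
    (hc : ∀ {a b c : 𝔹} (F : J a b) (G : J b c), ∃ (H : J a c) (e : ι F ≫ ι G ≅ ι H),
      T.M e.hom ≫ (φ H).hom ≫ e.inv =
        (T.ν (ι F) (ι G)).hom ≫ (φ F).hom ▷ T.N (ι G) ≫ ι F ◁ (φ G).hom)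
    {a b c : 𝔹} (f : a ⟶ b) (g : b ⟶ c) (hf : ∃ F : J a b, Nonempty (f ≅ ι F))
    (hg : ∃ F : J b c, Nonempty (g ≅ ι F)) (hfg : ∃ F : J a c, Nonempty (f ≫ g ≅ ι F)) :
    (extend @φ (f ≫ g) hfg).hom = (T.ν f g).hom ≫ (extend @φ f hf).hom ▷ T.N g ≫
      f ◁ (extend @φ g hg).hom := by
  obtain ⟨F, ⟨e⟩⟩ := id hf
  obtain ⟨G, ⟨e'⟩⟩ := id hg
  obtain ⟨H, κ, h⟩ := hc F G
  rw [extend_hom @φ hφ f hf e, extend_hom @φ hφ g hg e',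
    extend_hom @φ hφ (f ≫ g) hfg (whiskerRightIso e g ≪≫ whiskerLeftIso _ e' ≪≫ κ)]
  simp only [Iso.trans_hom, whiskerRightIso_hom, whiskerLeftIso_hom, T.M_comp, Category.assoc,
    Iso.trans_inv, whiskerRightIso_inv, whiskerLeftIso_inv]
  rw [reassoc_of% h, reassoc_of% T.nat_left, reassoc_of% T.nat_right]
  simp only [comp_whiskerRight, whiskerLeft_comp, Category.assoc]
  simp only [← whisker_exchange, ← whisker_exchange_assoc]

end SemiFunctor

/-- Compatibility of an isomorphism from the double dual to the identity with composition, given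
partial models `f'`, `g'`, … of the duals. -/
lemma DualStructure.double_comp (T : DualStructure 𝔹) {a b c : 𝔹} {f f'' : a ⟶ b} {g g'' : b ⟶ c}
    {f' : b ⟶ a} {g' : c ⟶ b} {h' : c ⟶ a} {h'' p : a ⟶ c} (θf : f' ≅ T.R f) (θf' : f'' ≅ T.R f')
    (θg : g' ≅ T.R g) (θg' : g'' ≅ T.R g') (θh : h' ≅ T.R (f ≫ g)) (θh' : h'' ≅ T.R h')
    (θp : p ≅ T.R (g' ≫ f')) (m : h' ≅ g' ≫ f') (mp : p ≅ f'' ≫ g'') (n : h'' ⟶ p)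
    (df : f'' ⟶ f) (dg : g'' ⟶ g) (dh : h'' ⟶ f ≫ g)
    (H1 : θh.hom ≫ (T.μ f g).hom = m.hom ≫ g' ◁ θf.hom ≫ θg.hom ▷ T.R f)
    (H2 : θp.hom ≫ (T.μ g' f').hom = mp.hom ≫ f'' ◁ θg'.hom ≫ θf'.hom ▷ T.R g')
    (H3 : n ≫ θp.hom = θh'.hom ≫ T.M m.inv)
    (H4 : dh = n ≫ mp.hom ≫ f'' ◁ dg ≫ df ▷ g) :
    T.M θh.hom ≫ θh'.inv ≫ dh =
      (T.double.ν f g).hom ≫ (T.M θf.hom ≫ θf'.inv ≫ df) ▷ T.double.N g ≫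
        f ◁ (T.M θg.hom ≫ θg'.inv ≫ dg) := by
  have h1 : θh.hom = (m.hom ≫ g' ◁ θf.hom ≫ θg.hom ▷ T.R f) ≫ (T.μ f g).inv := by
    rw [← H1, Category.assoc, Iso.hom_inv_id, Category.comp_id]
  -- The comparison n is determined by H3 as the model of the dual of m; this eliminates the models
  -- of the composite in favour of p.
  have h3 : T.M m.hom ≫ θh'.inv ≫ n = θp.inv := by
    rw [← cancel_mono θp.hom, Category.assoc, Category.assoc, H3, Iso.inv_hom_id_assoc,
      ← T.M_comp, Iso.inv_hom_id, T.M_id, Iso.inv_hom_id]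
  have h2 : θp.inv ≫ mp.hom = (T.μ g' f').hom ≫ θf'.inv ▷ T.R g' ≫ f'' ◁ θg'.inv := by
    rw [Iso.inv_comp_eq, reassoc_of% H2]
    simp
  have n1 := T.nat_left g' θf.hom
  have n2 := T.nat_right θg.hom (T.R f)
  rw [h1, H4]
  simp only [T.M_comp, Category.assoc]
  rw [reassoc_of% h3, reassoc_of% h2, reassoc_of% n1, reassoc_of% n2]
  change _ = (T.M (T.μ f g).inv ≫ (T.μ (T.R g) (T.R f)).hom) ≫
    (T.M θf.hom ≫ θf'.inv ≫ df) ▷ T.R (T.R g) ≫ f ◁ (T.M θg.hom ≫ θg'.inv ≫ dg)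
  simp only [Category.assoc, comp_whiskerRight, whiskerLeft_comp]
  simp only [← whisker_exchange, ← whisker_exchange_assoc]

end CategoryTheory.Bicategory

namespace TwoSemicat

variable {k : Type x} [Field k] {B : Type w}

/-! ## Cocycles -/

/-- A natural family of automorphisms of the horizontal composites which satisfies the cocycle
condition. -/
structure HCocycle (C : TwoSemicat.{v, u} k B) where
  ψ : ∀ {i j m : B} (G : C.Hom j m) (F : C.Hom i j), G ⊚ F ≅ G ⊚ F
  nat_left : ∀ {i j m : B} {G G' : C.Hom j m} (g : G ⟶ G') (F : C.Hom i j),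
    (g ▷ₛ F) ≫ (ψ G' F).hom = (ψ G F).hom ≫ (g ▷ₛ F)
  nat_right : ∀ {i j m : B} (G : C.Hom j m) {F F' : C.Hom i j} (f : F ⟶ F'),
    (G ◁ₛ f) ≫ (ψ G F').hom = (ψ G F).hom ≫ (G ◁ₛ f)
  cocycle : ∀ {i j m n : B} (H : C.Hom m n) (G : C.Hom j m) (F : C.Hom i j),
    ((ψ H G).hom ▷ₛ F) ≫ (ψ (H ⊚ G) F).hom ≫ (assoc H G F).hom =
      (assoc H G F).hom ≫ (H ◁ₛ (ψ G F).hom) ≫ (ψ H (G ⊚ F)).hom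

namespace HCocycle

section

variable {C : TwoSemicat.{v, u} k B} (c : HCocycle C)

lemma hom_mem {i j m : B} (P : ProjAb k (C.Hom j m)) (Q : ProjAb k (C.Hom i j)) :
    (c.ψ P.X Q.X).hom ∈ ProjAb.admissible (C.projAbHcomp P Q) (C.projAbHcomp P Q) :=
  mem_admissible_hcomp (R := C.projAbHcomp P Q)
    (fun y hy => by
      rw [c.nat_right]
      exact ProjAb.comp_mem_null _ _ (whiskerLeft_mem_null P (mem_null_self Q hy)))
    (fun y hy => by
      rw [c.nat_left]
      exact ProjAb.comp_mem_null _ _ (whiskerRight_mem_null Q (mem_null_self P hy)))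

lemma inv_mem {i j m : B} (P : ProjAb k (C.Hom j m)) (Q : ProjAb k (C.Hom i j)) :
    (c.ψ P.X Q.X).inv ∈ ProjAb.admissible (C.projAbHcomp P Q) (C.projAbHcomp P Q) :=
  mem_admissible_hcomp (R := C.projAbHcomp P Q)
    (fun y hy => by
      rw [show (P.X ◁ₛ y.2) ≫ (c.ψ P.X Q.X).inv = (c.ψ P.X y.1).inv ≫ (P.X ◁ₛ y.2) by
        rw [Iso.comp_inv_eq, Category.assoc, c.nat_right, Iso.inv_hom_id_assoc]]
      exact ProjAb.comp_mem_null _ _ (whiskerLeft_mem_null P (mem_null_self Q hy)))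
    (fun y hy => by
      rw [show (y.2 ▷ₛ Q.X) ≫ (c.ψ P.X Q.X).inv = (c.ψ y.1 Q.X).inv ≫ (y.2 ▷ₛ Q.X) by
        rw [Iso.comp_inv_eq, Category.assoc, c.nat_left, Iso.inv_hom_id_assoc]]
      exact ProjAb.comp_mem_null _ _ (whiskerRight_mem_null Q (mem_null_self P hy)))

/-- A cocycle extends to the projective abelianization. -/
def projAb : HCocycle C.projAb where
  ψ P Q :=
    { hom := ProjAb.homMk _ (c.hom_mem P Q)
      inv := ProjAb.homMk _ (c.inv_mem P Q)
      hom_inv_id := ProjAb.homMk_congr (c.ψ P.X Q.X).hom_inv_id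
      inv_hom_id := ProjAb.homMk_congr (c.ψ P.X Q.X).inv_hom_id }
  nat_left g F := by
    obtain ⟨g, hg, rfl⟩ := ProjAb.homMk_surjective g
    exact ProjAb.homMk_congr (c.nat_left _ _)
  nat_right G _ _ f := by
    obtain ⟨f, hf, rfl⟩ := ProjAb.homMk_surjective f
    exact ProjAb.homMk_congr (c.nat_right _ _)
  cocycle H G F := ProjAb.homMk_congr (c.cocycle _ _ _)

/-- A cocycle restricts to full sub-2-semicategories. -/
def full {P : ∀ i j : B, ObjectProperty (C.Hom i j)}
    (hP : ∀ {i j m : B} (G : C.Hom j m) (F : C.Hom i j), P j m G → P i j F → P i m (G ⊚ F)) :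
    HCocycle (C.full P hP) where
  ψ G F := ObjectProperty.isoMk _ (c.ψ G.obj F.obj)
  nat_left g F := ObjectProperty.hom_ext _ (c.nat_left g.hom F.obj)
  nat_right G _ _ f := ObjectProperty.hom_ext _ (c.nat_right G.obj f.hom)
  cocycle H G F := ObjectProperty.hom_ext _ (c.cocycle H.obj G.obj F.obj)

lemma toCocycle {one : ∀ i : B, C.Hom i i} (W : ∀ i, WeakUnit C (one i)) :
    Bicategory.Cocycle (𝔹 := Obj W) (fun {_ _ _} F G => c.ψ G F) where
  nat_left F _ _ g := c.nat_left g F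
  nat_right f G := c.nat_right G f
  cocycle F G H := c.cocycle H G F

end

end HCocycle

section Hat

variable {C : TwoSemicat.{v, u} k B} {U : BilaxUnits C} {E : ∀ i, UnitCoequalizer U i}
  (hE : HatClosed E) (hL : ∀ i, (U.lax i).IsSplit) (S : FiaxStructure U)

instance (i j : B) : (hatEmbed E hE i j).Full :=
  inferInstanceAs ((IsHat E i j).lift (C.embed i j) (fun F => isHat_embed E F)).Full

instance (i j : B) : (hatEmbed E hE i j).Faithful :=
  inferInstanceAs ((IsHat E i j).lift (C.embed i j) (fun F => isHat_embed E F)).Faithful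

/-- The adjunctions of the extension which are given by the adjoint pairs of `C`. -/
noncomputable abbrev hatAdj {i j : B} (F : C.Hom i j) :=
  (S.adj F).hatAdj hE hL

/-- The isomorphism `S.μ`, as an isomorphism of the extension. -/
noncomputable def hatμ {i j m : B} (G : C.Hom j m) (F : C.Hom i j) :
    toHom (hatWeakUnit hE hL) ((hatEmbed E hE m i).obj (S.obj (G ⊚ F))) ≅
      CategoryStruct.comp (toHom (hatWeakUnit hE hL) ((hatEmbed E hE m j).obj (S.obj G)))
        (toHom (hatWeakUnit hE hL) ((hatEmbed E hE j i).obj (S.obj F))) :=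
  (hatEmbed E hE m i).mapIso (S.μ G F)

/-- The automorphism of `G ⊚ F`, in the extension, which compares `S.μ` with the canonical
isomorphism between right adjoints. -/
noncomputable def hatψ {i j m : B} (G : C.Hom j m) (F : C.Hom i j) :
    (hatEmbed E hE i m).obj (G ⊚ F) ≅ (hatEmbed E hE i m).obj (G ⊚ F) :=
  (Bicategory.conjugateIsoEquiv (hatAdj hE hL S (G ⊚ F))
    ((hatAdj hE hL S F).comp (hatAdj hE hL S G))).symm (hatμ hE hL S G F)

/-- The axiom of `S` in `C`, transported by the embedding; `mate_hatAdj` turns its values on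
2-morphisms into mates. -/
lemma hatμ_naturality_left {i j m : B} {G G' : C.Hom j m} (g : G ⟶ G') (F : C.Hom i j) :
    mate (hatAdj hE hL S (G ⊚ F)) (hatAdj hE hL S (G' ⊚ F))
        ((hatEmbed E hE j m).map g ▷ₛ (hatEmbed E hE i j).obj F) ≫ (hatμ hE hL S G F).hom =
      (hatμ hE hL S G' F).hom ≫ ((hatEmbed E hE j i).obj (S.obj F) ◁ₛ
        mate (hatAdj hE hL S G) (hatAdj hE hL S G') ((hatEmbed E hE j m).map g)) := by
  have h1 := S.mate_hatAdj hE hL g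
  have h2 := S.mate_hatAdj hE hL (g ▷ₛ F)
  have h3 := congrArg (hatEmbed E hE m i).map (S.μ_naturality_left g F)
  rw [Functor.map_comp, Functor.map_comp] at h3
  refine (congrArg (· ≫ (hatμ hE hL S G F).hom) h2).trans (h3.trans ?_)
  exact congrArg (fun t => (hatμ hE hL S G' F).hom ≫
    (hat E hE).whiskerLeft ((hatEmbed E hE j i).obj (S.obj F)) t) h1.symm

lemma hatμ_naturality_right {i j m : B} (G : C.Hom j m) {F F' : C.Hom i j} (f : F ⟶ F') :
    mate (hatAdj hE hL S (G ⊚ F)) (hatAdj hE hL S (G ⊚ F'))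
        ((hatEmbed E hE j m).obj G ◁ₛ (hatEmbed E hE i j).map f) ≫ (hatμ hE hL S G F).hom =
      (hatμ hE hL S G F').hom ≫ (mate (hatAdj hE hL S F) (hatAdj hE hL S F')
        ((hatEmbed E hE i j).map f) ▷ₛ (hatEmbed E hE m j).obj (S.obj G)) := by
  have h1 := S.mate_hatAdj hE hL f
  have h2 := S.mate_hatAdj hE hL (G ◁ₛ f)
  have h3 := congrArg (hatEmbed E hE m i).map (S.μ_naturality_right G f)
  rw [Functor.map_comp, Functor.map_comp] at h3
  refine (congrArg (· ≫ (hatμ hE hL S G F).hom) h2).trans (h3.trans ?_)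
  exact congrArg (fun t => (hatμ hE hL S G F').hom ≫
    (hat E hE).whiskerRight t ((hatEmbed E hE m j).obj (S.obj G))) h1.symm

lemma hatμ_assoc {i j m n : B} (H : C.Hom m n) (G : C.Hom j m) (F : C.Hom i j) :
    mate (hatAdj hE hL S ((H ⊚ G) ⊚ F)) (hatAdj hE hL S (H ⊚ G ⊚ F))
        ((hatEmbed E hE i n).map (assoc H G F).hom) ≫ (hatμ hE hL S (H ⊚ G) F).hom ≫
        ((hatEmbed E hE j i).obj (S.obj F) ◁ₛ (hatμ hE hL S H G).hom) =
      (hatμ hE hL S H (G ⊚ F)).hom ≫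
        ((hatμ hE hL S G F).hom ▷ₛ (hatEmbed E hE n m).obj (S.obj H)) ≫
          (hatEmbed E hE n i).map (assoc (S.obj F) (S.obj G) (S.obj H)).hom := by
  have h2 := S.mate_hatAdj hE hL (assoc H G F).hom
  have h3 := congrArg (hatEmbed E hE n i).map (S.μ_assoc H G F)
  simp only [Functor.map_comp] at h3
  exact (congrArg (· ≫ (hatμ hE hL S (H ⊚ G) F).hom ≫ ((hat E hE).whiskerLeft
    ((hatEmbed E hE j i).obj (S.obj F)) (hatμ hE hL S H G).hom)) h2).trans h3

/-- The cocycle which compares `S.μ` with the canonical isomorphisms between right adjoints. -/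
noncomputable def FiaxStructure.cocycle : HCocycle C where
  -- The discrepancy is formed in the extension, where adjunctions are classical, and brought back
  -- to `C` by full faithfulness. From `C` it then extends to all 1-morphisms of the abelianization.
  ψ {i j m} G F := (hatEmbed E hE i m).preimageIso (hatψ hE hL S G F)
  nat_left {i j m G G'} g F := (hatEmbed E hE i m).map_injective (by
    simp only [Functor.map_comp, Functor.preimageIso_hom, Functor.map_preimage]
    exact Bicategory.comp_conj_nat_left (hatAdj hE hL S F) (hatAdj hE hL S G)
      (hatAdj hE hL S G') (hatAdj hE hL S (G ⊚ F)) (hatAdj hE hL S (G' ⊚ F))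
      ((hatEmbed E hE j m).map g) (hatμ_naturality_left hE hL S g F))
  nat_right {i j m} G F F' f := (hatEmbed E hE i m).map_injective (by
    simp only [Functor.map_comp, Functor.preimageIso_hom, Functor.map_preimage]
    exact Bicategory.comp_conj_nat_right (hatAdj hE hL S F) (hatAdj hE hL S F')
      (hatAdj hE hL S G) (hatAdj hE hL S (G ⊚ F)) (hatAdj hE hL S (G ⊚ F'))
      ((hatEmbed E hE i j).map f) (hatμ_naturality_right hE hL S G f))
  cocycle {i j m n} H G F := (hatEmbed E hE i n).map_injective (by
    have h {i j m : B} (G : C.Hom j m) (F : C.Hom i j) :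
        (hatEmbed E hE i m).map ((hatEmbed E hE i m).preimageIso (hatψ hE hL S G F)).hom =
          (hatψ hE hL S G F).hom := by
      rw [Functor.preimageIso_hom, Functor.map_preimage]
    have key := Bicategory.comp_conj_cocycle (hatAdj hE hL S F) (hatAdj hE hL S G)
      (hatAdj hE hL S H) (hatAdj hE hL S (G ⊚ F)) (hatAdj hE hL S (H ⊚ G))
      (hatAdj hE hL S (H ⊚ G ⊚ F)) (hatAdj hE hL S ((H ⊚ G) ⊚ F)) (hatμ_assoc hE hL S H G F)
    simp only [Functor.map_comp]
    rw [h, h]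
    refine Eq.trans ?_ (key.trans ?_)
    · exact congrArg (fun t => (hat E hE).whiskerRight t ((hatEmbed E hE i j).obj F) ≫
        (hatψ hE hL S (H ⊚ G) F).hom ≫ (hatEmbed E hE i n).map (assoc H G F).hom) (h H G)
    · exact congrArg (fun t => (hatEmbed E hE i n).map (assoc H G F).hom ≫
        (hat E hE).whiskerLeft ((hatEmbed E hE m n).obj H) t ≫
          (hatψ hE hL S H (G ⊚ F)).hom) (h G F).symm)

end Hat

end TwoSemicat

/-! ### Change of right adjoints -/

namespace CategoryTheory.Bicategory

open _root_.CategoryTheory.Bicategory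

variable {𝔹 : Type w} [Bicategory.{v, u} 𝔹] {a b c : 𝔹}

lemma conjugateEquiv_id_naturality {f g : a ⟶ b} {r r' s s' : b ⟶ a}
    (A : Bicategory.Adjunction f r) (A' : Bicategory.Adjunction f r')
    (X : Bicategory.Adjunction g s) (X' : Bicategory.Adjunction g s') (γ : f ⟶ g) :
    conjugateEquiv X A γ ≫ conjugateEquiv A A' (𝟙 f) =
      conjugateEquiv X X' (𝟙 g) ≫ conjugateEquiv X' A' γ := by
  rw [conjugateEquiv_comp, conjugateEquiv_comp, Category.comp_id, Category.id_comp]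

/-- A discrepancy measured with one choice of right adjoints gives, with another choice, an
isomorphism that corresponds to m under the canonical comparisons. -/
lemma conjugateEquiv_id_comp {f : a ⟶ b} {g : b ⟶ c} {rf rf' : b ⟶ a} {rg rg' : c ⟶ b}
    {r r' : c ⟶ a} (Af : Bicategory.Adjunction f rf) (Af' : Bicategory.Adjunction f rf')
    (Ag : Bicategory.Adjunction g rg) (Ag' : Bicategory.Adjunction g rg')
    (A : Bicategory.Adjunction (f ≫ g) r) (A' : Bicategory.Adjunction (f ≫ g) r')
    (m : r ⟶ rg ≫ rf) :
    conjugateEquiv A A' (𝟙 (f ≫ g)) ≫ conjugateEquiv A' (Af'.comp Ag')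
        ((conjugateEquiv A (Af.comp Ag)).symm m) =
      m ≫ rg ◁ conjugateEquiv Af Af' (𝟙 f) ≫ conjugateEquiv Ag Ag' (𝟙 g) ▷ rf' := by
  rw [← conjugateEquiv_comp_id Af Af' Ag Ag']
  conv_rhs => rw [← (conjugateEquiv A (Af.comp Ag)).apply_symm_apply m]
  rw [conjugateEquiv_comp, conjugateEquiv_comp, Category.comp_id, Category.id_comp]

end CategoryTheory.Bicategory

namespace TwoSemicat

variable {k : Type x} [Field k] {B : Type w}
variable {C : TwoSemicat.{v, u} k B} {U : BilaxUnits C} {E : ∀ i, UnitCoequalizer U i}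
  (hE : HatClosed E) (hL : ∀ i, (U.lax i).IsSplit) (S : FiaxStructure U)

/-! ## The weak involution of the extension -/

/-- The cocycle of the extension. -/
noncomputable def hatCocycle : HCocycle (hat E hE) :=
  (S.cocycle hE hL).projAb.full hE

lemma hatCocycle_embed {i j m : B} (G : C.Hom j m) (F : C.Hom i j) :
    ((hatCocycle hE hL S).ψ ((hatEmbed E hE j m).obj G) ((hatEmbed E hE i j).obj F)).hom =
      (hatψ hE hL S G F).hom :=
  (hatEmbed E hE i m).map_preimage (hatψ hE hL S G F).hom

lemma hatCocycle_toCocycle : Bicategory.Cocycle (𝔹 := Obj (hatWeakUnit hE hL))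
    (fun {_ _ _} F G => (hatCocycle hE hL S).ψ G F) :=
  (hatCocycle hE hL S).toCocycle (hatWeakUnit hE hL)

variable (R : ∀ {i j : B}, (hat E hE).Hom i j → (hat E hE).Hom j i)
  (adj : ∀ {i j : B} (F : (hat E hE).Hom i j),
    Bicategory.Adjunction (toHom (hatWeakUnit hE hL) F) (toHom (hatWeakUnit hE hL) (R F)))

/-- The contravariant structure of the extension. -/
noncomputable abbrev hatDual : Bicategory.DualStructure (Obj (hatWeakUnit hE hL)) :=
  dualOfAdj R adj (hatCocycle_toCocycle hE hL S)

/-- The comparison of the duals. -/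
noncomputable def hatθ {i j : B} (F : C.Hom i j) :
    (hatEmbed E hE j i).obj (S.obj F) ≅ R ((hatEmbed E hE i j).obj F) :=
  Bicategory.conjugateIsoEquiv (hatAdj hE hL S F) (adj ((hatEmbed E hE i j).obj F))
    (Iso.refl (toHom (hatWeakUnit hE hL) ((hatEmbed E hE i j).obj F)))

lemma hatθ_naturality {i j : B} {F G : C.Hom i j} (γ : F ⟶ G) :
    (hatEmbed E hE j i).map (S.map γ) ≫ (hatθ hE hL S R adj F).hom =
      (hatθ hE hL S R adj G).hom ≫ mate (adj _) (adj _) ((hatEmbed E hE i j).map γ) := by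
  rw [← S.mate_hatAdj hE hL γ]
  exact Bicategory.conjugateEquiv_id_naturality (hatAdj hE hL S F)
    (adj ((hatEmbed E hE i j).obj F)) (hatAdj hE hL S G) (adj ((hatEmbed E hE i j).obj G))
    ((hatEmbed E hE i j).map γ)

/-- This is what the cocycle was built for: the canonical comparison θ of right adjoints carries the
given μ to the twisted one, so the new involution restricts to the old one compatibly with
composition. -/
lemma hatθ_hcomp {i j m : B} (G : C.Hom j m) (F : C.Hom i j) :
    (hatθ hE hL S R adj (G ⊚ F)).hom ≫ ((hatDual hE hL S R adj).μ
        (toHom _ ((hatEmbed E hE i j).obj F)) (toHom _ ((hatEmbed E hE j m).obj G))).hom =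
      (hatμ hE hL S G F).hom ≫
        ((hatθ hE hL S R adj F).hom ▷ₛ (hatEmbed E hE m j).obj (S.obj G)) ≫
          (R ((hatEmbed E hE i j).obj F) ◁ₛ (hatθ hE hL S R adj G).hom) := by
  refine Eq.trans ?_ (Bicategory.conjugateEquiv_id_comp (hatAdj hE hL S F)
    (adj ((hatEmbed E hE i j).obj F)) (hatAdj hE hL S G) (adj ((hatEmbed E hE j m).obj G))
    (hatAdj hE hL S (G ⊚ F)) (adj ((hatEmbed E hE i m).obj (G ⊚ F))) (hatμ hE hL S G F).hom)
  exact congrArg (fun t => (hatθ hE hL S R adj (G ⊚ F)).hom ≫ Bicategory.conjugateEquiv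
    (adj ((hatEmbed E hE i m).obj (G ⊚ F))) ((adj ((hatEmbed E hE i j).obj F)).comp
      (adj ((hatEmbed E hE j m).obj G))) t) (hatCocycle_embed hE hL S G F)

end TwoSemicat

/-- Naturality of an isomorphism from the double dual to the identity, given partial models `f'`,
`g'`, … of the duals. -/
lemma CategoryTheory.Bicategory.DualStructure.double_naturality {𝔹 : Type w} [Bicategory.{v, u} 𝔹]
    (T : Bicategory.DualStructure 𝔹) {a b : 𝔹} {f g f'' g'' : a ⟶ b} {f' g' : b ⟶ a}
    (θf : f' ≅ T.R f) (θf' : f'' ≅ T.R f') (θg : g' ≅ T.R g) (θg' : g'' ≅ T.R g')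
    {γ : f ⟶ g} {γ' : g' ⟶ f'} {γ'' : f'' ⟶ g''} {df : f'' ⟶ f} {dg : g'' ⟶ g}
    (H1 : γ' ≫ θf.hom = θg.hom ≫ T.M γ) (H2 : γ'' ≫ θg'.hom = θf'.hom ≫ T.M γ')
    (H3 : γ'' ≫ dg = df ≫ γ) :
    T.M (T.M γ) ≫ T.M θg.hom ≫ θg'.inv ≫ dg = (T.M θf.hom ≫ θf'.inv ≫ df) ≫ γ := by
  have h1 := congrArg T.M H1
  rw [T.M_comp, T.M_comp] at h1
  have h2 : T.M γ' ≫ θg'.inv = θf'.inv ≫ γ'' := by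
    rw [Iso.comp_inv_eq, Category.assoc, H2, Iso.inv_hom_id_assoc]
  simp only [Category.assoc]
  rw [← reassoc_of% h1, reassoc_of% h2, H3]

namespace TwoSemicat

variable {k : Type x} [Field k] {B : Type w}
variable {C : TwoSemicat.{v, u} k B} {U : BilaxUnits C} {E : ∀ i, UnitCoequalizer U i}
  (hE : HatClosed E) (hL : ∀ i, (U.lax i).IsSplit) (S : FiaxStructure U)
  (R : ∀ {i j : B}, (hat E hE).Hom i j → (hat E hE).Hom j i)
  (adj : ∀ {i j : B} (F : (hat E hE).Hom i j),
    Bicategory.Adjunction (toHom (hatWeakUnit hE hL) F) (toHom (hatWeakUnit hE hL) (R F)))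

/-- The embedding, as a map to the 1-morphisms of the bicategory. -/
noncomputable abbrev hatHom {i j : B} (F : C.Hom i j) :=
  toHom (hatWeakUnit hE hL) ((hatEmbed E hE i j).obj F)

variable (dd : S.toAntiEquivalence.DoubleDualIso)

/-- The isomorphism `dd.app`, as an isomorphism of the extension. -/
noncomputable def hatDd {i j : B} (F : C.Hom i j) :
    hatHom hE hL (S.obj (S.obj F)) ≅ hatHom hE hL F :=
  (hatEmbed E hE i j).mapIso (dd.app F)

/-- The double dual of a 1-morphism of `C`, in the extension. -/
noncomputable def hatDoubleDual {i j : B} (F : C.Hom i j) :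
    (hatDual hE hL S R adj).double.N (hatHom hE hL F) ≅ hatHom hE hL F :=
  Iso.trans ((hatDual hE hL S R adj).mapIso (hatθ hE hL S R adj F)) <|
    Iso.trans (hatθ hE hL S R adj (S.obj F)).symm (hatDd hE hL S dd F)

lemma hatDoubleDual_naturality {i j : B} {F G : C.Hom i j}
    (γ : hatHom hE hL F ⟶ hatHom hE hL G) :
    (hatDual hE hL S R adj).double.M γ ≫ (hatDoubleDual hE hL S R adj dd G).hom =
      (hatDoubleDual hE hL S R adj dd F).hom ≫ γ := by
  obtain ⟨γ, rfl⟩ := (hatEmbed E hE i j).map_surjective γ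
  have h3 := congrArg (hatEmbed E hE i j).map (dd.naturality γ)
  rw [Functor.map_comp, Functor.map_comp] at h3
  exact (hatDual hE hL S R adj).double_naturality (hatθ hE hL S R adj F)
    (hatθ hE hL S R adj (S.obj F)) (hatθ hE hL S R adj G) (hatθ hE hL S R adj (S.obj G))
    (hatθ_naturality hE hL S R adj γ) (hatθ_naturality hE hL S R adj (S.map γ)) h3

/-- Compatibility of the given ⋆⋆ ≅ Id with composition survives the replacement of the duals F⋆ by
the chosen ones, since θ respects μ at (G, F) and at their duals and is natural at μ. -/
lemma hatDoubleDual_hcomp {i j m : B} (G : C.Hom j m) (F : C.Hom i j) :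
    (hatDoubleDual hE hL S R adj dd (G ⊚ F)).hom =
      ((hatDual hE hL S R adj).double.ν (hatHom hE hL F) (hatHom hE hL G)).hom ≫
        ((hat E hE).whiskerLeft ((hatDual hE hL S R adj).double.N (hatHom hE hL G)) 
          (hatDoubleDual hE hL S R adj dd F).hom) ≫
          ((hat E hE).whiskerRight (hatDoubleDual hE hL S R adj dd G).hom
            ((hatEmbed E hE i j).obj F)) := by
  exact (hatDual hE hL S R adj).double_comp (hatθ hE hL S R adj F)
    (hatθ hE hL S R adj (S.obj F)) (hatθ hE hL S R adj G) (hatθ hE hL S R adj (S.obj G))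
    (hatθ hE hL S R adj (G ⊚ F)) (hatθ hE hL S R adj (S.obj (G ⊚ F)))
    (hatθ hE hL S R adj (S.obj F ⊚ S.obj G)) (hatμ hE hL S G F)
    (hatμ hE hL S (S.obj F) (S.obj G)) ((hatEmbed E hE i m).map (S.map (S.μ G F).inv))
    ((hatEmbed E hE i j).map (dd.app F).hom) ((hatEmbed E hE j m).map (dd.app G).hom)
    ((hatEmbed E hE i m).map (dd.app (G ⊚ F)).hom)
    (hatθ_hcomp hE hL S R adj G F)
    (hatθ_hcomp hE hL S R adj (S.obj F) (S.obj G))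
    (hatθ_naturality hE hL S R adj (S.μ G F).inv) (by
      have h := congrArg (hatEmbed E hE i m).map (dd.app_hcomp G F)
      simp only [Functor.map_comp] at h
      exact h)

lemma hatDoubleDual_refl_comp {i j m : B} (G : C.Hom j m) (F : C.Hom i j) :
    (hatDual hE hL S R adj).double.M (Iso.refl (hatHom hE hL (G ⊚ F))).hom ≫
        (hatDoubleDual hE hL S R adj dd (G ⊚ F)).hom ≫ (Iso.refl (hatHom hE hL (G ⊚ F))).inv =
      ((hatDual hE hL S R adj).double.ν (hatHom hE hL F) (hatHom hE hL G)).hom ≫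
        Bicategory.whiskerRight (hatDoubleDual hE hL S R adj dd F).hom
          ((hatDual hE hL S R adj).double.N (hatHom hE hL G)) ≫
        Bicategory.whiskerLeft (hatHom hE hL F) (hatDoubleDual hE hL S R adj dd G).hom := by
  rw [Iso.refl_hom, Iso.refl_inv, (hatDual hE hL S R adj).double.M_id, Category.comp_id,
    Category.id_comp]
  exact hatDoubleDual_hcomp hE hL S R adj dd G F

/-- The double dual of the extension is isomorphic to the identity. -/
noncomputable def hatIsoId (hU : ∀ i j, IsFinitaryCategory k (C.Hom i j)) :
    (hatDual hE hL S R adj).double.IsoId :=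
  (hatResolution hE hL hU).isoId
    (fun f hf => Bicategory.SemiFunctor.extend (J := fun i j : Obj (hatWeakUnit hE hL) => C.Hom i j)
      (ι := fun {_ _} F => hatHom hE hL F)
      (fun {_ _} F => hatDoubleDual hE hL S R adj dd F) f hf)
    (fun hf hg γ => Bicategory.SemiFunctor.extend_naturality
      (J := fun i j : Obj (hatWeakUnit hE hL) => C.Hom i j)
      (ι := fun {_ _} F => hatHom hE hL F)
      (fun {_ _} F => hatDoubleDual hE hL S R adj dd F)
      (fun {_ _ _ _} γ => hatDoubleDual_naturality hE hL S R adj dd γ) hf hg γ)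
    (fun f g hf hg => Bicategory.SemiFunctor.extend_comp
      (J := fun i j : Obj (hatWeakUnit hE hL) => C.Hom i j)
      (ι := fun {_ _} F => hatHom hE hL F)
      (fun {_ _} F => hatDoubleDual hE hL S R adj dd F)
      (fun {_ _ _ _} γ => hatDoubleDual_naturality hE hL S R adj dd γ)
      (fun {_ _ _} F G => ⟨C.hcomp G F, Iso.refl (hatHom hE hL (C.hcomp G F)),
        hatDoubleDual_refl_comp hE hL S R adj dd G F⟩) f g hf hg _)

end TwoSemicat

/-! ### The fiat structure and the theorem -/

namespace TwoSemicat

lemma exists_fiaxStructure_hat {k : Type x} [Field k] {B : Type w} {C : TwoSemicat.{v, u} k B}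
    {U : BilaxUnits C} {E : ∀ i, UnitCoequalizer U i} (hE : HatClosed E)
    (hL : ∀ i, (U.lax i).IsSplit) (S : FiaxStructure U)
    (hU : ∀ i j, IsFinitaryCategory k (C.Hom i j))
    (h : ∀ i j, IsFinitaryCategory k ((hat E hE).Hom i j)) :
    ∃ T : FiaxStructure (BilaxUnits.ofWeakUnits (hatWeakUnit hE hL)),
      ExtendsStar S.toAntiEquivalence T.toAntiEquivalence := by
  have hR {i j : B} (F : (hat E hE).Hom i j) := hat_hasRightAdjoint hE hL S hU h F
  -- The right adjoints are chosen arbitrarily, also on `C`; there they agree with the given duals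
  -- only up to θ, which is all that the extension of ⋆ asks for.
  choose R adj using @hR
  let adj' {i j : B} (F : (hat E hE).Hom i j) := (adj F).some
  obtain ⟨dd⟩ := S.doubleDual
  refine ⟨fiaxOfAdj @R @adj' (hatCocycle_toCocycle hE hL S)
    (hatIsoId hE hL S @R @adj' dd hU), fun F => hatθ hE hL S @R @adj' F,
    fun γ => hatθ_naturality hE hL S @R @adj' γ, fun {i j m} G F => ?_⟩
  -- The embedding preserves composites on the nose, so this mate compares two equal 1-morphisms
  -- with the same adjunction and is the identity.
  have hid : mate (adj' ((hatEmbed E hE j m).obj G ⊚ (hatEmbed E hE i j).obj F))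
      (adj' ((hatEmbed E hE i m).obj (G ⊚ F))) (hatEmbedComp E hE G F).inv = 𝟙 _ :=
    (hatDual hE hL S @R @adj').M_id (hatHom hE hL (G ⊚ F))
  let T := hatDual hE hL S @R @adj'
  refine (congrArg (fun t => (hatθ hE hL S @R @adj' (G ⊚ F)).hom ≫ t ≫
    (T.μ (hatHom hE hL F) (hatHom hE hL G)).hom) hid).trans ?_
  refine (congrArg ((hatθ hE hL S @R @adj' (G ⊚ F)).hom ≫ ·) (Category.id_comp _)).trans ?_
  refine (hatθ_hcomp hE hL S @R @adj' G F).trans ?_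
  exact (congrArg ((hatμ hE hL S G F).hom ≫ ·) (Category.id_comp _)).symm

end TwoSemicat

theorem mainTheorem3 {k : Type x} [Field k] [IsAlgClosed k] {B : Type w}
    (C : TwoSemicat.{v, u} k B) (hC : C.IsStrict) (U : BilaxUnits C) (hU : IsFinitary U)
    (S : FiaxStructure U) :
    (∀ i : B, Nonempty (UnitCoequalizer U i)) ∧
    ∀ E : ∀ i : B, UnitCoequalizer U i,
      ∃ hE : HatClosed E,
        (hat E hE).IsStrict ∧
        ∃ W : ∀ i : B, WeakUnit (hat E hE) (hatOne E hE i),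
          IsInducedUnit W ∧
          IsFinitary (BilaxUnits.ofWeakUnits W) ∧
          ∃ T : FiaxStructure (BilaxUnits.ofWeakUnits W),
            ExtendsStar S.toAntiEquivalence T.toAntiEquivalence := by
  have hL i := S.isSplit i
  refine ⟨fun i => ⟨stdUnitCoequalizer U i⟩, fun E => ?_⟩
  have hE : HatClosed E := hatClosed hU.finitary_hom fun i => (E i).weakUnit (hL i)
  have hF := hat_isFinitary hE hU hL (hatWeakUnit hE hL)
  exact ⟨hE, full_isStrict (projAb_isStrict hC) _ hE, hatWeakUnit hE hL,
    isInducedUnit_hatWeakUnit hE hL, hF,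
    exists_fiaxStructure_hat hE hL S hU.finitary_hom hF.finitary_hom⟩
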